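/- **Proposition.** Let $G$ be a finite simple undirected graph with $n\ge 1$ vertices, $m$ edges, maximum degree $\Delta$ and degeneracy $d$ (the smallest number such that every nonempty induced subgraph of $G$ contains a vertex of degree at most $d$), and let $\ell\ge 0$ be an integer. Write $N_2[v]$ for the set consisting of $v$, its neighbors, and all vertices that have a common neighbor with $v$. Two vertices of a graph are *incompatible* if their distance in it is larger than $2$; the *conflict graph* of a graph has the same vertices and its edges are the incompatible pairs. The *Low-Triangle Rule (LTR)* deletes, in the case of Vertex Triangle 2-Club, every vertex that is in less than $\ell$ triangles and, in the case of Edge Triangle 2-Club, every edge that is in less than $\ell$ triangles and every isolated vertex; it is applied exhaustively. The *Greedy Lower Bound (G-LB)* is the following heuristic. For every vertex $v$ of $G$, start with the graph $G_v:=G[N_2[v]]$ and apply the LTR to it. While the conflict graph of the current graph $G_v$ has an edge, choose such an edge $\{u,w\}$; if one of $u,w$ is $v$, delete the other one from $G_v$, and otherwise delete the one of $u,w$ that is in less triangles of the current $G_v$ (either of them in case of a tie); then apply the LTR to $G_v$ again. Let $S_v$ be the vertex set of the final graph. (If $v$ itself is deleted by the LTR, one may either abort with $S_v:=\emptyset$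 or continue; the statement holds for both conventions.) The G-LB returns a set $S$ of maximum size among the sets $S_v$, together with its size. Then for Vertex Triangle 2-Club and for Edge Triangle 2-Club the G-LB, given the adjacency lists of $G$ and $\ell$, can be implemented on a unit-cost random access machine with addition and subtraction such that its overall running time is $O(m\cdot\Delta^3\cdot d^2)$ if $G$ has no isolated vertices, and $O(n+m\cdot\Delta^3\cdot d^2)$ in general, where the constants in the $O$-notation are absolute (in particular independent of $G$ and $\ell$). -/

import Mathlib

/-! ## A random access machine with unit costs

Structured programs over finitely many integer registers and finitely many arrays. The arithmetic is
addition and truncated subtraction. Every register access, array access, arithmetic operation,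
assignment and test costs one step. -/

namespace RAM

/-- The memory: `reg x` is the content of register `x`, and `arr a i` is cell `i` of array `a`. -/
structure Mem where
  reg : ℕ → ℕ
  arr : ℕ → ℕ → ℕ

namespace Mem

/-- Write the number `k` into register `x`. -/
def setReg (s : Mem) (x k : ℕ) : Mem :=
  { s with reg := Function.update s.reg x k }

/-- Write the number `k` into cell `i` of array `a`. -/
def setArr (s : Mem) (a i k : ℕ) : Mem :=
  { s with arr := Function.update s.arr a (Function.update (s.arr a) i k) }

end Mem

/-- Expressions. The names of registers and arrays are fixed in the text of the program, array
indices are computed. -/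
inductive Expr where
  | const (k : ℕ)
  | reg (x : ℕ)
  | get (a : ℕ) (i : Expr)
  | add (e f : Expr)
  | sub (e f : Expr)

namespace Expr

/-- The value of an expression. -/
def eval (s : Mem) : Expr → ℕ
  | const k => k
  | reg x => s.reg x
  | get a i => s.arr a (i.eval s)
  | add e f => e.eval s + f.eval s
  | sub e f => e.eval s - f.eval s

/-- The number of steps for evaluating an expression: one for every operation in it. -/
def cost : Expr → ℕ
  | const _ => 1
  | reg _ => 1
  | get _ i => i.cost + 1
  | add e f => e.cost + f.cost + 1
  | sub e f => e.cost + f.cost + 1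

end Expr

/-- Programs. A test succeeds if the value of the expression is not zero. -/
inductive Prog where
  | skip
  | assign (x : ℕ) (e : Expr)
  | store (a : ℕ) (i e : Expr)
  | seq (p q : Prog)
  | ite (e : Expr) (p q : Prog)
  | loop (e : Expr) (p : Prog)

/-- `Exec p s s' t`: the program `p`, started in memory `s`, halts in memory `s'` after exactly `t`
steps. `loop e p` is the loop `while e ≠ 0 do p`. -/
inductive Exec : Prog → Mem → Mem → ℕ → Prop where
  | skip (s : Mem) : Exec .skip s s 1
  | assign (x : ℕ) (e : Expr) (s : Mem) :
      Exec (.assign x e) s (s.setReg x (e.eval s)) (e.cost + 1)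
  | store (a : ℕ) (i e : Expr) (s : Mem) :
      Exec (.store a i e) s (s.setArr a (i.eval s) (e.eval s)) (i.cost + e.cost + 1)
  | seq {p q : Prog} {s₁ s₂ s₃ : Mem} {t u : ℕ} :
      Exec p s₁ s₂ t → Exec q s₂ s₃ u → Exec (.seq p q) s₁ s₃ (t + u)
  | ite_true {e : Expr} {p q : Prog} {s s' : Mem} {t : ℕ} :
      e.eval s ≠ 0 → Exec p s s' t → Exec (.ite e p q) s s' (e.cost + 1 + t)
  | ite_false {e : Expr} {p q : Prog} {s s' : Mem} {t : ℕ} :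
      e.eval s = 0 → Exec q s s' t → Exec (.ite e p q) s s' (e.cost + 1 + t)
  | loop_done {e : Expr} {p : Prog} {s : Mem} :
      e.eval s = 0 → Exec (.loop e p) s s (e.cost + 1)
  | loop_next {e : Expr} {p : Prog} {s₁ s₂ s₃ : Mem} {t u : ℕ} :
      e.eval s₁ ≠ 0 → Exec p s₁ s₂ t → Exec (.loop e p) s₂ s₃ u →
      Exec (.loop e p) s₁ s₃ (e.cost + 1 + t + u)

end RAM

/-! ## Graphs, triangles and the conflict graph -/

namespace TriangleClub

variable {V : Type*}

/-- The degeneracy: the smallest `d` such that every (nonempty) induced subgraph of `G` contains a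
vertex of degree at most `d`. -/
noncomputable def degeneracy (G : SimpleGraph V) : ℕ :=
  sInf {d | ∀ S : Set V, S.Nonempty → ∃ v ∈ S, (G.neighborSet v ∩ S).ncard ≤ d}

/-- The closed second neighborhood `N₂[v]`: the vertex `v`, its neighbors, and all vertices that
have a common neighbor with `v`. -/
def closedNbhd₂ (G : SimpleGraph V) (v : V) : Set V :=
  {v} ∪ G.neighborSet v ∪ {w | (G.commonNeighbors v w).Nonempty}

/-- The conflict graph: two vertices are adjacent iff they are incompatible, that is, iff their
distance is larger than `2` (the distance of vertices in different components being infinite). -/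
def conflictGraph (G : SimpleGraph V) : SimpleGraph V where
  Adj u w := 2 < G.edist u w
  symm := ⟨fun u w h => by rwa [SimpleGraph.edist_comm] at h⟩
  loopless := ⟨fun u h => by simp at h⟩

variable {G : SimpleGraph V}

/-- The number of triangles of `H` that contain the vertex `u`. -/
noncomputable def vertexTriangles (H : G.Subgraph) (u : V) : ℕ :=
  {t : Finset V | H.spanningCoe.IsNClique 3 t ∧ u ∈ t}.ncard

/-- The number of triangles of `H` that contain the edge `uw` (for adjacent `u` and `w`). -/
noncomputable def edgeTriangles (H : G.Subgraph) (u w : V) : ℕ :=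
  {t : Finset V | H.spanningCoe.IsNClique 3 t ∧ u ∈ t ∧ w ∈ t}.ncard

/-! ## The Greedy Lower Bound -/

/-- The two problem variants, Vertex Triangle 2-Club and Edge Triangle 2-Club. -/
inductive Variant where
  | vertex
  | edge

/-- A single deletion by the Low-Triangle Rule. In the vertex variant, a vertex in less than `ℓ`
triangles is deleted; in the edge variant, an edge in less than `ℓ` triangles or an isolated vertex
is deleted. -/
inductive LTRStep (ℓ : ℕ) : Variant → G.Subgraph → G.Subgraph → Prop where
  | vertex {H : G.Subgraph} {u : V} :
      u ∈ H.verts → vertexTriangles H u < ℓ → LTRStep ℓ .vertex H (H.deleteVerts {u})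
  | edge {H : G.Subgraph} {u w : V} :
      H.Adj u w → edgeTriangles H u w < ℓ → LTRStep ℓ .edge H (H.deleteEdges {s(u, w)})
  | isolated {H : G.Subgraph} {u : V} :
      u ∈ H.verts → (∀ w, ¬ H.Adj u w) → LTRStep ℓ .edge H (H.deleteVerts {u})

/-- `H'` is the result of applying the Low-Triangle Rule exhaustively to `H`. -/
def LTR (ℓ : ℕ) (var : Variant) (H H' : G.Subgraph) : Prop :=
  Relation.ReflTransGen (LTRStep ℓ var) H H' ∧ ∀ H'', ¬ LTRStep ℓ var H' H''

/-- One greedy deletion in the current graph `H` for the vertex `v`: for some pair `{x, y}` of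
incompatible vertices, that is, for some edge of the conflict graph of `H`, delete `x`. If one of
the two is `v`, then the other one is deleted; otherwise, the one that is in less triangles (either
of them in case of a tie). -/
def GreedyStep (v : V) (H H' : G.Subgraph) : Prop :=
  ∃ x y : H.verts, (conflictGraph H.coe).Adj x y ∧ x.1 ≠ v ∧
    (y.1 = v ∨ vertexTriangles H x ≤ vertexTriangles H y) ∧ H' = H.deleteVerts {x.1}

/-- `GreedyRun ℓ var abort v H S`: the main loop of the heuristic for the vertex `v`, entered with
the current graph `H` (to which the Low-Triangle Rule has been applied), can end with the vertex
set `S`. The flag `abort` says what happens if `v` has been deleted by the Low-Triangle Rule: if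
it is `true`, the run for `v` is aborted and yields the empty set; if it is `false`, the run is
continued. -/
inductive GreedyRun (ℓ : ℕ) (var : Variant) (abort : Bool) (v : V) :
    G.Subgraph → Set V → Prop where
  | aborted {H : G.Subgraph} :
      abort = true → v ∉ H.verts → GreedyRun ℓ var abort v H ∅
  | done {H : G.Subgraph} :
      (abort = true → v ∈ H.verts) → conflictGraph H.coe = ⊥ → GreedyRun ℓ var abort v H H.verts
  | step {H H' H'' : G.Subgraph} {S : Set V} :
      (abort = true → v ∈ H.verts) → GreedyStep v H H' → LTR ℓ var H' H'' →
      GreedyRun ℓ var abort v H'' S → GreedyRun ℓ var abort v H S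

/-- `S` is a set `S_v` that the heuristic can compute for the vertex `v`: it starts with the subgraph
of `G` induced by `N₂[v]`, applies the Low-Triangle Rule, and enters the main loop. -/
def IsLocalGLB (G : SimpleGraph V) (ℓ : ℕ) (var : Variant) (abort : Bool) (v : V) (S : Set V) :
    Prop :=
  ∃ H : G.Subgraph, LTR ℓ var ((⊤ : G.Subgraph).induce (closedNbhd₂ G v)) H ∧
    GreedyRun ℓ var abort v H S

/-- `S` is a set that the Greedy Lower Bound can return: a largest one of the sets `S_v`. -/
def IsGLB (G : SimpleGraph V) (ℓ : ℕ) (var : Variant) (abort : Bool) (S : Set V) : Prop :=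
  ∃ T : V → Set V, (∀ v, IsLocalGLB G ℓ var abort v (T v)) ∧
    (∃ v, S = T v) ∧ ∀ v, (T v).ncard ≤ S.ncard

/-! ## Input and output on the machine -/

/-- `L` is a family of adjacency lists of `G` (in any order). -/
def IsAdjLists {n : ℕ} (G : SimpleGraph (Fin n)) (L : Fin n → List (Fin n)) : Prop :=
  ∀ v, (L v).Nodup ∧ ∀ w, w ∈ L v ↔ G.Adj v w

/-- The initial memory: register `0` holds the number `n` of vertices, register `1` holds `ℓ`, array
`1` holds the concatenation of all adjacency lists, and array `0` tells where each of them starts: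
the list of vertex `i` occupies the cells from `arr 0 i` to `arr 0 (i + 1) - 1` of array `1` (the
cells `n, n + 1, …` of array `0` hold the total length). All other registers and cells are `0`. -/
def input {n : ℕ} (L : Fin n → List (Fin n)) (ℓ : ℕ) : RAM.Mem where
  reg x := if x = 0 then n else if x = 1 then ℓ else 0
  arr a i :=
    if a = 0 then ∑ v : Fin n, if v.val < i then (L v).length else 0
    else if a = 1 then ((List.finRange n).flatMap fun v => (L v).map Fin.val).getD i 0
    else 0

/-- The final memory contains the answer `S`: register `0` holds `|S|`, and the first `n` cells of
array `2` are the indicator vector of `S`. -/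
def IsOutput {n : ℕ} (s : RAM.Mem) (S : Set (Fin n)) : Prop :=
  s.reg 0 = S.ncard ∧
    ∀ v : Fin n, (v ∈ S → s.arr 2 v.val = 1) ∧ (v ∉ S → s.arr 2 v.val = 0)

end TriangleClub

/-!
The program works on the subgraphs `G[N₂[v]]` one after the other. For the current graph it keeps
the adjacency matrix, the number of common neighbors of every pair of vertices, and twice the number
of triangles of every vertex (`Tables`). These numbers decide everything that the heuristic asks
for: the common neighbors of the ends of an edge are the triangles through the edge
(`edgeTriangles_eq_cnt`), the common neighbors of a vertex with itself are its degree, and two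
distinct vertices are incompatible iff they are neither adjacent nor have a common neighbor
(`conflictGraph_adj_iff`). Inserting or deleting one arc changes the tables along the walks through
this arc only, so it costs `O(Δ)` steps (`cnt_insert`, `tri_insert`, `run_updArc`). The matrices are
indexed by the vertices of `G` itself; since memory is zero initially and the graph is emptied again
after each `v`, they need no initialization, and a table of multiples of `n` replaces
multiplication.

Candidates for deletion are found with a log to which every changed pair is appended. The log is
read by two queues, one for the Low-Triangle Rule and one for conflicts. Since deletions only make
further deletions possible at pairs that change, everything that may be deleted is in the unread
part of the respective queue (`CoversLow`, `CoversConflicts`, `Recorded`), and a queue that is empty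
certifies that the rule is exhausted or that the conflict graph has no edges.

For the running time let `k = |N₂[v]| ≤ (Δ + 1)²`. Each vertex is deleted once, at `O(Δ²)` steps,
and each of the at most `k * Δ` edges once, at `O(Δ)` steps; the log has `O(k² + k * Δ²)` entries.
The potential `pot` turns this into the bound `O(k * Δ²)` for one vertex `v`. As `k` is at most
`1 + deg v * (Δ + 1)`, the sum over all `v` is `O(n + m * Δ³)` (`run_glb`), provided that isolated
vertices are charged only a constant, which is why the degree bound may depend on `v`. The
degeneracy enters only through the fact that it is at least `1` as soon as there is an edge.

A run that is aborted when `v` is lost is simulated by one that is not aborted, with the empty set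
as its result if `v` is missing in the end (`GreedyRun.of_rounds`).
-/

/-! ### A program logic with exact running times -/

namespace RAM

/-- `Run p s Q`: the program `p` halts from `s`, and `Q` holds of the final memory and of the number
of steps. -/
def Run (p : Prog) (s : Mem) (Q : Mem → ℕ → Prop) : Prop :=
  ∃ s' t, Exec p s s' t ∧ Q s' t

theorem Run.mono {p : Prog} {s : Mem} {Q R : Mem → ℕ → Prop} (h : Run p s Q)
    (hQR : ∀ s' t, Q s' t → R s' t) : Run p s R := by
  obtain ⟨s', t, he, hq⟩ := h
  exact ⟨s', t, he, hQR _ _ hq⟩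

@[simp] theorem run_skip {s : Mem} {Q : Mem → ℕ → Prop} : Run .skip s Q ↔ Q s 1 := by
  constructor
  · rintro ⟨_, _, ⟨⟩, h⟩
    exact h
  · exact fun h => ⟨_, _, .skip s, h⟩

@[simp] theorem run_assign {x : ℕ} {e : Expr} {s : Mem} {Q : Mem → ℕ → Prop} :
    Run (.assign x e) s Q ↔ Q (s.setReg x (e.eval s)) (e.cost + 1) := by
  constructor
  · rintro ⟨_, _, ⟨⟩, h⟩
    exact h
  · exact fun h => ⟨_, _, .assign x e s, h⟩

@[simp] theorem run_store {a : ℕ} {i e : Expr} {s : Mem} {Q : Mem → ℕ → Prop} :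
    Run (.store a i e) s Q ↔
      Q (s.setArr a (i.eval s) (e.eval s)) (i.cost + e.cost + 1) := by
  constructor
  · rintro ⟨_, _, ⟨⟩, h⟩
    exact h
  · exact fun h => ⟨_, _, .store a i e s, h⟩

@[simp] theorem run_seq {p q : Prog} {s : Mem} {Q : Mem → ℕ → Prop} :
    Run (.seq p q) s Q ↔ Run p s fun s₁ t => Run q s₁ fun s₂ u => Q s₂ (t + u) := by
  constructor
  · rintro ⟨_, _, ⟨⟩, h⟩
    exact ⟨_, _, ‹_›, _, _, ‹_›, h⟩
  · rintro ⟨_, _, h₁, _, _, h₂, h⟩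
    exact ⟨_, _, .seq h₁ h₂, h⟩

@[simp] theorem run_ite {e : Expr} {p q : Prog} {s : Mem} {Q : Mem → ℕ → Prop} :
    Run (.ite e p q) s Q ↔
      if e.eval s = 0 then Run q s fun s' t => Q s' (e.cost + 1 + t)
      else Run p s fun s' t => Q s' (e.cost + 1 + t) := by
  constructor
  · rintro ⟨_, _, h, hQ⟩
    cases h with
    | ite_true h₀ h₁ => rw [if_neg h₀]; exact ⟨_, _, h₁, hQ⟩
    | ite_false h₀ h₁ => rw [if_pos h₀]; exact ⟨_, _, h₁, hQ⟩
  · split_ifs with h₀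
    · rintro ⟨_, _, h₁, hQ⟩
      exact ⟨_, _, .ite_false h₀ h₁, hQ⟩
    · rintro ⟨_, _, h₁, hQ⟩
      exact ⟨_, _, .ite_true h₀ h₁, hQ⟩

@[simp] theorem Mem.setReg_reg (s : Mem) (x k r : ℕ) :
    (s.setReg x k).reg r = if r = x then k else s.reg r := by
  simp [Mem.setReg, Function.update_apply]

@[simp] theorem Mem.setReg_arr (s : Mem) (x k : ℕ) : (s.setReg x k).arr = s.arr := rfl

@[simp] theorem Mem.setArr_reg (s : Mem) (a i k : ℕ) : (s.setArr a i k).reg = s.reg := rfl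

@[simp] theorem Mem.setArr_arr (s : Mem) (a i k b : ℕ) :
    (s.setArr a i k).arr b = if b = a then Function.update (s.arr a) i k else s.arr b := by
  simp [Mem.setArr, Function.update_apply]

/-- Whether the program contains an assignment to register `r`. -/
def Prog.wr : Prog → ℕ → Bool
  | .skip, _ => false
  | .assign x _, r => x == r
  | .store _ _ _, _ => false
  | .seq p q, r => p.wr r || q.wr r
  | .ite _ p q, r => p.wr r || q.wr r
  | .loop _ p, r => p.wr r

/-- Whether the program contains a store to array `a`. -/
def Prog.wa : Prog → ℕ → Bool
  | .skip, _ => false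
  | .assign _ _, _ => false
  | .store b _ _, a => b == a
  | .seq p q, a => p.wa a || q.wa a
  | .ite _ p q, a => p.wa a || q.wa a
  | .loop _ p, a => p.wa a

/-- `s` and `s'` agree on all registers and arrays that do not occur as a target in `p`. -/
structure Frame (p : Prog) (s s' : Mem) : Prop where
  reg : ∀ r, p.wr r = false → s'.reg r = s.reg r
  arr : ∀ a, p.wa a = false → s'.arr a = s.arr a

theorem Frame.refl (p : Prog) (s : Mem) : Frame p s s := ⟨fun _ _ => rfl, fun _ _ => rfl⟩

theorem Frame.trans {p : Prog} {s s' s'' : Mem} (h : Frame p s s') (h' : Frame p s' s'') :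
    Frame p s s'' :=
  ⟨fun r hr => (h'.reg r hr).trans (h.reg r hr), fun a ha => (h'.arr a ha).trans (h.arr a ha)⟩

/-- A program changes only the registers and arrays that occur as a target in its text. -/
theorem Exec.frame {p : Prog} {s s' : Mem} {t : ℕ} (h : Exec p s s' t) : Frame p s s' := by
  induction h with
  | skip s => exact .refl _ _
  | assign x e s =>
    refine ⟨fun r hr => ?_, fun _ _ => rfl⟩
    have : r ≠ x := by rintro rfl; simp [Prog.wr] at hr
    simp [this]
  | store a i e s =>
    refine ⟨fun _ _ => rfl, fun b hb => ?_⟩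
    have : b ≠ a := by rintro rfl; simp [Prog.wa] at hb
    simp [this]
  | seq _ _ h₁ h₂ =>
    refine ⟨fun r hr => ?_, fun a ha => ?_⟩
    · simp only [Prog.wr, Bool.or_eq_false_iff] at hr
      rw [h₂.reg r hr.2, h₁.reg r hr.1]
    · simp only [Prog.wa, Bool.or_eq_false_iff] at ha
      rw [h₂.arr a ha.2, h₁.arr a ha.1]
  | ite_true _ _ ih =>
    refine ⟨fun r hr => ?_, fun a ha => ?_⟩
    · simp only [Prog.wr, Bool.or_eq_false_iff] at hr
      exact ih.reg r hr.1
    · simp only [Prog.wa, Bool.or_eq_false_iff] at ha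
      exact ih.arr a ha.1
  | ite_false _ _ ih =>
    refine ⟨fun r hr => ?_, fun a ha => ?_⟩
    · simp only [Prog.wr, Bool.or_eq_false_iff] at hr
      exact ih.reg r hr.2
    · simp only [Prog.wa, Bool.or_eq_false_iff] at ha
      exact ih.arr a ha.2
  | loop_done _ => exact .refl _ _
  | loop_next _ _ _ h₁ h₂ => exact Frame.trans ⟨h₁.reg, h₁.arr⟩ h₂

theorem Run.frame {p : Prog} {s : Mem} {Q : Mem → ℕ → Prop} (h : Run p s Q) :
    Run p s fun s' t => Q s' t ∧ Frame p s s' := by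
  obtain ⟨s', t, he, hq⟩ := h
  exact ⟨s', t, he, hq, he.frame⟩

/-- The rule for loops. The invariant `I s φ` carries a potential `φ` that pays for the iterations
still to come, which also guarantees termination. -/
theorem Run.loop {e : Expr} {p : Prog} (I : Mem → ℕ → Prop) {s : Mem} {φ : ℕ} (hs : I s φ)
    (hstep : ∀ s' φ, I s' φ → Frame p s s' → e.eval s' ≠ 0 →
      Run p s' fun s'' t => ∃ φ', I s'' φ' ∧ e.cost + 1 + t + φ' ≤ φ) :
    Run (.loop e p) s fun s' t =>
      ∃ φ', I s' φ' ∧ e.eval s' = 0 ∧ t + φ' ≤ φ + e.cost + 1 := by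
  suffices H : ∀ φ s', I s' φ → Frame p s s' → Run (.loop e p) s' fun s' t =>
      ∃ φ', I s' φ' ∧ e.eval s' = 0 ∧ t + φ' ≤ φ + e.cost + 1 from H φ s hs (.refl _ _)
  intro φ
  induction φ using Nat.strong_induction_on with
  | _ φ ih =>
    intro s' hs' hf
    by_cases h₀ : e.eval s' = 0
    · exact ⟨_, _, .loop_done h₀, φ, hs', h₀, by omega⟩
    · obtain ⟨s₁, t, he, φ', hI, ht⟩ := hstep s' φ hs' hf h₀
      obtain ⟨s₂, u, he₂, φ'', hI₂, h₂, ht₂⟩ := ih φ' (by omega) s₁ hI (hf.trans he.frame)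
      exact ⟨_, _, .loop_next h₀ he he₂, φ'', hI₂, h₂, by omega⟩

/-- Sequential composition. -/
infixr:60 " ;; " => Prog.seq

/-- The body is executed for the cells `i, i + 1, …, e - 1` of array `a` in turn, where `i` and `e`
are the contents of two registers; the content of the cell is passed in register `z`. -/
def forSeg (i e z a : ℕ) (body : Prog) : Prog :=
  .loop (.sub (.reg e) (.reg i))
    (.assign z (.get a (.reg i)) ;; body ;; .assign i (.add (.reg i) (.const 1)))

/-- The cells of `f` from `p` on hold the members of the list `l`. -/
def Seg {n : ℕ} (f : ℕ → ℕ) (p : ℕ) (l : List (Fin n)) : Prop :=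
  ∀ (j : ℕ) (h : j < l.length), f (p + j) = (l[j] : Fin n)

theorem Seg.append_singleton {n : ℕ} {f : ℕ → ℕ} {l : List (Fin n)} (h : Seg f 0 l) (x : Fin n) :
    Seg (Function.update f l.length x) 0 (l ++ [x]) := by
  intro j hj
  rw [List.length_append, List.length_singleton] at hj
  rw [Function.update_apply, List.getElem_append]
  rcases Nat.lt_succ_iff_lt_or_eq.mp hj with h₁ | h₁
  · rw [if_neg (by omega), dif_pos h₁]; exact h j h₁
  · subst h₁; simp

/-- The invariant `I` speaks about the part of the list that has been processed. -/
theorem Run.forSeg {n i e z a : ℕ} {body : Prog} {l : List (Fin n)} {p : ℕ}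
    (I : List (Fin n) → Mem → Prop) (τ : ℕ) {s : Mem}
    (hd : i ≠ e ∧ i ≠ z ∧ e ≠ z) (hw : (body.wr i || body.wr e || body.wa a) = false)
    (hs : I [] s) (hi : s.reg i = p) (he : s.reg e = p + l.length) (ha : Seg (s.arr a) p l)
    (hI : ∀ r k pre s, r = i ∨ r = z → I pre s → I pre (s.setReg r k))
    (hstep : ∀ (pre : List (Fin n)) (c : Fin n) (post : List (Fin n)),
      l = pre ++ c :: post → ∀ s', I pre s' → s'.reg z = (c : ℕ) →
      Frame (RAM.forSeg i e z a body) s s' →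
      Run body s' fun s'' t => I (pre ++ [c]) s'' ∧ t ≤ τ) :
    Run (RAM.forSeg i e z a body) s fun s' t => I l s' ∧ t ≤ l.length * (τ + 11) + 4 := by
  simp only [Bool.or_eq_false_iff] at hw
  obtain ⟨⟨hwi, hwe⟩, hwa⟩ := hw
  have key := Run.loop (e := .sub (.reg e) (.reg i))
    (p := .assign z (.get a (.reg i)) ;; body ;; .assign i (.add (.reg i) (.const 1)))
    (fun s' φ => ∃ pre post : List (Fin n), l = pre ++ post ∧ I pre s' ∧ s'.reg i = p + pre.length ∧
      s'.reg e = p + l.length ∧ s'.arr a = s.arr a ∧ φ = post.length * (τ + 11))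
    (s := s) (φ := l.length * (τ + 11)) ⟨[], l, rfl, hs, by simpa using hi, he, rfl, rfl⟩ ?_
  · refine key.mono ?_
    rintro s' t ⟨φ, ⟨pre, post, hl, hp, h₁, h₂, -, hφ⟩, h₀, ht⟩
    simp only [Expr.eval, h₁, h₂] at h₀
    have : post = [] := by
      have := congrArg List.length hl
      rw [List.length_append] at this
      exact List.length_eq_zero_iff.mp (by omega)
    subst this
    simp only [List.append_nil] at hl
    subst hl
    refine ⟨hp, ?_⟩
    simp only [Expr.cost] at ht
    omega
  · rintro s' φ ⟨pre, post, hl, hp, h₁, h₂, h₃, hφ⟩ hf h₀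
    simp only [Expr.eval, h₁, h₂] at h₀
    cases post with
    | nil => simp [hl] at h₀
    | cons c post =>
      have hc : s'.arr a (s'.reg i) = (c : ℕ) := by
        rw [h₃, h₁, ha pre.length (by simp [hl])]
        simp [hl]
      simp only [run_seq, run_assign, Expr.eval, Expr.cost, hc]
      have hfz : Frame (RAM.forSeg i e z a body) s (s'.setReg z c) :=
        Frame.trans ⟨hf.reg, hf.arr⟩ ⟨fun r hr => by
          have : r ≠ z := by
            rintro rfl
            simp [RAM.forSeg, Prog.wr] at hr
          simp [this], fun _ _ => rfl⟩
      refine (hstep pre c post hl _ (hI z c pre s' (.inr rfl) hp) (by simp) hfz).frame.mono ?_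
      rintro s'' t ⟨⟨hI', ht⟩, hf'⟩
      refine ⟨_, ⟨pre ++ [c], post, by simpa using hl, hI _ _ _ _ (.inl rfl) hI', ?_, ?_, ?_, rfl⟩,
        ?_⟩
      · simp [hf'.reg i hwi, h₁, hd.2.1]
        omega
      · simp [hf'.reg e hwe, h₂, hd.1.symm, hd.2.2]
      · simp [hf'.arr a hwa, h₃]
      · simp only [hφ, List.length_cons]
        rw [Nat.add_mul]
        omega

/-- The rule for a loop that counts register `i` up to the content `m` of register `e`. -/
theorem Run.forRange {i e m : ℕ} {body : Prog} (I : ℕ → Mem → Prop) (τ : ℕ → ℕ) {s : Mem}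
    (hd : i ≠ e) (hw : (body.wr i || body.wr e) = false)
    (hs : I 0 s) (hi : s.reg i = 0) (he : s.reg e = m)
    (hI : ∀ k j s, I j s → I j (s.setReg i k))
    (hstep : ∀ j, j < m → ∀ s', I j s' → s'.reg i = j →
      Frame (body ;; .assign i (.add (.reg i) (.const 1))) s s' →
      Run body s' fun s'' t => I (j + 1) s'' ∧ t ≤ τ j) :
    Run (.loop (.sub (.reg e) (.reg i)) (body ;; .assign i (.add (.reg i) (.const 1)))) s
      fun s' t => I m s' ∧ t ≤ ∑ j ∈ Finset.range m, (τ j + 8) + 4 := by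
  simp only [Bool.or_eq_false_iff] at hw
  have key := Run.loop (e := .sub (.reg e) (.reg i))
    (p := body ;; .assign i (.add (.reg i) (.const 1)))
    (fun s' φ => ∃ j, j ≤ m ∧ I j s' ∧ s'.reg i = j ∧ s'.reg e = m ∧
      φ = ∑ k ∈ Finset.Ico j m, (τ k + 8))
    (s := s) (φ := ∑ k ∈ Finset.Ico 0 m, (τ k + 8)) ⟨0, by simp, hs, hi, he, rfl⟩ ?_
  · refine key.mono ?_
    rintro s' t ⟨φ, ⟨j, hj, hIj, h₁, h₂, hφ⟩, h₀, ht⟩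
    simp only [Expr.eval, h₁, h₂] at h₀
    obtain rfl : j = m := by omega
    refine ⟨hIj, ?_⟩
    rw [Finset.range_eq_Ico]
    simp only [Expr.cost] at ht
    omega
  · rintro s' φ ⟨j, hj, hIj, h₁, h₂, hφ⟩ hf h₀
    simp only [Expr.eval, h₁, h₂] at h₀
    have hj' : j < m := by omega
    simp only [run_seq, run_assign, Expr.cost]
    refine (hstep j hj' s' hIj h₁ hf).frame.mono ?_
    rintro s'' t ⟨⟨hI', ht⟩, hf'⟩
    refine ⟨_, ⟨j + 1, hj', hI _ _ _ hI', ?_, ?_, rfl⟩, ?_⟩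
    · simp [Expr.eval, hf'.reg i hw.1, h₁]
    · simp [hf'.reg e hw.2, h₂, hd.symm]
    · rw [hφ, Finset.sum_eq_sum_Ico_succ_bot hj']
      omega

end RAM

/-! ### Counting walks and triangles -/

namespace TriangleClub

open Finset

section Arcs

variable {α : Type*} [Fintype α] [DecidableEq α]

/-- The number of walks of length two from `x` to `y` in the digraph with arc set `E`. -/
def cnt (E : Finset (α × α)) (x y : α) : ℕ := #{r | (x, r) ∈ E ∧ (r, y) ∈ E}

/-- The number of closed walks of length three from `x` in the digraph with arc set `E`. -/
def tri (E : Finset (α × α)) (x : α) : ℕ := ∑ r with (x, r) ∈ E, cnt E r x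

theorem cnt_insert {E : Finset (α × α)} {a b : α} (hab : a ≠ b) (h : (a, b) ∉ E) (x y : α) :
    cnt (insert (a, b) E) x y = cnt E x y + (if x = a ∧ (b, y) ∈ E then 1 else 0) +
      (if y = b ∧ (x, a) ∈ E then 1 else 0) := by
  have key : ∀ r, (if (x, r) ∈ insert (a, b) E ∧ (r, y) ∈ insert (a, b) E then 1 else 0) =
      (if (x, r) ∈ E ∧ (r, y) ∈ E then 1 else 0) +
      (if r = b then (if x = a ∧ (b, y) ∈ E then 1 else 0) else 0) +
      (if r = a then (if y = b ∧ (x, a) ∈ E then 1 else 0) else 0) := by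
    intro r
    simp only [mem_insert, Prod.mk.injEq]
    grind
  rw [cnt, cnt, card_filter, card_filter, sum_congr rfl fun r _ => key r, sum_add_distrib,
    sum_add_distrib, sum_ite_eq' univ b, sum_ite_eq' univ a]
  simp

theorem tri_insert {E : Finset (α × α)} {a b : α} (hab : a ≠ b) (h : (a, b) ∉ E) (x : α) :
    tri (insert (a, b) E) x = tri E x + (if (b, x) ∈ E ∧ (x, a) ∈ E then 1 else 0) +
      (if x = a then cnt E b a else 0) + (if x = b then cnt E b a else 0) := by
  have key : ∀ r, (if (x, r) ∈ insert (a, b) E then cnt (insert (a, b) E) r x else 0) =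
      (if (x, r) ∈ E then cnt E r x else 0) +
      (if r = a then (if (b, x) ∈ E ∧ (x, a) ∈ E then 1 else 0) else 0) +
      (if r = b then (if x = a then cnt E b a else 0) else 0) +
      (if x = b then (if (b, r) ∈ E ∧ (r, a) ∈ E then 1 else 0) else 0) := by
    intro r
    rw [cnt_insert hab h]
    simp only [mem_insert, Prod.mk.injEq]
    grind
  rw [tri, tri, sum_filter, sum_filter, sum_congr rfl fun r _ => key r, sum_add_distrib,
    sum_add_distrib, sum_add_distrib, sum_ite_eq' univ b, sum_ite_eq' univ a]
  by_cases hx : x = b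
  · simp [hx, cnt]
  · simp [hx]

/-- The list `q` names everything that differs between the arc sets `E` and `F`: all pairs of
vertices whose adjacency or number of common neighbors differs, and all vertices whose number of
triangles differs. -/
structure Recorded (E F : Finset (α × α)) (q : List (α × α)) : Prop where
  cnt_eq : ∀ x y, (x, y) ∉ q → cnt F x y = cnt E x y
  mem_iff : ∀ x y, (x, y) ∉ q → ((x, y) ∈ F ↔ (x, y) ∈ E)
  tri_eq : ∀ x, (∀ y, (x, y) ∉ q) → tri F x = tri E x

theorem Recorded.refl (E : Finset (α × α)) : Recorded E E [] :=
  ⟨fun _ _ _ => rfl, fun _ _ _ => Iff.rfl, fun _ _ => rfl⟩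

theorem Recorded.trans {E F K : Finset (α × α)} {q r : List (α × α)} (h : Recorded E F q)
    (h' : Recorded F K r) : Recorded E K (q ++ r) := by
  refine ⟨fun x y hq => ?_, fun x y hq => ?_, fun x hq => ?_⟩
  · rw [List.mem_append, not_or] at hq
    rw [h'.cnt_eq x y hq.2, h.cnt_eq x y hq.1]
  · rw [List.mem_append, not_or] at hq
    rw [h'.mem_iff x y hq.2, h.mem_iff x y hq.1]
  · simp only [List.mem_append, not_or] at hq
    rw [h'.tri_eq x fun y => (hq y).2, h.tri_eq x fun y => (hq y).1]

theorem Recorded.symm {E F : Finset (α × α)} {q : List (α × α)} (h : Recorded E F q) :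
    Recorded F E q :=
  ⟨fun x y hq => (h.cnt_eq x y hq).symm, fun x y hq => (h.mem_iff x y hq).symm,
    fun x hq => (h.tri_eq x hq).symm⟩

/-- The pairs that `updArc` appends to the log. -/
theorem recorded_insert {E : Finset (α × α)} {a b : α} (hab : a ≠ b) (h : (a, b) ∉ E)
    {q : List (α × α)} (h₁ : ∀ c, (b, c) ∈ E → (a, c) ∈ q) (h₂ : ∀ c, (c, a) ∈ E → (c, b) ∈ q)
    (h₃ : (a, b) ∈ q) (h₄ : (b, a) ∈ q) : Recorded E (insert (a, b) E) q := by
  refine ⟨fun x y hq => ?_, fun x y hq => ?_, fun x hq => ?_⟩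
  · have n₁ : ¬ (x = a ∧ (b, y) ∈ E) := by
      rintro ⟨rfl, hx⟩
      exact hq (h₁ _ hx)
    have n₂ : ¬ (y = b ∧ (x, a) ∈ E) := by
      rintro ⟨rfl, hx⟩
      exact hq (h₂ _ hx)
    simp [cnt_insert hab h, n₁, n₂]
  · rw [mem_insert, Prod.mk.injEq, or_iff_right]
    rintro ⟨rfl, rfl⟩
    exact hq h₃
  · have n₁ : ¬ ((b, x) ∈ E ∧ (x, a) ∈ E) := fun hx => hq _ (h₂ _ hx.2)
    have n₂ : x ≠ a := by
      rintro rfl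
      exact hq _ h₃
    have n₃ : x ≠ b := by
      rintro rfl
      exact hq _ h₄
    simp [tri_insert hab h, n₁, n₂, n₃]

/-- Every pair of distinct vertices of `U` that are neither adjacent nor have a common neighbor
occurs in `q`. -/
def CoversConflicts (U : Set α) (E : Finset (α × α)) (q : List (α × α)) : Prop :=
  ∀ x ∈ U, ∀ y ∈ U, x ≠ y → (x, y) ∉ E → cnt E x y = 0 → (x, y) ∈ q

/-- Everything that the Low-Triangle Rule may delete, isolated vertices aside, occurs in `q`. -/
def CoversLow (ℓ : ℕ) : Variant → Set α → Finset (α × α) → List (α × α) → Prop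
  | .vertex, U, E, q => ∀ x ∈ U, tri E x < ℓ + ℓ → ∃ y, (x, y) ∈ q
  | .edge, _, E, q => ∀ x y, (x, y) ∈ E → cnt E x y < ℓ → (x, y) ∈ q

/-- A queue that covers all conflicts still does so after a change that has been recorded. -/
theorem CoversConflicts.recorded {U U' : Set α} {E F : Finset (α × α)} {q r : List (α × α)}
    (h : CoversConflicts U E q) (hr : Recorded E F r) (hU : U' ⊆ U) :
    CoversConflicts U' F (q ++ r) := by
  intro x hx y hy hxy hE hc
  by_cases hm : (x, y) ∈ r
  · exact List.mem_append_right _ hm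
  · rw [hr.mem_iff x y hm] at hE
    rw [hr.cnt_eq x y hm] at hc
    exact List.mem_append_left _ (h x (hU hx) y (hU hy) hxy hE hc)

theorem CoversLow.recorded {ℓ : ℕ} {var : Variant} {U U' : Set α} {E F : Finset (α × α)}
    {q r : List (α × α)} (h : CoversLow ℓ var U E q) (hr : Recorded E F r) (hU : U' ⊆ U) :
    CoversLow ℓ var U' F (q ++ r) := by
  cases var with
  | vertex =>
    intro x hx ht
    by_cases hm : ∃ y, (x, y) ∈ r
    · exact hm.imp fun y hy => List.mem_append_right _ hy
    · rw [hr.tri_eq x (not_exists.mp hm)] at ht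
      exact (h x (hU hx) ht).imp fun y hy => List.mem_append_left _ hy
  | edge =>
    intro x y hE hc
    by_cases hm : (x, y) ∈ r
    · exact List.mem_append_right _ hm
    · rw [hr.mem_iff x y hm] at hE
      rw [hr.cnt_eq x y hm] at hc
      exact List.mem_append_left _ (h x y hE hc)

end Arcs

/-! ### Subgraphs and their arc sets -/

section Subgraph

open Classical in
/-- The set of arcs of a subgraph: both orientations of every edge. -/
noncomputable def arcs {V : Type*} [Fintype V] {G : SimpleGraph V} (H : G.Subgraph) :
    Finset (V × V) := {p | H.Adj p.1 p.2}

variable {V : Type*} {G : SimpleGraph V}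

@[simp] theorem mem_arcs [Fintype V] {H : G.Subgraph} {x y : V} : (x, y) ∈ arcs H ↔ H.Adj x y := by
  simp [arcs]

variable [Fintype V] [DecidableEq V]

theorem arcs_deleteVerts (H : G.Subgraph) (d : V) :
    arcs (H.deleteVerts {d}) = {p ∈ arcs H | p.1 ≠ d ∧ p.2 ≠ d} := by
  ext ⟨x, y⟩
  simp only [mem_arcs, mem_filter, SimpleGraph.Subgraph.deleteVerts_adj, Set.mem_singleton_iff]
  exact ⟨fun h => ⟨h.2.2.2.2, h.2.1, h.2.2.2.1⟩,
    fun h => ⟨h.1.fst_mem, h.2.1, h.1.snd_mem, h.2.2, h.1⟩⟩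

theorem arcs_deleteEdges (H : G.Subgraph) (u w : V) :
    arcs (H.deleteEdges {s(u, w)}) = ((arcs H).erase (u, w)).erase (w, u) := by
  ext ⟨x, y⟩
  simp only [mem_arcs, mem_erase, SimpleGraph.Subgraph.deleteEdges_adj, Set.mem_singleton_iff,
    Sym2.eq_iff, ne_eq, Prod.mk.injEq]
  tauto

theorem edgeTriangles_eq_cnt {H : G.Subgraph} {u w : V} (h : H.Adj u w) :
    edgeTriangles H u w = cnt (arcs H) u w := by
  have hinj : Set.InjOn (fun r : V => ({u, w, r} : Finset V))
      {r | H.Adj u r ∧ H.Adj r w} := by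
    intro r hr r' hr' hrr
    have h₁ : r ∈ ({u, w, r'} : Finset V) := by
      have : r ∈ ({u, w, r} : Finset V) := by simp
      simpa [hrr] using this
    simp only [mem_insert, mem_singleton] at h₁
    rcases h₁ with rfl | rfl | rfl
    · exact absurd rfl hr.1.ne
    · exact absurd rfl hr.2.ne
    · rfl
  have himg : {t : Finset V | H.spanningCoe.IsNClique 3 t ∧ u ∈ t ∧ w ∈ t} =
      (fun r : V => ({u, w, r} : Finset V)) '' {r | H.Adj u r ∧ H.Adj r w} := by
    ext t
    simp only [Set.mem_ofPred_eq, Set.mem_image]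
    constructor
    · rintro ⟨ht, hu, hw⟩
      have hc : #((t.erase u).erase w) = 1 := by
        rw [card_erase_of_mem (mem_erase.mpr ⟨h.ne.symm, hw⟩), card_erase_of_mem hu, ht.card_eq]
      obtain ⟨r, hr⟩ := card_eq_one.mp hc
      have hrt : r ∈ (t.erase u).erase w := by simp [hr]
      simp only [mem_erase, ne_eq] at hrt
      refine ⟨r, ⟨?_, ?_⟩, ?_⟩
      · simpa using ht.isClique hu hrt.2.2 (Ne.symm hrt.2.1)
      · simpa using ht.isClique hrt.2.2 hw hrt.1
      · rw [← hr, insert_erase (mem_erase.mpr ⟨h.ne.symm, hw⟩), insert_erase hu]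
    · rintro ⟨r, ⟨h₁, h₂⟩, rfl⟩
      refine ⟨?_, by simp, by simp⟩
      rw [SimpleGraph.is3Clique_triple_iff]
      exact ⟨by simpa using h, by simpa using h₁, by simpa using h₂.symm⟩
  rw [edgeTriangles, himg, Set.InjOn.ncard_image hinj, cnt, ← Set.ncard_coe_finset]
  congr 1
  ext r
  simp

/-- Every triangle at `u` gives rise to two closed walks from `u`, one for each orientation. -/
theorem two_mul_vertexTriangles (H : G.Subgraph) (u : V) :
    2 * vertexTriangles H u = tri (arcs H) u := by
  classical
  let T : Finset (Finset V) := {t | H.spanningCoe.IsNClique 3 t ∧ u ∈ t}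
  let P : Finset (V × V) := {p | H.Adj u p.1 ∧ H.Adj p.1 p.2 ∧ H.Adj p.2 u}
  have hT : vertexTriangles H u = #T := by
    rw [vertexTriangles, ← Set.ncard_coe_finset]
    congr 1
    ext t
    simp [T]
  have hP : tri (arcs H) u = #P := by
    simp only [tri, cnt, mem_arcs]
    rw [← card_sigma]
    refine card_bij (fun p _ => (p.1, p.2)) ?_ ?_ ?_
    · rintro ⟨p, q⟩ h
      simpa [P] using h
    · rintro ⟨p, q⟩ - ⟨p', q'⟩ - h
      simpa using h
    · rintro ⟨p, q⟩ h
      exact ⟨⟨p, q⟩, by simpa [P] using h, rfl⟩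
  have hmaps : ∀ p ∈ P, ({u, p.1, p.2} : Finset V) ∈ T := by
    rintro ⟨p, q⟩ h
    simp only [P, mem_filter, mem_univ, true_and] at h
    simp only [T, mem_filter, mem_univ, true_and, mem_insert, true_or, and_true,
      SimpleGraph.is3Clique_triple_iff]
    exact ⟨by simpa using h.1, by simpa using h.2.2.symm, by simpa using h.2.1⟩
  rw [hT, hP, card_eq_sum_card_fiberwise hmaps, sum_const_nat (m := 2), mul_comm]
  intro t ht
  simp only [T, mem_filter, mem_univ, true_and] at ht
  have hc : #(t.erase u) = 2 := by rw [card_erase_of_mem ht.2, ht.1.card_eq]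
  obtain ⟨p, q, hpq, he⟩ := card_eq_two.mp hc
  have ht' : t = {u, p, q} := by rw [← insert_erase ht.2, he]
  have hp : p ∈ t.erase u := by simp [he]
  have hq : q ∈ t.erase u := by simp [he]
  have hcl := ht.1
  rw [ht', SimpleGraph.is3Clique_triple_iff] at hcl
  simp only [SimpleGraph.Subgraph.spanningCoe_adj] at hcl
  obtain ⟨hup, huq, hpq'⟩ := hcl
  have hfib : {x ∈ P | ({u, x.1, x.2} : Finset V) = t} = {(p, q), (q, p)} := by
    ext ⟨a, b⟩
    simp only [P, mem_filter, mem_univ, true_and, mem_insert, mem_singleton, Prod.mk.injEq]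
    constructor
    · rintro ⟨⟨h₁, h₂, h₃⟩, h₄⟩
      have ha : a ∈ t.erase u := by
        rw [← h₄]; simp [h₁.ne.symm]
      have hb : b ∈ t.erase u := by
        rw [← h₄]; simp [h₃.ne]
      simp only [he, mem_insert, mem_singleton] at ha hb
      have := h₂.ne
      grind
    · rintro (⟨rfl, rfl⟩ | ⟨rfl, rfl⟩)
      · exact ⟨⟨hup, hpq', huq.symm⟩, ht'.symm⟩
      · refine ⟨⟨huq, hpq'.symm, hup.symm⟩, ?_⟩
        rw [ht', Finset.pair_comm]
  rw [hfib, card_pair]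
  simp [hpq]

theorem conflictGraph_adj_iff {H : G.Subgraph} {x y : H.verts} :
    (conflictGraph H.coe).Adj x y ↔
      x.1 ≠ y.1 ∧ ¬ H.Adj x.1 y.1 ∧ cnt (arcs H) x.1 y.1 = 0 := by
  have hc : cnt (arcs H) x.1 y.1 = 0 ↔ ∀ r, ¬ (H.Adj x.1 r ∧ H.Adj r y.1) := by
    simp [cnt, filter_eq_empty_iff]
  rw [hc]
  change 2 < H.coe.edist x y ↔ _
  constructor
  · intro h
    refine ⟨fun hxy => ?_, fun hxy => ?_, fun r hr => ?_⟩
    · rw [Subtype.ext hxy] at h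
      simp at h
    · have hadj : H.coe.Adj x y := hxy
      have := SimpleGraph.edist_le (SimpleGraph.Walk.cons hadj .nil)
      refine absurd (h.trans_le this) ?_
      simp
    · have h₁ : H.coe.Adj x ⟨r, hr.1.snd_mem⟩ := hr.1
      have h₂ : H.coe.Adj ⟨r, hr.1.snd_mem⟩ y := hr.2
      have := SimpleGraph.edist_le (SimpleGraph.Walk.cons h₁ (.cons h₂ .nil))
      refine absurd (h.trans_le this) ?_
      simp
  · rintro ⟨hne, hadj, hcom⟩
    by_contra hlt
    rw [not_lt] at hlt
    have hreach : H.coe.edist x y ≠ ⊤ := fun h => by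
      rw [h] at hlt
      exact absurd hlt (by decide)
    obtain ⟨w, hw⟩ := SimpleGraph.exists_walk_of_edist_ne_top hreach
    rw [← hw] at hlt
    have hlen : w.length ≤ 2 := by exact_mod_cast hlt
    cases w with
    | nil => exact hne rfl
    | cons h₁ w =>
      cases w with
      | nil => exact hadj h₁
      | cons h₂ w =>
        cases w with
        | nil => exact hcom _ ⟨h₁, h₂⟩
        | cons h₃ w => simp at hlen

/-! ### The abstract heuristic -/

theorem LTR.of_vertex {ℓ : ℕ} {H H' : G.Subgraph}
    (h : Relation.ReflTransGen (LTRStep ℓ .vertex) H H')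
    (hc : CoversLow ℓ .vertex H'.verts (arcs H') []) : LTR ℓ .vertex H H' := by
  refine ⟨h, fun H'' hs => ?_⟩
  cases hs with
  | vertex hu ht =>
    have := two_mul_vertexTriangles H'
    obtain ⟨y, hy⟩ := hc _ hu (by rw [← this]; omega)
    simp at hy

theorem LTR.of_edge {ℓ : ℕ} {H H' : G.Subgraph}
    (h : Relation.ReflTransGen (LTRStep ℓ .edge) H H')
    (hc : CoversLow ℓ .edge H'.verts (arcs H') [])
    (hi : ∀ u ∈ H'.verts, ∃ w, H'.Adj u w) : LTR ℓ .edge H H' := by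
  refine ⟨h, fun H'' hs => ?_⟩
  cases hs with
  | edge hu ht =>
    rw [edgeTriangles_eq_cnt hu] at ht
    simpa using hc _ _ (mem_arcs.mpr hu) ht
  | isolated hu ht =>
    obtain ⟨w, hw⟩ := hi _ hu
    exact ht w hw

end Subgraph

section Rounds

variable {V : Type*} {G : SimpleGraph V}

theorem LTRStep.verts_subset {ℓ : ℕ} {var : Variant} {H H' : G.Subgraph} (h : LTRStep ℓ var H H') :
    H'.verts ⊆ H.verts := by
  cases h <;> simp

theorem LTR.verts_subset {ℓ : ℕ} {var : Variant} {H H' : G.Subgraph} (h : LTR ℓ var H H') :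
    H'.verts ⊆ H.verts := by
  obtain ⟨h, -⟩ := h
  induction h with
  | refl => exact subset_rfl
  | tail _ hs ih => exact hs.verts_subset.trans ih

/-- One round of the main loop: a greedy deletion and the Low-Triangle Rule after it. -/
def Round (ℓ : ℕ) (var : Variant) (v : V) (H H' : G.Subgraph) : Prop :=
  ∃ K, GreedyStep v H K ∧ LTR ℓ var K H'

theorem Round.verts_subset {ℓ : ℕ} {var : Variant} {v : V} {H H' : G.Subgraph}
    (h : Round ℓ var v H H') : H'.verts ⊆ H.verts := by
  obtain ⟨K, ⟨x, y, -, -, -, rfl⟩, hL⟩ := h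
  exact hL.verts_subset.trans (by simp)

open Classical in
/-- Aborting can be simulated by a run that is never aborted: vertices do not come back, so `v` has
been deleted at some point iff it is missing in the end. -/
theorem GreedyRun.of_rounds {ℓ : ℕ} {var : Variant} (abort : Bool) {v : V} {H H' : G.Subgraph}
    (h : Relation.ReflTransGen (Round ℓ var v) H H') (hc : conflictGraph H'.coe = ⊥) :
    GreedyRun ℓ var abort v H (if abort = true ∧ v ∉ H'.verts then ∅ else H'.verts) := by
  induction h using Relation.ReflTransGen.head_induction_on with
  | refl =>
    split_ifs with h
    · exact .aborted h.1 h.2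
    · exact .done (by tauto) hc
  | head h₁ h₂ ih =>
    rename_i H₁ H₂
    by_cases hv : abort = true → v ∈ H₁.verts
    · obtain ⟨K, hg, hL⟩ := h₁
      exact .step hv hg hL ih
    · have : v ∉ H'.verts := fun hv' => by
        have hsub : H'.verts ⊆ H₂.verts := by
          clear ih hc hv h₁ hv'
          induction h₂ with
          | refl => exact subset_rfl
          | tail _ hs ih => exact hs.verts_subset.trans ih
        exact hv fun _ => h₁.verts_subset (hsub hv')
      rw [if_pos (by tauto)]
      exact .aborted (by tauto) (by tauto)

end Rounds

end TriangleClub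

/-! ### The data structure for the current graph -/

namespace TriangleClub

open RAM

/-- The arrays `f` and `g` hold the adjacency lists `L` in the format of `input`. -/
def IsInput {n : ℕ} (L : Fin n → List (Fin n)) (f g : ℕ → ℕ) : Prop :=
  ∀ x : Fin n, f (x + 1) = f x + (L x).length ∧ Seg g (f x) (L x)

/-- What never changes after the initialization: the input, and the table of row offsets in array
`3`, which replaces multiplications by `n`. Entry `(x, y)` of a matrix is kept in cell
`x * n + y`. -/
structure Base {n : ℕ} (L : Fin n → List (Fin n)) (ℓ : ℕ) (s : Mem) : Prop where
  reg_zero : s.reg 0 = n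
  reg_one : s.reg 1 = ℓ
  inp : IsInput L (s.arr 0) (s.arr 1)
  off : ∀ x : Fin n, s.arr 3 x = x * n

theorem Base.of_eq {n : ℕ} {L : Fin n → List (Fin n)} {ℓ : ℕ} {s s' : Mem} (h : Base L ℓ s)
    (h₀ : s'.reg 0 = s.reg 0) (h₁ : s'.reg 1 = s.reg 1) (h₂ : s'.arr 0 = s.arr 0)
    (h₃ : s'.arr 1 = s.arr 1) (h₄ : s'.arr 3 = s.arr 3) : Base L ℓ s' :=
  ⟨h₀ ▸ h.reg_zero, h₁ ▸ h.reg_one, by rw [h₂, h₃]; exact h.inp, by rw [h₄]; exact h.off⟩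

theorem Base.frame {n : ℕ} {L : Fin n → List (Fin n)} {ℓ : ℕ} {s s' : Mem} {p : Prog}
    (h : Base L ℓ s) (hf : Frame p s s')
    (hw : (p.wr 0 || p.wr 1 || p.wa 0 || p.wa 1 || p.wa 3) = false) : Base L ℓ s' := by
  simp only [Bool.or_eq_false_iff] at hw
  exact h.of_eq (hf.reg _ hw.1.1.1.1) (hf.reg _ hw.1.1.1.2) (hf.arr _ hw.1.1.2)
    (hf.arr _ hw.1.2) (hf.arr _ hw.2)

theorem cell_inj {n : ℕ} {x y a b : Fin n} :
    (x : ℕ) * n + y = a * n + b ↔ x = a ∧ y = b := by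
  constructor
  · intro h
    have h₁ : ((x : ℕ) * n + y) / n = (a * n + b) / n := by rw [h]
    have h₂ : ((x : ℕ) * n + y) % n = (a * n + b) % n := by rw [h]
    have hn : 0 < n := x.pos
    rw [mul_comm, Nat.mul_add_div hn, Nat.div_eq_of_lt y.2, mul_comm, Nat.mul_add_div hn,
      Nat.div_eq_of_lt b.2] at h₁
    rw [mul_comm, Nat.mul_add_mod, Nat.mod_eq_of_lt y.2, mul_comm, Nat.mul_add_mod,
      Nat.mod_eq_of_lt b.2] at h₂
    exact ⟨Fin.ext h₁, Fin.ext h₂⟩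
  · rintro ⟨rfl, rfl⟩
    rfl

/-- The adjacency matrix `f`, the matrix `g` of the numbers of common neighbors, and the table `k`
of the (doubled) numbers of triangles for the arc set `E`. -/
structure Tables {n : ℕ} (f g k : ℕ → ℕ) (E : Finset (Fin n × Fin n)) : Prop where
  adj : ∀ x y : Fin n, f (x * n + y) = if (x, y) ∈ E then 1 else 0
  cnt : ∀ x y : Fin n, g (x * n + y) = cnt E x y
  tri : ∀ x : Fin n, k x = tri E x

/-- The array `f` is the indicator vector of the set `U`. -/
def IsIndicator {n : ℕ} (f : ℕ → ℕ) (U : Set (Fin n)) : Prop :=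
  ∀ x : Fin n, (x ∈ U → f x = 1) ∧ (x ∉ U → f x = 0)

/-- A log of `r` pairs of vertices, kept in the arrays `f` and `g`, that holds the list `l`. -/
def IsLog {n : ℕ} (r : ℕ) (f g : ℕ → ℕ) (l : List (Fin n × Fin n)) : Prop :=
  r = l.length ∧ Seg f 0 (l.map Prod.fst) ∧ Seg g 0 (l.map Prod.snd)

theorem IsLog.push {n r : ℕ} {f g : ℕ → ℕ} {l : List (Fin n × Fin n)} (h : IsLog r f g l)
    (x y : Fin n) :
    IsLog (r + 1) (Function.update f r x) (Function.update g r y) (l ++ [(x, y)]) := by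
  obtain ⟨rfl, h₁, h₂⟩ := h
  refine ⟨by simp, ?_, ?_⟩
  · simpa using h₁.append_singleton x
  · simpa using h₂.append_singleton y

theorem IsLog.get {n r : ℕ} {f g : ℕ → ℕ} {l : List (Fin n × Fin n)} (h : IsLog r f g l)
    {i : ℕ} (hi : i < l.length) : f i = (l[i]).1 ∧ g i = (l[i]).2 := by
  have h₁ := h.2.1 i (by simpa using hi)
  have h₂ := h.2.2 i (by simpa using hi)
  simpa using And.intro h₁ h₂

/-- The expression for entry `(x, y)` of the matrix in array `a`, where `x` and `y` are the contents
of two registers. -/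
abbrev cellIdx (x y : ℕ) : Expr := .add (.get 3 (.reg x)) (.reg y)

/-- Append the pair of the contents of two registers to the log. -/
def pushPair (x y : ℕ) : Prog :=
  .store 8 (.reg 4) (.reg x) ;; .store 9 (.reg 4) (.reg y) ;; .assign 4 (.add (.reg 4) (.const 1))

/-- The body is executed for all `z` in the adjacency list of the vertex in register `x`. -/
def forAdj (i e z x : ℕ) (body : Prog) : Prog :=
  .assign i (.get 0 (.reg x)) ;; .assign e (.get 0 (.add (.reg x) (.const 1))) ;;
    forSeg i e z 1 body

theorem run_forAdj {n i e z x : ℕ} {body : Prog} {L : Fin n → List (Fin n)} {X : Fin n}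
    (I : List (Fin n) → Mem → Prop) (τ : ℕ) {s : Mem}
    (hinp : IsInput L (s.arr 0) (s.arr 1)) (hx : s.reg x = X)
    (hd : i ≠ e ∧ i ≠ z ∧ e ≠ z ∧ x ≠ i) (hw : (body.wr i || body.wr e || body.wa 1) = false)
    (hs : I [] s)
    (hI : ∀ r k pre s, r = i ∨ r = e ∨ r = z → I pre s → I pre (s.setReg r k))
    (hstep : ∀ (pre : List (Fin n)) (c : Fin n) (post : List (Fin n)), L X = pre ++ c :: post →
      ∀ s', I pre s' → s'.reg z = (c : ℕ) →
      Frame (forAdj i e z x body) s s' →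
      Run body s' fun s'' t => I (pre ++ [c]) s'' ∧ t ≤ τ) :
    Run (forAdj i e z x body) s fun s' t => I (L X) s' ∧ t ≤ (L X).length * (τ + 11) + 12 := by
  have hf : Frame (forAdj i e z x body) s
      ((s.setReg i (s.arr 0 X)).setReg e (s.arr 0 (X + 1))) := by
    refine ⟨fun r hr => ?_, fun _ _ => rfl⟩
    simp only [forAdj, Prog.wr, Bool.or_eq_false_iff, beq_eq_false_iff_ne] at hr
    simp [hr.1.symm, hr.2.1.symm]
  simp only [forAdj, run_seq, run_assign, Expr.eval, hx, Mem.setReg_reg, if_neg hd.2.2.2,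
    Mem.setReg_arr, Expr.cost]
  refine (Run.forSeg (p := s.arr 0 X) I τ ⟨hd.1, hd.2.1, hd.2.2.1⟩ hw
    (hI _ _ _ _ (.inr (.inl rfl)) (hI _ _ _ _ (.inl rfl) hs)) ?_ ?_ (hinp X).2 ?_ ?_).mono ?_
  · simp [hd.1]
  · simp [(hinp X).1]
  · rintro r k pre s (h | h) hp
    · exact hI r k pre s (.inl h) hp
    · exact hI r k pre s (.inr (.inr h)) hp
  · intro pre c post hl s' hp hz hf'
    refine hstep pre c post hl s' hp hz (hf.trans ⟨fun r hr => ?_, fun r hr => ?_⟩)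
    · simp only [forAdj, Prog.wr, Bool.or_eq_false_iff] at hr
      exact hf'.reg r hr.2.2
    · simp only [forAdj, Prog.wa, Bool.false_or] at hr
      exact hf'.arr r hr
  · rintro s' t ⟨h₁, h₂⟩
    exact ⟨h₁, by omega⟩

/-- Addition (`op = true`) or subtraction (`op = false`). -/
def bump (op : Bool) (u k : ℕ) : ℕ := if op then u + k else u - k

/-- The expression for `bump`. -/
def bumpExpr (op : Bool) (e f : Expr) : Expr := if op then .add e f else .sub e f

@[simp] theorem eval_bumpExpr (op : Bool) (e f : Expr) (s : Mem) :
    (bumpExpr op e f).eval s = bump op (e.eval s) (f.eval s) := by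
  cases op <;> rfl

@[simp] theorem cost_bumpExpr (op : Bool) (e f : Expr) :
    (bumpExpr op e f).cost = e.cost + f.cost + 1 := by
  cases op <;> rfl

@[simp] theorem bump_zero (op : Bool) (u : ℕ) : bump op u 0 = u := by
  cases op <;> simp [bump]

/-- The first loop of `updArc`: walks of length two from `a` through `b`, and triangles through the
arc as seen from the third vertex. -/
def updOut (op : Bool) : Prog :=
  forAdj 12 13 14 11 (.ite (.get 5 (cellIdx 11 14))
    (.store 6 (cellIdx 10 14) (bumpExpr op (.get 6 (cellIdx 10 14)) (.const 1)) ;;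
      pushPair 10 14 ;;
      .ite (.get 5 (cellIdx 14 10))
        (.store 7 (.reg 14) (bumpExpr op (.get 7 (.reg 14)) (.const 1))) .skip)
    .skip)

/-- The second loop of `updArc`: walks of length two through `a` to `b`. -/
def updIn (op : Bool) : Prog :=
  forAdj 12 13 14 10 (.ite (.get 5 (cellIdx 14 10))
    (.store 6 (cellIdx 14 11) (bumpExpr op (.get 6 (cellIdx 14 11)) (.const 1)) ;;
      pushPair 14 11)
    .skip)

/-- The insertion (`op = true`) or deletion (`op = false`) of the arc from the vertex `a` in
register `10` to the vertex `b` in register `11`. All changes are logged. -/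
def updArc (op : Bool) : Prog :=
  updOut op ;; updIn op ;;
  .store 7 (.reg 10) (bumpExpr op (.get 7 (.reg 10)) (.get 6 (cellIdx 11 10))) ;;
  .store 7 (.reg 11) (bumpExpr op (.get 7 (.reg 11)) (.get 6 (cellIdx 11 10))) ;;
  .store 5 (cellIdx 10 11) (.const (if op then 1 else 0)) ;;
  pushPair 10 11 ;; pushPair 11 10

section

variable {n ℓ D : ℕ} {L : Fin n → List (Fin n)} {E E₀ : Finset (Fin n × Fin n)}
  {l : List (Fin n × Fin n)} {a b : Fin n} {s : Mem}

theorem run_updOut (op : Bool) (hB : Base L ℓ s) (hL : ∀ x, (L x).Nodup)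
    (hT : Tables (s.arr 5) (s.arr 6) (s.arr 7) E) (hl : IsLog (s.reg 4) (s.arr 8) (s.arr 9) l)
    (ha : s.reg 10 = a) (hb : s.reg 11 = b) (hE : ∀ c, (b, c) ∈ E → c ∈ L b)
    (hD : (L b).length ≤ D) :
    Run (updOut op) s fun s' t =>
      (∀ x y : Fin n, s'.arr 6 (x * n + y) =
        bump op (cnt E x y) (if x = a ∧ (b, y) ∈ E then 1 else 0)) ∧
      (∀ x : Fin n, s'.arr 7 x = bump op (tri E x) (if (b, x) ∈ E ∧ (x, a) ∈ E then 1 else 0)) ∧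
      (∃ l', IsLog (s'.reg 4) (s'.arr 8) (s'.arr 9) (l ++ l') ∧ l'.length ≤ D ∧
        ∀ c, (b, c) ∈ E → (a, c) ∈ l') ∧ t ≤ 70 * (D + 1) := by
  refine (run_forAdj (L := L) (X := b) (fun pre s' =>
    (∀ x y : Fin n, s'.arr 6 (x * n + y) =
        bump op (cnt E x y) (if x = a ∧ y ∈ pre ∧ (b, y) ∈ E then 1 else 0)) ∧
      (∀ x : Fin n, s'.arr 7 x =
        bump op (tri E x) (if x ∈ pre ∧ (b, x) ∈ E ∧ (x, a) ∈ E then 1 else 0)) ∧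
      (∃ l', IsLog (s'.reg 4) (s'.arr 8) (s'.arr 9) (l ++ l') ∧ l'.length ≤ pre.length ∧
        ∀ c ∈ pre, (b, c) ∈ E → (a, c) ∈ l')) 45 hB.inp hb (by decide) (by cases op <;> rfl)
      ⟨?_, ?_, [], ?_⟩ ?_ ?_).mono ?_
  · simpa using hT.cnt
  · simpa using hT.tri
  · simpa using hl
  · rintro r k pre s' (rfl | rfl | rfl) h <;> simpa using h
  · rintro pre c post hpre s' ⟨h₆, h₇, l', hl', hlen, hmem⟩ hz hf
    have hcn : c ∉ pre := by
      have := hL b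
      rw [hpre] at this
      exact fun hc => (List.nodup_append.mp this).2.2 c hc c (by simp) rfl
    have ha' : s'.reg 10 = a := by rw [hf.reg 10 (by cases op <;> rfl), ha]
    have hb' : s'.reg 11 = b := by rw [hf.reg 11 (by cases op <;> rfl), hb]
    have h₃ : ∀ x : Fin n, s'.arr 3 x = x * n := by
      rw [hf.arr 3 (by cases op <;> rfl)]; exact hB.off
    have h₅ : ∀ x y : Fin n, s'.arr 5 (x * n + y) = if (x, y) ∈ E then 1 else 0 := by
      rw [hf.arr 5 (by cases op <;> rfl)]; exact hT.adj
    have hlog := hl'.push a c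
    have c₆ := h₆ a c
    have c₇ := h₇ c
    simp only [hcn, false_and, and_false, if_false, bump_zero] at c₆ c₇
    by_cases hbc : (b, c) ∈ E
    · have H : ∀ (g : ℕ → ℕ), (∀ x : Fin n, g x =
          bump op (tri E x) (if x ∈ pre ++ [c] ∧ (b, x) ∈ E ∧ (x, a) ∈ E then 1 else 0)) →
          ((∀ x y : Fin n, Function.update (s'.arr 6) (a * n + c)
            (bump op (cnt E a c) 1) (x * n + y) = bump op (cnt E x y)
              (if x = a ∧ y ∈ pre ++ [c] ∧ (b, y) ∈ E then 1 else 0)) ∧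
          (∀ x : Fin n, g x = bump op (tri E x)
            (if x ∈ pre ++ [c] ∧ (b, x) ∈ E ∧ (x, a) ∈ E then 1 else 0)) ∧
          (∃ l', IsLog (s'.reg 4 + 1) (Function.update (s'.arr 8) (s'.reg 4) a)
            (Function.update (s'.arr 9) (s'.reg 4) c) (l ++ l') ∧
            l'.length ≤ (pre ++ [c]).length ∧ ∀ d ∈ pre ++ [c], (b, d) ∈ E → (a, d) ∈ l')) := by
        intro g hg
        refine ⟨fun x y => ?_, hg, l' ++ [(a, c)], by simpa using hlog, by simpa using hlen, ?_⟩
        · rw [Function.update_apply]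
          simp only [cell_inj]
          split_ifs with h₁ h₂ h₃ <;> grind
        · intro d hd hbd
          simp only [List.mem_append, List.mem_singleton] at hd ⊢
          rcases hd with hd | rfl
          · exact .inl (hmem d hd hbd)
          · exact .inr rfl
      by_cases hca : (c, a) ∈ E
      · have := H (Function.update (s'.arr 7) c (bump op (tri E c) 1)) fun x => by
          rw [Function.update_apply]
          by_cases hxc : x = c
          · subst hxc; simp [hbc, hca]
          · have : (x : ℕ) ≠ c := fun h => hxc (Fin.ext h)
            simp [this, h₇, hxc]
        simpa [pushPair, Expr.eval, Expr.cost, ha', hb', hz, h₃, h₅, hbc, hca, c₆, c₇] using this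
      · have := H (s'.arr 7) fun x => by
          by_cases hxc : x = c
          · subst hxc; simp [hcn, hca, h₇]
          · simp [h₇, hxc]
        simpa [pushPair, Expr.eval, Expr.cost, ha', hb', hz, h₃, h₅, hbc, hca, c₆, c₇] using this
    · have : ∀ y, (y ∈ pre ++ [c] ∧ (b, y) ∈ E) ↔ (y ∈ pre ∧ (b, y) ∈ E) := by
        intro y
        simp only [List.mem_append, List.mem_singleton]
        grind
      simp only [run_ite, Expr.eval, hb', hz, h₃, h₅, hbc, if_false, run_skip, if_true,
        Expr.cost]
      refine ⟨⟨fun x y => ?_, fun x => ?_, l', hl', by simp; omega, ?_⟩, by norm_num⟩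
      · rw [h₆]; simp only [this]
      · rw [h₇]; simp only [← and_assoc, this]
      · intro d hd hbd
        exact hmem d ((this d).1 ⟨hd, hbd⟩).1 hbd
  · rintro s' t ⟨⟨h₆, h₇, l', hl', hlen, hmem⟩, ht⟩
    refine ⟨fun x y => ?_, fun x => ?_,
      ⟨l', hl', hlen.trans hD, fun c hc => hmem c (hE c hc) hc⟩, ?_⟩
    · rw [h₆]
      congr 2
      simp only [eq_iff_iff, and_congr_right_iff, and_iff_right_iff_imp]
      exact fun _ => hE y
    · rw [h₇]
      congr 2
      simp only [eq_iff_iff, and_iff_right_iff_imp]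
      exact fun h => hE x h.1
    · nlinarith

theorem run_updIn (op : Bool) (hB : Base L ℓ s) (hL : ∀ x, (L x).Nodup)
    (h₅ : ∀ x y : Fin n, s.arr 5 (x * n + y) = if (x, y) ∈ E then 1 else 0) {m : Fin n → Fin n → ℕ}
    (h₆ : ∀ x y : Fin n, s.arr 6 (x * n + y) = m x y)
    (hl : IsLog (s.reg 4) (s.arr 8) (s.arr 9) l)
    (ha : s.reg 10 = a) (hb : s.reg 11 = b) (hE : ∀ c, (c, a) ∈ E → c ∈ L a)
    (hD : (L a).length ≤ D) :
    Run (updIn op) s fun s' t =>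
      (∀ x y : Fin n, s'.arr 6 (x * n + y) =
        bump op (m x y) (if y = b ∧ (x, a) ∈ E then 1 else 0)) ∧
      (∃ l', IsLog (s'.reg 4) (s'.arr 8) (s'.arr 9) (l ++ l') ∧ l'.length ≤ D ∧
        ∀ c, (c, a) ∈ E → (c, b) ∈ l') ∧ t ≤ 60 * (D + 1) := by
  refine (run_forAdj (L := L) (X := a) (fun pre s' =>
    (∀ x y : Fin n, s'.arr 6 (x * n + y) =
        bump op (m x y) (if y = b ∧ x ∈ pre ∧ (x, a) ∈ E then 1 else 0)) ∧
      (∃ l', IsLog (s'.reg 4) (s'.arr 8) (s'.arr 9) (l ++ l') ∧ l'.length ≤ pre.length ∧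
        ∀ c ∈ pre, (c, a) ∈ E → (c, b) ∈ l')) 45 hB.inp ha (by decide) (by cases op <;> rfl)
      ⟨?_, [], ?_⟩ ?_ ?_).mono ?_
  · simpa using h₆
  · simpa using hl
  · rintro r k pre s' (rfl | rfl | rfl) h <;> simpa using h
  · rintro pre c post hpre s' ⟨h₆', l', hl', hlen, hmem⟩ hz hf
    have hcn : c ∉ pre := by
      have := hL a
      rw [hpre] at this
      exact fun hc => (List.nodup_append.mp this).2.2 c hc c (by simp) rfl
    have ha' : s'.reg 10 = a := by rw [hf.reg 10 (by cases op <;> rfl), ha]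
    have hb' : s'.reg 11 = b := by rw [hf.reg 11 (by cases op <;> rfl), hb]
    have h₃ : ∀ x : Fin n, s'.arr 3 x = x * n := by
      rw [hf.arr 3 (by cases op <;> rfl)]; exact hB.off
    have h₅' : ∀ x y : Fin n, s'.arr 5 (x * n + y) = if (x, y) ∈ E then 1 else 0 := by
      rw [hf.arr 5 (by cases op <;> rfl)]; exact h₅
    have hlog := hl'.push c b
    have c₆ := h₆' c b
    simp only [hcn, false_and, and_false, if_false, bump_zero] at c₆
    by_cases hca : (c, a) ∈ E
    · have H : (∀ x y : Fin n, Function.update (s'.arr 6) (c * n + b)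
            (bump op (m c b) 1) (x * n + y) = bump op (m x y)
              (if y = b ∧ x ∈ pre ++ [c] ∧ (x, a) ∈ E then 1 else 0)) ∧
          (∃ l', IsLog (s'.reg 4 + 1) (Function.update (s'.arr 8) (s'.reg 4) c)
            (Function.update (s'.arr 9) (s'.reg 4) b) (l ++ l') ∧
            l'.length ≤ (pre ++ [c]).length ∧ ∀ d ∈ pre ++ [c], (d, a) ∈ E → (d, b) ∈ l') := by
        refine ⟨fun x y => ?_, l' ++ [(c, b)], by simpa using hlog, by simpa using hlen, ?_⟩
        · rw [Function.update_apply]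
          simp only [cell_inj]
          split_ifs with h₁ h₂ h₃ <;> grind
        · intro d hd hbd
          simp only [List.mem_append, List.mem_singleton] at hd ⊢
          rcases hd with hd | rfl
          · exact .inl (hmem d hd hbd)
          · exact .inr rfl
      simpa [pushPair, Expr.eval, Expr.cost, ha', hb', hz, h₃, h₅', hca, c₆] using H
    · have : ∀ x, (x ∈ pre ++ [c] ∧ (x, a) ∈ E) ↔ (x ∈ pre ∧ (x, a) ∈ E) := by
        intro y
        simp only [List.mem_append, List.mem_singleton]
        grind
      simp only [run_ite, Expr.eval, ha', hz, h₃, h₅', hca, if_false, run_skip, if_true,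
        Expr.cost]
      refine ⟨⟨fun x y => ?_, l', hl', by simp; omega, ?_⟩, by norm_num⟩
      · rw [h₆']; simp only [this]
      · intro d hd hbd
        exact hmem d ((this d).1 ⟨hd, hbd⟩).1 hbd
  · rintro s' t ⟨⟨h₆, l', hl', hlen, hmem⟩, ht⟩
    refine ⟨fun x y => ?_, ⟨l', hl', hlen.trans hD, fun c hc => hmem c (hE c hc) hc⟩, ?_⟩
    · rw [h₆]
      congr 2
      simp only [eq_iff_iff, and_congr_right_iff, and_iff_right_iff_imp]
      exact fun _ => hE x
    · nlinarith

/-- The arc set before the update is `E₀` for an insertion and `E₀ ∪ {(a, b)}` for a deletion, and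
the other way round afterwards. -/
theorem run_updArc (op : Bool) (hB : Base L ℓ s) (hL : ∀ x, (L x).Nodup) (hab : a ≠ b)
    (hE₀ : (a, b) ∉ E₀)
    (hT : Tables (s.arr 5) (s.arr 6) (s.arr 7) (if op then E₀ else insert (a, b) E₀))
    (hl : IsLog (s.reg 4) (s.arr 8) (s.arr 9) l) (ha : s.reg 10 = a) (hb : s.reg 11 = b)
    (hEb : ∀ c, (b, c) ∈ E₀ → c ∈ L b) (hEa : ∀ c, (c, a) ∈ E₀ → c ∈ L a)
    (hDa : (L a).length ≤ D) (hDb : (L b).length ≤ D) :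
    Run (updArc op) s fun s' t =>
      Tables (s'.arr 5) (s'.arr 6) (s'.arr 7) (if op then insert (a, b) E₀ else E₀) ∧
      (∃ l', IsLog (s'.reg 4) (s'.arr 8) (s'.arr 9) (l ++ l') ∧ l'.length ≤ 2 * D + 2 ∧
        Recorded E₀ (insert (a, b) E₀) l') ∧ t ≤ 200 * (D + 1) := by
  generalize hE : (if op then E₀ else insert (a, b) E₀) = E at hT
  have hb_iff : ∀ c, (b, c) ∈ E ↔ (b, c) ∈ E₀ := by
    subst hE; intro c; split_ifs <;> simp [hab.symm]
  have ha_iff : ∀ c, (c, a) ∈ E ↔ (c, a) ∈ E₀ := by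
    subst hE; intro c; split_ifs <;> simp [hab]
  have hcba : cnt E b a = cnt E₀ b a := by
    subst hE
    split_ifs
    · rfl
    · rw [cnt_insert hab hE₀]; simp [hab, hab.symm]
  have hba : (b : ℕ) ≠ a := fun h => hab (Fin.ext h.symm)
  simp only [updArc, run_seq]
  refine (run_updOut op hB hL hT hl ha hb (fun c hc => hEb c ((hb_iff c).1 hc)) hDb).frame.mono ?_
  rintro s₁ t₁ ⟨⟨h₆, h₇, ⟨l₁, hl₁, hlen₁, hm₁⟩, ht₁⟩, hf₁⟩
  have ha₁ : s₁.reg 10 = a := by rw [hf₁.reg 10 (by cases op <;> rfl), ha]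
  have hb₁ : s₁.reg 11 = b := by rw [hf₁.reg 11 (by cases op <;> rfl), hb]
  have h₅ : ∀ x y : Fin n, s₁.arr 5 (x * n + y) = if (x, y) ∈ E then 1 else 0 := by
    rw [hf₁.arr 5 (by cases op <;> rfl)]; exact hT.adj
  refine (run_updIn op (hB.frame hf₁ (by cases op <;> rfl)) hL h₅ h₆ hl₁ ha₁ hb₁
    (fun c hc => hEa c ((ha_iff c).1 hc)) hDa).frame.mono ?_
  rintro s₂ t₂ ⟨⟨h₆', ⟨l₂, hl₂, hlen₂, hm₂⟩, ht₂⟩, hf₂⟩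
  have ha₂ : s₂.reg 10 = a := by rw [hf₂.reg 10 (by cases op <;> rfl), ha₁]
  have hb₂ : s₂.reg 11 = b := by rw [hf₂.reg 11 (by cases op <;> rfl), hb₁]
  have h₅' : ∀ x y : Fin n, s₂.arr 5 (x * n + y) = if (x, y) ∈ E then 1 else 0 := by
    rw [hf₂.arr 5 (by cases op <;> rfl)]; exact h₅
  have h₇' : ∀ x : Fin n, s₂.arr 7 x =
      bump op (tri E x) (if (b, x) ∈ E ∧ (x, a) ∈ E then 1 else 0) := by
    rw [hf₂.arr 7 (by cases op <;> rfl)]; exact h₇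
  have h₃ : ∀ x : Fin n, s₂.arr 3 x = x * n := by
    rw [hf₂.arr 3 (by cases op <;> rfl), hf₁.arr 3 (by cases op <;> rfl)]; exact hB.off
  have hcell : s₂.arr 6 (b * n + a) = cnt E₀ b a := by
    rw [h₆', if_neg fun h => hab h.1.symm, if_neg fun h => hab h.1, bump_zero, bump_zero, hcba]
  have hlog := (hl₂.push a b).push b a
  simp only [List.append_assoc, List.cons_append, List.nil_append] at hlog
  simp only [pushPair, run_seq, run_store, run_assign, Expr.eval, eval_bumpExpr, cost_bumpExpr,
    Mem.setReg_reg, Mem.setReg_arr, Mem.setArr_reg, Mem.setArr_arr, ha₂, hb₂, h₃, hcell, Expr.cost,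
    if_true, if_false, Nat.reduceEqDiff]
  refine ⟨⟨fun x y => ?_, fun x y => ?_, fun x => ?_⟩, ⟨_, hlog, ?_, ?_⟩, ?_⟩
  · rw [Function.update_apply, h₅', ← hE]
    by_cases hxy : x = a ∧ y = b
    · rw [if_pos (cell_inj.2 hxy)]
      obtain ⟨rfl, rfl⟩ := hxy
      cases op <;> simp [hE₀]
    · rw [if_neg (mt cell_inj.1 hxy)]
      cases op <;> simp [hxy]
  · rw [h₆']
    simp only [ha_iff, hb_iff]
    rw [← hE]
    cases op
    · simp only [Bool.false_eq_true, if_false, cnt_insert hab hE₀, bump]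
      omega
    · simp only [if_true, cnt_insert hab hE₀, bump]
  · have hT' := tri_insert hab hE₀ x
    simp only [Function.update_apply, h₇', ha_iff, hb_iff, ← Fin.ext_iff]
    rw [← hE]
    rcases eq_or_ne x a with rfl | hxa
    · rw [if_neg hab, if_pos rfl]
      rw [if_neg hab, if_pos rfl] at hT'
      cases op
      · simp only [Bool.false_eq_true, if_false, bump]
        omega
      · simp only [if_true, bump]
        omega
    · rcases eq_or_ne x b with rfl | hxb
      · rw [if_pos rfl, if_neg hab.symm]
        rw [if_pos rfl, if_neg hab.symm] at hT'
        cases op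
        · simp only [Bool.false_eq_true, if_false, bump]
          omega
        · simp only [if_true, bump]
          omega
      · rw [if_neg hxb, if_neg hxa]
        rw [if_neg hxb, if_neg hxa] at hT'
        cases op
        · simp only [Bool.false_eq_true, if_false, bump]
          omega
        · simp only [if_true, bump]
          omega
  · simp only [List.length_append, List.length_cons, List.length_nil]
    omega
  · refine recorded_insert hab hE₀ (fun c hc => ?_) (fun c hc => ?_) (by simp) (by simp)
    · simp [hm₁ c ((hb_iff c).2 hc)]
    · simp [hm₂ c ((ha_iff c).2 hc)]
  · omega

end

/-- Memory `s` represents the graph with vertex set `U` and arc set `E`, and the log is `l`. -/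
structure Holds {n : ℕ} (L : Fin n → List (Fin n)) (ℓ : ℕ) (s : Mem) (U : Set (Fin n))
    (E : Finset (Fin n × Fin n)) (l : List (Fin n × Fin n)) : Prop where
  base : Base L ℓ s
  alive : IsIndicator (s.arr 4) U
  tables : Tables (s.arr 5) (s.arr 6) (s.arr 7) E
  log : IsLog (s.reg 4) (s.arr 8) (s.arr 9) l

theorem Holds.of_eq {n : ℕ} {L : Fin n → List (Fin n)} {ℓ : ℕ} {s s' : Mem} {U : Set (Fin n)}
    {E : Finset (Fin n × Fin n)} {l : List (Fin n × Fin n)} (h : Holds L ℓ s U E l)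
    (hr : s'.reg 0 = s.reg 0 ∧ s'.reg 1 = s.reg 1 ∧ s'.reg 4 = s.reg 4)
    (ha : ∀ a < 10, a ≠ 2 → s'.arr a = s.arr a) : Holds L ℓ s' U E l where
  base := h.base.of_eq hr.1 hr.2.1 (ha 0 (by norm_num) (by norm_num))
    (ha 1 (by norm_num) (by norm_num)) (ha 3 (by norm_num) (by norm_num))
  alive := by rw [ha 4 (by norm_num) (by norm_num)]; exact h.alive
  tables := by
    rw [ha 5 (by norm_num) (by norm_num), ha 6 (by norm_num) (by norm_num),
      ha 7 (by norm_num) (by norm_num)]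
    exact h.tables
  log := by
    rw [hr.2.2, ha 8 (by norm_num) (by norm_num), ha 9 (by norm_num) (by norm_num)]
    exact h.log

theorem Holds.setReg {n : ℕ} {L : Fin n → List (Fin n)} {ℓ : ℕ} {s : Mem} {U : Set (Fin n)}
    {E : Finset (Fin n × Fin n)} {l : List (Fin n × Fin n)} (h : Holds L ℓ s U E l) {r : ℕ}
    (k : ℕ) (hr : r ≠ 0 ∧ r ≠ 1 ∧ r ≠ 4) : Holds L ℓ (s.setReg r k) U E l :=
  h.of_eq (by simp [hr.1.symm, hr.2.1.symm, hr.2.2.symm]) fun _ _ _ => rfl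

/-- The deletion of the edge between the vertices in registers `x` and `y`. -/
def delEdge (x y : ℕ) : Prog :=
  .assign 10 (.reg x) ;; .assign 11 (.reg y) ;; updArc false ;;
  .assign 10 (.reg y) ;; .assign 11 (.reg x) ;; updArc false

/-- The deletion of the vertex in register `15`. -/
def delVertex : Prog :=
  forAdj 16 17 18 15 (.ite (.get 5 (cellIdx 15 18)) (delEdge 15 18) .skip) ;;
  .store 4 (.reg 15) (.const 0)

section

variable {n ℓ D : ℕ} {G : SimpleGraph (Fin n)} {L : Fin n → List (Fin n)}
  {E : Finset (Fin n × Fin n)} {U : Set (Fin n)} {l : List (Fin n × Fin n)} {s : Mem}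

theorem run_delEdge {x y : ℕ} {a b : Fin n} (hL : IsAdjLists G L)
    (hE : ∀ u w, (u, w) ∈ E → G.Adj u w) (hS : Holds L ℓ s U E l)
    (hx : s.reg x = a) (hy : s.reg y = b) (hxy : 15 ≤ x ∧ 15 ≤ y)
    (hab : (a, b) ∈ E) (hba : (b, a) ∈ E) (hDa : (L a).length ≤ D) (hDb : (L b).length ≤ D) :
    Run (delEdge x y) s fun s' t => ∃ l',
      Holds L ℓ s' U ((E.erase (a, b)).erase (b, a)) (l ++ l') ∧ l'.length ≤ 4 * D + 4 ∧
      Recorded E ((E.erase (a, b)).erase (b, a)) l' ∧ t ≤ 410 * (D + 1) := by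
  have hne : a ≠ b := (hE _ _ hab).ne
  have hwx : (updArc false).wr x = false := by
    simp [updArc, updOut, updIn, forAdj, forSeg, pushPair, Prog.wr]
    omega
  have hwy : (updArc false).wr y = false := by
    simp [updArc, updOut, updIn, forAdj, forSeg, pushPair, Prog.wr]
    omega
  have hx' : x ≠ 10 ∧ x ≠ 11 := by omega
  have hy' : y ≠ 10 ∧ y ≠ 11 := by omega
  have hmem : ∀ {u w}, (u, w) ∈ E → w ∈ L u ∧ u ∈ L w := fun h =>
    ⟨((hL _).2 _).2 (hE _ _ h), ((hL _).2 _).2 (hE _ _ h).symm⟩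
  simp only [delEdge, run_seq, run_assign, Expr.eval, Mem.setReg_reg, hx, hy, hy'.1, if_false]
  have h₀ := (hS.setReg (r := 10) a (by decide)).setReg (r := 11) b (by decide)
  have hT₀ := h₀.tables
  rw [← Finset.insert_erase hab] at hT₀
  refine (run_updArc (E₀ := E.erase (a, b)) (D := D) false h₀.base (fun x => (hL x).1) hne (by simp)
    hT₀ h₀.log (by simp) (by simp)
    (fun c hc => (hmem (Finset.mem_of_mem_erase hc)).1)
    (fun c hc => (hmem (Finset.mem_of_mem_erase hc)).2) hDa hDb).frame.mono ?_
  rintro s₁ t₁ ⟨⟨hT₁, ⟨l₁, hl₁, hlen₁, hr₁⟩, ht₁⟩, hf₁⟩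
  simp only [Finset.insert_erase hab] at hr₁
  have hba' : (b, a) ∈ E.erase (a, b) := by simp [hba, hne.symm]
  simp only [hf₁.reg x hwx, hf₁.reg y hwy, Mem.setReg_reg, hx'.1, hx'.2, hy'.1, hy'.2, hx, hy,
    if_false]
  have h₁ : Holds L ℓ s₁ U (E.erase (a, b)) (l ++ l₁) := by
    refine ⟨h₀.base.frame hf₁ rfl, ?_, by simpa using hT₁, hl₁⟩
    rw [hf₁.arr 4 rfl]
    exact h₀.alive
  have h₂ := (h₁.setReg (r := 10) b (by decide)).setReg (r := 11) a (by decide)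
  have hT₂ := h₂.tables
  rw [← Finset.insert_erase hba'] at hT₂
  refine (run_updArc (E₀ := (E.erase (a, b)).erase (b, a)) (D := D) false h₂.base
    (fun x => (hL x).1) hne.symm (by simp) hT₂ h₂.log (by simp) (by simp)
    (fun c hc => (hmem (Finset.mem_of_mem_erase (Finset.mem_of_mem_erase hc))).1)
    (fun c hc => (hmem (Finset.mem_of_mem_erase (Finset.mem_of_mem_erase hc))).2)
    hDb hDa).frame.mono ?_
  rintro s₂ t₂ ⟨⟨hT₃, ⟨l₂, hl₂, hlen₂, hr₂⟩, ht₂⟩, hf₂⟩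
  simp only [Finset.insert_erase hba'] at hr₂
  refine ⟨l₁ ++ l₂, ⟨h₂.base.frame hf₂ rfl, ?_, by simpa using hT₃, by simpa using hl₂⟩, ?_, ?_, ?_⟩
  · rw [hf₂.arr 4 rfl]
    exact h₂.alive
  · rw [List.length_append]
    omega
  · exact hr₁.symm.trans hr₂.symm
  · simp only [Expr.cost]
    omega

theorem run_delVertex {d : Fin n} (hL : IsAdjLists G L)
    (hE : ∀ u w, (u, w) ∈ E → G.Adj u w) (hsymm : ∀ u w, (u, w) ∈ E → (w, u) ∈ E)
    (hS : Holds L ℓ s U E l) (hd : s.reg 15 = d)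
    (hDd : (L d).length ≤ D) (hD : ∀ u, (d, u) ∈ E → (L u).length ≤ D) :
    Run delVertex s fun s' t => ∃ l',
      Holds L ℓ s' (U \ {d}) {p ∈ E | p.1 ≠ d ∧ p.2 ≠ d} (l ++ l') ∧
      l'.length ≤ 4 * (D + 1) ^ 2 ∧ Recorded E {p ∈ E | p.1 ≠ d ∧ p.2 ≠ d} l' ∧
      t ≤ 500 * (D + 1) ^ 2 := by
  let F : List (Fin n) → Finset (Fin n × Fin n) := fun pre =>
    {p ∈ E | ¬ (p.1 = d ∧ p.2 ∈ pre) ∧ ¬ (p.2 = d ∧ p.1 ∈ pre)}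
  have hF : ∀ {pre u w}, (u, w) ∈ F pre ↔
      (u, w) ∈ E ∧ ¬ (u = d ∧ w ∈ pre) ∧ ¬ (w = d ∧ u ∈ pre) := by simp [F]
  simp only [delVertex, run_seq, run_store]
  refine (run_forAdj (L := L) (X := d) (fun pre s' => ∃ l', Holds L ℓ s' U (F pre) (l ++ l') ∧
    l'.length ≤ pre.length * (4 * D + 4) ∧ Recorded E (F pre) l') (410 * (D + 1) + 10)
    hS.base.inp hd (by decide) rfl ⟨[], ?_, by simp, ?_⟩ ?_ ?_).frame.mono ?_
  · simpa [F] using hS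
  · simpa [F] using Recorded.refl E
  · rintro r k pre s' hr ⟨l', h₁, h₂⟩
    exact ⟨l', h₁.setReg k (by omega), h₂⟩
  · rintro pre c post hpre s' ⟨l₁, h₁, hlen₁, hr₁⟩ hz hf
    have hd' : s'.reg 15 = d := by rw [hf.reg 15 rfl, hd]
    have hcn : c ∉ pre := by
      have := (hL d).1
      rw [hpre] at this
      exact fun hc => (List.nodup_append.mp this).2.2 c hc c (by simp) rfl
    have hadj : G.Adj d c := ((hL d).2 c).1 (by simp [hpre])
    simp only [run_ite, Expr.eval, hd', hz, h₁.base.off, h₁.tables.adj, run_skip, Expr.cost]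
    by_cases hdc : (d, c) ∈ E
    · have hdc' : (d, c) ∈ F pre := hF.2 ⟨hdc, by simp [hcn], by simp [hadj.ne.symm]⟩
      have hcd' : (c, d) ∈ F pre := hF.2 ⟨hsymm _ _ hdc, by simp [hadj.ne.symm], by simp [hcn]⟩
      simp only [hdc', if_true, one_ne_zero, if_false]
      refine (run_delEdge hL (fun u w h => hE u w (hF.1 h).1) h₁ hd' hz (by decide) hdc' hcd' hDd
        (hD c hdc)).mono ?_
      rintro s'' t ⟨l₂, h₂, hlen₂, hr₂, ht⟩
      have hFF : ((F pre).erase (d, c)).erase (c, d) = F (pre ++ [c]) := by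
        ext ⟨u, w⟩
        simp only [Finset.mem_erase, hF, List.mem_append, List.mem_singleton, ne_eq, Prod.mk.injEq]
        tauto
      rw [hFF] at h₂ hr₂
      refine ⟨⟨l₁ ++ l₂, by simpa using h₂, ?_, hr₁.trans hr₂⟩, by omega⟩
      rw [List.length_append, List.length_append, List.length_singleton, add_mul]
      omega
    · have hdc' : (d, c) ∉ F pre := fun h => hdc (hF.1 h).1
      have hFF : F pre = F (pre ++ [c]) := by
        ext ⟨u, w⟩
        have := hsymm c d
        simp only [hF, List.mem_append, List.mem_singleton]
        constructor
        · rintro ⟨huw, h₂, h₃⟩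
          refine ⟨huw, ?_, ?_⟩
          · rintro ⟨rfl, h | rfl⟩
            · exact h₂ ⟨rfl, h⟩
            · exact hdc huw
          · rintro ⟨rfl, h | rfl⟩
            · exact h₃ ⟨rfl, h⟩
            · exact hdc (this huw)
        · tauto
      simp only [hdc', if_true, if_false]
      rw [← hFF]
      refine ⟨⟨l₁, h₁, hlen₁.trans ?_, hr₁⟩, by omega⟩
      simp
  · rintro s₁ t₁ ⟨⟨⟨l₁, h₁, hlen₁, hr₁⟩, ht₁⟩, hf⟩
    have hFL : F (L d) = {p ∈ E | p.1 ≠ d ∧ p.2 ≠ d} := by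
      ext ⟨u, w⟩
      simp only [hF, Finset.mem_filter, ne_eq]
      refine and_congr_right fun huw => ?_
      have h₁ : u = d → w ∈ L d := by
        rintro rfl
        exact ((hL _).2 _).2 (hE _ _ huw)
      have h₂ : w = d → u ∈ L d := by
        rintro rfl
        exact ((hL _).2 _).2 (hE _ _ huw).symm
      tauto
    rw [hFL] at h₁ hr₁
    have hd₁ : s₁.reg 15 = d := by rw [hf.reg 15 rfl, hd]
    refine ⟨l₁, ⟨h₁.base.of_eq rfl rfl rfl rfl rfl, ?_, h₁.tables, h₁.log⟩, ?_, hr₁, ?_⟩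
    · intro x
      simp only [Expr.eval, hd₁, Mem.setArr_arr, if_true, Function.update_apply, ← Fin.ext_iff,
        Set.mem_sdiff, Set.mem_singleton_iff]
      have := h₁.alive x
      split_ifs with h
      · simp [h]
      · simpa [h] using this
    · nlinarith
    · simp only [Expr.cost]
      nlinarith

end

/-! ### The Low-Triangle Rule on the machine -/

/-- The machine is working on the current graph `H` for the vertex `v`; the list `vs` contains all
vertices of `H`. Two queues share the log `l`: the queue of the Low-Triangle Rule is the log from
position `p` on, and the queue of conflicts is the log from position `q` on. -/
structure Work {n : ℕ} {G : SimpleGraph (Fin n)} (L : Fin n → List (Fin n)) (ℓ : ℕ)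
    (v : Fin n) (vs : List (Fin n)) (H : G.Subgraph) (l : List (Fin n × Fin n)) (p q : ℕ)
    (s : Mem) : Prop where
  holds : Holds L ℓ s H.verts (arcs H) l
  verts_subset : ∀ x ∈ H.verts, x ∈ vs
  reg_two : s.reg 2 = v
  reg_three : s.reg 3 = vs.length
  seg : Seg (s.arr 10) 0 vs
  reg_five : s.reg 5 = p
  le_five : p ≤ l.length
  reg_six : s.reg 6 = q
  le_six : q ≤ l.length

/-- The potential that pays for the log entries not yet processed by either queue, for the deletion
of the remaining edges, and for the deletion of the remaining vertices. -/
noncomputable def pot {n : ℕ} {G : SimpleGraph (Fin n)} (D : ℕ) (H : G.Subgraph)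
    (l : List (Fin n × Fin n)) (p q : ℕ) : ℕ :=
  60 * (l.length - p) + 150 * (l.length - q) + 700 * ((D + 1) * (arcs H).card) +
    2000 * ((D + 1) ^ 2 * H.verts.ncard)

theorem CoversLow.pop_vertex {n ℓ : ℕ} {U : Set (Fin n)} {E : Finset (Fin n × Fin n)} {x y : Fin n}
    {q : List (Fin n × Fin n)} (h : CoversLow ℓ .vertex U E ((x, y) :: q))
    (hx : x ∈ U → ¬ tri E x < ℓ + ℓ) : CoversLow ℓ .vertex U E q := by
  intro u hu ht
  obtain ⟨w, hw⟩ := h u hu ht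
  refine ⟨w, (List.mem_cons.mp hw).resolve_left ?_⟩
  rintro ⟨⟩
  exact hx hu ht

theorem CoversLow.pop_edge {n ℓ : ℕ} {U : Set (Fin n)} {E : Finset (Fin n × Fin n)} {x y : Fin n}
    {q : List (Fin n × Fin n)} (h : CoversLow ℓ .edge U E ((x, y) :: q))
    (hx : (x, y) ∈ E → ¬ cnt E x y < ℓ) : CoversLow ℓ .edge U E q := by
  intro u w hu ht
  refine (List.mem_cons.mp (h u w hu ht)).resolve_left ?_
  rintro ⟨⟩
  exact hx hu ht

theorem drop_eq_cons {α : Type*} {l : List (α × α)} {p : ℕ} (h : p < l.length) :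
    l.drop p = (l[p].1, l[p].2) :: l.drop (p + 1) := List.drop_eq_getElem_cons h

section

variable {n ℓ D : ℕ} {G : SimpleGraph (Fin n)} {L : Fin n → List (Fin n)} {v : Fin n}
  {vs : List (Fin n)} {H H' : G.Subgraph} {l l' : List (Fin n × Fin n)} {p q : ℕ} {s : Mem}

theorem pot_deleteVerts {d : Fin n} (hd : d ∈ H.verts) (hl : l'.length ≤ 4 * (D + 1) ^ 2)
    (hp : p ≤ l.length) (hq : q ≤ l.length) :
    1160 * (D + 1) ^ 2 + pot D (H.deleteVerts {d}) (l ++ l') p q ≤ pot D H l p q := by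
  have h₁ : (arcs (H.deleteVerts {d})).card ≤ (arcs H).card := by
    rw [arcs_deleteVerts]
    exact Finset.card_filter_le _ _
  have h₂ : (H.deleteVerts {d}).verts.ncard + 1 = H.verts.ncard :=
    Set.ncard_sdiff_singleton_add_one hd (Set.toFinite _)
  have h₃ := Nat.mul_le_mul_left (D + 1) h₁
  simp only [pot, List.length_append, ← h₂, mul_add, mul_one]
  omega

theorem pot_deleteEdges {a b : Fin n} (hab : H.Adj a b) (hl : l'.length ≤ 4 * D + 4)
    (hp : p ≤ l.length) (hq : q ≤ l.length) :
    560 * (D + 1) + pot D (H.deleteEdges {s(a, b)}) (l ++ l') p q ≤ pot D H l p q := by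
  have h₁ : (arcs (H.deleteEdges {s(a, b)})).card + 2 = (arcs H).card := by
    rw [arcs_deleteEdges]
    have e₁ : (a, b) ∈ arcs H := mem_arcs.2 hab
    have e₂ : (b, a) ∈ (arcs H).erase (a, b) := by simp [hab.symm, hab.ne.symm]
    rw [Finset.card_erase_of_mem e₂, Finset.card_erase_of_mem e₁]
    have := Finset.card_pos.2 ⟨_, e₂⟩
    rw [Finset.card_erase_of_mem e₁] at this
    omega
  simp only [pot, List.length_append, ← h₁, mul_add, SimpleGraph.Subgraph.deleteEdges_verts]
  omega

/-- Registers that do not describe the current state may be changed. -/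
theorem Work.setReg (h : Work L ℓ v vs H l p q s) {r : ℕ} (k : ℕ) (hr : 6 < r) :
    Work L ℓ v vs H l p q (s.setReg r k) := by
  have e : ∀ i ≤ 6, (s.setReg r k).reg i = s.reg i := fun i hi => by
    simp [show i ≠ r by omega]
  exact ⟨h.holds.setReg k (by omega), h.verts_subset, by rw [e 2 (by norm_num), h.reg_two],
    by rw [e 3 (by norm_num), h.reg_three], h.seg, by rw [e 5 (by norm_num), h.reg_five],
    h.le_five, by rw [e 6 (by norm_num), h.reg_six], h.le_six⟩

theorem Work.setReg_five (h : Work L ℓ v vs H l p q s) {p' : ℕ} (hp : p' ≤ l.length) :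
    Work L ℓ v vs H l p' q (s.setReg 5 p') :=
  ⟨h.holds.setReg _ (by decide), h.verts_subset, by simp [h.reg_two], by simp [h.reg_three], h.seg,
    by simp, hp, by simp [h.reg_six], h.le_six⟩

theorem Work.setReg_six (h : Work L ℓ v vs H l p q s) {q' : ℕ} (hq : q' ≤ l.length) :
    Work L ℓ v vs H l p q' (s.setReg 6 q') :=
  ⟨h.holds.setReg _ (by decide), h.verts_subset, by simp [h.reg_two], by simp [h.reg_three], h.seg,
    by simp [h.reg_five], h.le_five, by simp, hq⟩

theorem Work.frame {U : Prog} {s' : Mem} (h : Work L ℓ v vs H l p q s) (hf : Frame U s s')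
    (hw : (U.wr 2 || U.wr 3 || U.wr 5 || U.wr 6 || U.wa 10) = false)
    {r : List (Fin n × Fin n)} (hH : Holds L ℓ s' H'.verts (arcs H') (l ++ r))
    (hsub : H'.verts ⊆ H.verts) : Work L ℓ v vs H' (l ++ r) p q s' := by
  simp only [Bool.or_eq_false_iff] at hw
  obtain ⟨⟨⟨⟨h₂, h₃⟩, h₅⟩, h₆⟩, h₁₀⟩ := hw
  refine ⟨hH, fun x hx => h.verts_subset x (hsub hx), by rw [hf.reg 2 h₂, h.reg_two],
    by rw [hf.reg 3 h₃, h.reg_three], by rw [hf.arr 10 h₁₀]; exact h.seg,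
    by rw [hf.reg 5 h₅, h.reg_five], ?_, by rw [hf.reg 6 h₆, h.reg_six], ?_⟩
  · simpa using h.le_five.trans (Nat.le_add_right _ _)
  · simpa using h.le_six.trans (Nat.le_add_right _ _)

/-- Deleting the vertex in register `15` from the current graph. -/
theorem Work.run_delVertex (hL : IsAdjLists G L)
    (hD : ∀ x ∈ vs, (L x).length ≤ D) (h : Work L ℓ v vs H l p q s) {d : Fin n}
    (hd : s.reg 15 = d) (hdH : d ∈ H.verts) :
    Run delVertex s fun s' t => ∃ r, Work L ℓ v vs (H.deleteVerts {d}) (l ++ r) p q s' ∧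
      Recorded (arcs H) (arcs (H.deleteVerts {d})) r ∧
      t + 660 * (D + 1) ^ 2 + pot D (H.deleteVerts {d}) (l ++ r) p q ≤ pot D H l p q := by
  refine (TriangleClub.run_delVertex (D := D) hL (fun u w huw => (mem_arcs.1 huw).adj_sub)
    (fun u w huw => mem_arcs.2 (mem_arcs.1 huw).symm) h.holds hd (hD d (h.verts_subset d hdH))
    fun u hu => hD u (h.verts_subset u (mem_arcs.1 hu).snd_mem)).frame.mono ?_
  rintro s' t ⟨⟨r, h₁, hlen, hrec, ht⟩, hf⟩
  rw [← arcs_deleteVerts] at h₁ hrec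
  have hpot := pot_deleteVerts (D := D) hdH hlen h.le_five h.le_six
  exact ⟨r, h.frame hf rfl h₁ Set.sdiff_subset, hrec, by omega⟩

/-- Deleting the edge between the vertices in registers `20` and `21` from the current graph. -/
theorem Work.run_delEdge (hL : IsAdjLists G L)
    (hD : ∀ x ∈ vs, (L x).length ≤ D) (h : Work L ℓ v vs H l p q s) {a b : Fin n}
    (ha : s.reg 20 = a) (hb : s.reg 21 = b) (hab : H.Adj a b) :
    Run (delEdge 20 21) s fun s' t => ∃ r,
      Work L ℓ v vs (H.deleteEdges {s(a, b)}) (l ++ r) p q s' ∧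
      Recorded (arcs H) (arcs (H.deleteEdges {s(a, b)})) r ∧
      t + 150 * (D + 1) + pot D (H.deleteEdges {s(a, b)}) (l ++ r) p q ≤ pot D H l p q := by
  refine (TriangleClub.run_delEdge (D := D) hL (fun u w huw => (mem_arcs.1 huw).adj_sub)
    h.holds ha hb (by decide) (mem_arcs.2 hab) (mem_arcs.2 hab.symm)
    (hD a (h.verts_subset a hab.fst_mem)) (hD b (h.verts_subset b hab.snd_mem))).frame.mono ?_
  rintro s' t ⟨⟨r, h₁, hlen, hrec, ht⟩, hf⟩
  rw [← arcs_deleteEdges] at h₁ hrec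
  have hpot := pot_deleteEdges (D := D) hab hlen h.le_five h.le_six
  exact ⟨r, h.frame hf rfl h₁ subset_rfl, hrec, by omega⟩

/-- The Low-Triangle Rule in the vertex variant: a vertex that has become low is the first component
of some pair in the queue. -/
def ltrVertex : Prog :=
  .loop (.sub (.reg 4) (.reg 5))
    (.assign 15 (.get 8 (.reg 5)) ;; .assign 5 (.add (.reg 5) (.const 1)) ;;
      .ite (.sub (.get 4 (.reg 15))
          (.sub (.const 1) (.sub (.add (.reg 1) (.reg 1)) (.get 7 (.reg 15)))))
        delVertex .skip)

/-- The deletion of all edges in less than `ℓ` triangles. -/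
def ltrEdges : Prog :=
  .loop (.sub (.reg 4) (.reg 5))
    (.assign 20 (.get 8 (.reg 5)) ;; .assign 21 (.get 9 (.reg 5)) ;;
      .assign 5 (.add (.reg 5) (.const 1)) ;;
      .ite (.sub (.get 5 (cellIdx 20 21))
          (.sub (.const 1) (.sub (.reg 1) (.get 6 (cellIdx 20 21)))))
        (delEdge 20 21) .skip)

/-- The deletion of all isolated vertices. The number of walks of length two from a vertex to itself
is its degree. -/
def ltrIsolated : Prog :=
  .assign 19 (.const 0) ;;
  forSeg 19 3 22 10 (.ite (.sub (.get 4 (.reg 22)) (.get 6 (cellIdx 22 22)))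
    (.store 4 (.reg 22) (.const 0)) .skip)

/-- The Low-Triangle Rule, applied exhaustively. -/
def ltr : Variant → Prog
  | .vertex => ltrVertex
  | .edge => ltrEdges ;; ltrIsolated

theorem pot_pop_five {p q : ℕ} (hp : p < l.length) :
    60 + pot D H l (p + 1) q = pot D H l p q := by
  simp only [pot]
  omega

theorem run_ltrVertex (hL : IsAdjLists G L) (hD : ∀ x ∈ vs, (L x).length ≤ D)
    (h : Work L ℓ v vs H l p q s) (hlow : CoversLow ℓ .vertex H.verts (arcs H) (l.drop p))
    (hcon : CoversConflicts H.verts (arcs H) (l.drop q)) :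
    Run ltrVertex s fun s' t => ∃ H' l', LTR ℓ .vertex H H' ∧
      Work L ℓ v vs H' l' l'.length q s' ∧ CoversLow ℓ .vertex H'.verts (arcs H') [] ∧
      CoversConflicts H'.verts (arcs H') (l'.drop q) ∧
      t + pot D H' l' l'.length q ≤ pot D H l p q + 10 := by
  refine (Run.loop (fun s' φ => ∃ H' l' p', Relation.ReflTransGen (LTRStep ℓ .vertex) H H' ∧
    Work L ℓ v vs H' l' p' q s' ∧ CoversLow ℓ .vertex H'.verts (arcs H') (l'.drop p') ∧
    CoversConflicts H'.verts (arcs H') (l'.drop q) ∧ φ = pot D H' l' p' q)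
    ⟨H, l, p, .refl, h, hlow, hcon, rfl⟩ ?_).mono ?_
  · rintro s₁ φ ⟨H₁, l₁, p₁, hst, h₁, hlow₁, hcon₁, rfl⟩ hf h₀
    simp only [Expr.eval, h₁.reg_five, h₁.holds.log.1] at h₀
    have hp : p₁ < l₁.length := by omega
    have hpot := pot_pop_five (D := D) (H := H₁) (q := q) hp
    rw [drop_eq_cons hp] at hlow₁
    have h₈ : s₁.arr 8 p₁ = (l₁[p₁].1 : ℕ) := (h₁.holds.log.get hp).1
    generalize l₁[p₁].1 = x at h₈ hlow₁
    have h₂ := (h₁.setReg (r := 15) x (by norm_num)).setReg_five (p' := p₁ + 1) hp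
    have hT := h₁.holds.tables.tri x
    have hA := h₁.holds.alive x
    have hℓ := h₁.holds.base.reg_one
    simp only [run_seq, run_assign, run_ite, Expr.eval, h₁.reg_five, h₈, Mem.setReg_reg,
      Mem.setReg_arr, Nat.reduceEqDiff, OfNat.one_ne_ofNat, if_false, if_true, hT, hℓ, run_skip]
    by_cases hc : x ∈ H₁.verts ∧ tri (arcs H₁) x < ℓ + ℓ
    · rw [if_neg (by rw [hA.1 hc.1]; omega)]
      refine (h₂.run_delVertex hL hD (by simp) hc.1).mono ?_
      rintro s₂ t ⟨r, hW, hrec, ht⟩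
      have hsub : (H₁.deleteVerts {x}).verts ⊆ H₁.verts := Set.sdiff_subset
      refine ⟨_, ⟨_, _, _, hst.tail (.vertex hc.1 ?_), hW, ?_, ?_, rfl⟩, ?_⟩
      · have := two_mul_vertexTriangles H₁ x
        omega
      · rw [List.drop_append_of_le_length hp]
        exact (hlow₁.recorded hrec hsub).pop_vertex fun hx => absurd rfl hx.2
      · rw [List.drop_append_of_le_length h₁.le_six]
        exact hcon₁.recorded hrec hsub
      · simp only [Expr.cost]
        omega
    · rw [if_pos]
      · refine ⟨_, ⟨_, _, _, hst, h₂, ?_, hcon₁, rfl⟩, ?_⟩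
        · exact hlow₁.pop_vertex fun hx ht => hc ⟨hx, ht⟩
        · simp only [Expr.cost]
          omega
      · by_cases hx : x ∈ H₁.verts
        · rw [hA.1 hx]
          have : ¬ tri (arcs H₁) x < ℓ + ℓ := fun ht => hc ⟨hx, ht⟩
          omega
        · rw [hA.2 hx]
          omega
  · rintro s₁ t ⟨φ, ⟨H₁, l₁, p₁, hst, h₁, hlow₁, hcon₁, rfl⟩, h₀, ht⟩
    simp only [Expr.eval, h₁.reg_five, h₁.holds.log.1] at h₀
    obtain rfl : p₁ = l₁.length := by have := h₁.le_five; omega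
    rw [List.drop_length] at hlow₁
    refine ⟨H₁, l₁, .of_vertex hst hlow₁, h₁, hlow₁, hcon₁, ?_⟩
    simp only [Expr.cost] at ht
    omega

theorem run_ltrEdges (hL : IsAdjLists G L) (hD : ∀ x ∈ vs, (L x).length ≤ D)
    (h : Work L ℓ v vs H l p q s) (hlow : CoversLow ℓ .edge H.verts (arcs H) (l.drop p))
    (hcon : CoversConflicts H.verts (arcs H) (l.drop q)) :
    Run ltrEdges s fun s' t => ∃ H' l', Relation.ReflTransGen (LTRStep ℓ .edge) H H' ∧
      Work L ℓ v vs H' l' l'.length q s' ∧ CoversLow ℓ .edge H'.verts (arcs H') [] ∧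
      CoversConflicts H'.verts (arcs H') (l'.drop q) ∧
      t + pot D H' l' l'.length q ≤ pot D H l p q + 10 := by
  refine (Run.loop (fun s' φ => ∃ H' l' p', Relation.ReflTransGen (LTRStep ℓ .edge) H H' ∧
    Work L ℓ v vs H' l' p' q s' ∧ CoversLow ℓ .edge H'.verts (arcs H') (l'.drop p') ∧
    CoversConflicts H'.verts (arcs H') (l'.drop q) ∧ φ = pot D H' l' p' q)
    ⟨H, l, p, .refl, h, hlow, hcon, rfl⟩ ?_).mono ?_
  · rintro s₁ φ ⟨H₁, l₁, p₁, hst, h₁, hlow₁, hcon₁, rfl⟩ hf h₀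
    simp only [Expr.eval, h₁.reg_five, h₁.holds.log.1] at h₀
    have hp : p₁ < l₁.length := by omega
    have hpot := pot_pop_five (D := D) (H := H₁) (q := q) hp
    rw [drop_eq_cons hp] at hlow₁
    have h₈ : s₁.arr 8 p₁ = (l₁[p₁].1 : ℕ) := (h₁.holds.log.get hp).1
    have h₉ : s₁.arr 9 p₁ = (l₁[p₁].2 : ℕ) := (h₁.holds.log.get hp).2
    generalize l₁[p₁].1 = x at h₈ hlow₁
    generalize l₁[p₁].2 = y at h₉ hlow₁
    have h₂ := ((h₁.setReg (r := 20) x (by norm_num)).setReg (r := 21) y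
      (by norm_num)).setReg_five (p' := p₁ + 1) hp
    have hT := h₁.holds.tables.cnt x y
    have hA := h₁.holds.tables.adj x y
    have hℓ := h₁.holds.base.reg_one
    simp only [run_seq, run_assign, run_ite, Expr.eval, h₁.reg_five, h₈, h₉, Mem.setReg_reg,
      Mem.setReg_arr, Nat.reduceEqDiff, OfNat.one_ne_ofNat, if_false, if_true, hT, hA, hℓ,
      run_skip, h₁.holds.base.off]
    by_cases hc : H₁.Adj x y ∧ cnt (arcs H₁) x y < ℓ
    · rw [if_neg (by rw [if_pos (mem_arcs.2 hc.1)]; omega)]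
      refine (h₂.run_delEdge hL hD (by simp) (by simp) hc.1).mono ?_
      rintro s₂ t ⟨r, hW, hrec, ht⟩
      refine ⟨_, ⟨_, _, _, hst.tail (.edge hc.1 ?_), hW, ?_, ?_, rfl⟩, ?_⟩
      · rw [edgeTriangles_eq_cnt hc.1]
        exact hc.2
      · rw [List.drop_append_of_le_length hp]
        exact (hlow₁.recorded hrec subset_rfl).pop_edge fun hx => by simp at hx
      · rw [List.drop_append_of_le_length h₁.le_six]
        exact hcon₁.recorded hrec subset_rfl
      · simp only [Expr.cost]
        omega
    · rw [if_pos]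
      · refine ⟨_, ⟨_, _, _, hst, h₂, ?_, hcon₁, rfl⟩, ?_⟩
        · exact hlow₁.pop_edge fun hx ht => hc ⟨mem_arcs.1 hx, ht⟩
        · simp only [Expr.cost]
          omega
      · by_cases hx : H₁.Adj x y
        · rw [if_pos (mem_arcs.2 hx)]
          have : ¬ cnt (arcs H₁) x y < ℓ := fun ht => hc ⟨hx, ht⟩
          omega
        · rw [if_neg (mt mem_arcs.1 hx)]
          omega
  · rintro s₁ t ⟨φ, ⟨H₁, l₁, p₁, hst, h₁, hlow₁, hcon₁, rfl⟩, h₀, ht⟩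
    simp only [Expr.eval, h₁.reg_five, h₁.holds.log.1] at h₀
    obtain rfl : p₁ = l₁.length := by have := h₁.le_five; omega
    rw [List.drop_length] at hlow₁
    refine ⟨H₁, l₁, hst, h₁, hlow₁, hcon₁, ?_⟩
    simp only [Expr.cost] at ht
    omega

theorem cnt_self_eq_zero {x : Fin n} : cnt (arcs H) x x = 0 ↔ ∀ w, ¬ H.Adj x w := by
  simp only [cnt, mem_arcs, Finset.card_eq_zero, Finset.filter_eq_empty_iff, Finset.mem_univ,
    true_imp_iff, not_and]
  exact ⟨fun h w hw => h hw hw.symm, fun h w hw => absurd hw (h w)⟩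

theorem run_ltrIsolated (h : Work L ℓ v vs H l p q s)
    (hcon : CoversConflicts H.verts (arcs H) (l.drop q)) :
    Run ltrIsolated s fun s' t => ∃ H', Relation.ReflTransGen (LTRStep ℓ .edge) H H' ∧
      arcs H' = arcs H ∧ (∀ u ∈ H'.verts, ∃ w, H'.Adj u w) ∧
      Work L ℓ v vs H' l p q s' ∧ CoversConflicts H'.verts (arcs H') (l.drop q) ∧
      t + pot D H' l p q ≤ pot D H l p q + 30 * (vs.length + 1) := by
  simp only [ltrIsolated, run_seq, run_assign, Expr.eval]
  refine Run.mono (Run.frame (Run.forSeg (fun pre s' => ∃ H',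
      Relation.ReflTransGen (LTRStep ℓ .edge) H H' ∧
      arcs H' = arcs H ∧ H'.verts ⊆ H.verts ∧ (∀ u ∈ pre, u ∈ H'.verts → ∃ w, H'.Adj u w) ∧
      IsIndicator (s'.arr 4) H'.verts) (p := 0) (l := vs) 15 (by decide) rfl
      ⟨H, .refl, rfl, subset_rfl, by simp, h.holds.alive⟩ (by simp) (by simp [h.reg_three])
      h.seg ?_ ?_)) ?_
  · rintro r k pre s₁ - h₁
    exact h₁
  · rintro pre c post - s₁ ⟨H₁, hst, harcs, hsub, hiso, halive⟩ hz hf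
    have hA := halive c
    have hC : s₁.arr 6 (c * n + c) = cnt (arcs H₁) c c := by
      rw [hf.arr 6 rfl, harcs]
      exact h.holds.tables.cnt c c
    have h₃ : s₁.arr 3 c = c * n := by
      rw [hf.arr 3 rfl]
      exact h.holds.base.off c
    simp only [run_ite, run_store, run_skip, Expr.eval, hz, hC, h₃, Expr.cost]
    by_cases hc : c ∈ H₁.verts ∧ ∀ w, ¬ H₁.Adj c w
    · rw [if_neg (by rw [hA.1 hc.1, cnt_self_eq_zero.2 hc.2]; omega)]
      have harcs' : arcs (H₁.deleteVerts {c}) = arcs H₁ := by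
        rw [arcs_deleteVerts, Finset.filter_eq_self]
        rintro ⟨x, y⟩ hxy
        rw [mem_arcs] at hxy
        refine ⟨?_, ?_⟩
        · rintro rfl
          exact hc.2 _ hxy
        · rintro rfl
          exact hc.2 _ hxy.symm
      refine ⟨⟨H₁.deleteVerts {c}, hst.tail (.isolated hc.1 hc.2), harcs'.trans harcs,
        Set.sdiff_subset.trans hsub, ?_, ?_⟩, by norm_num⟩
      · rintro u hu ⟨hu₁, hu₂⟩
        obtain ⟨w, hw⟩ := hiso u
          ((List.mem_append.1 hu).resolve_right fun h => hu₂ (by simpa using h)) hu₁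
        refine ⟨w, mem_arcs.1 ?_⟩
        rw [harcs']
        exact mem_arcs.2 hw
      · intro x
        simp only [Mem.setArr_arr, if_true, Function.update_apply, ← Fin.ext_iff,
          SimpleGraph.Subgraph.deleteVerts_verts, Set.mem_sdiff, Set.mem_singleton_iff]
        have := halive x
        split_ifs with h
        · simp [h]
        · simpa [h] using this
    · rw [if_pos]
      · refine ⟨⟨H₁, hst, harcs, hsub, fun u hu hu₁ => ?_, halive⟩, by norm_num⟩
        rcases List.mem_append.1 hu with hu | hu
        · exact hiso u hu hu₁
        · rw [List.mem_singleton] at hu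
          subst hu
          by_contra hcon
          exact hc ⟨hu₁, not_exists.1 hcon⟩
      · by_cases hx : c ∈ H₁.verts
        · have : cnt (arcs H₁) c c ≠ 0 := fun h₀ => hc ⟨hx, cnt_self_eq_zero.1 h₀⟩
          rw [hA.1 hx]
          omega
        · rw [hA.2 hx]
          omega
  · rintro s₁ t ⟨⟨⟨H₁, hst, harcs, hsub, hiso, halive⟩, ht⟩, hf⟩
    have hpot : pot D H₁ l p q ≤ pot D H l p q := by
      have := Nat.mul_le_mul_left ((D + 1) ^ 2) (Set.ncard_le_ncard hsub)
      simp only [pot, harcs]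
      omega
    have hW := h.setReg (r := 19) 0 (by norm_num)
    refine ⟨H₁, hst, harcs, fun u hu => hiso u ?_ hu, ?_, ?_, ?_⟩
    · exact h.verts_subset u (hsub hu)
    · have := hW.frame (H' := H₁) (r := []) hf rfl ?_ hsub
      · simpa using this
      · refine ⟨hW.holds.base.frame hf rfl, halive, ?_, ?_⟩
        · rw [hf.arr 5 rfl, hf.arr 6 rfl, hf.arr 7 rfl, harcs]
          exact hW.holds.tables
        · rw [hf.reg 4 rfl, hf.arr 8 rfl, hf.arr 9 rfl, List.append_nil]
          exact hW.holds.log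
    · have := hcon.recorded (.refl _) hsub
      simpa [harcs] using this
    · simp only [Expr.cost]
      omega

theorem run_ltr (var : Variant) (hL : IsAdjLists G L) (hD : ∀ x ∈ vs, (L x).length ≤ D)
    (h : Work L ℓ v vs H l p q s) (hlow : CoversLow ℓ var H.verts (arcs H) (l.drop p))
    (hcon : CoversConflicts H.verts (arcs H) (l.drop q)) :
    Run (ltr var) s fun s' t => ∃ H' l', LTR ℓ var H H' ∧
      Work L ℓ v vs H' l' l'.length q s' ∧ CoversLow ℓ var H'.verts (arcs H') [] ∧
      CoversConflicts H'.verts (arcs H') (l'.drop q) ∧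
      t + pot D H' l' l'.length q ≤ pot D H l p q + 40 * (vs.length + 1) := by
  cases var with
  | vertex =>
    refine (run_ltrVertex hL hD h hlow hcon).mono ?_
    rintro s₁ t ⟨H₁, l₁, h₁, h₂, h₃, h₄, h₅⟩
    exact ⟨H₁, l₁, h₁, h₂, h₃, h₄, by omega⟩
  | edge =>
    simp only [ltr, run_seq]
    refine (run_ltrEdges hL hD h hlow hcon).mono ?_
    rintro s₁ t₁ ⟨H₁, l₁, hst₁, hW₁, hlow₁, hcon₁, ht₁⟩
    refine (run_ltrIsolated (D := D) hW₁ hcon₁).mono ?_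
    rintro s₂ t₂ ⟨H₂, hst₂, harcs, hiso, hW₂, hcon₂, ht₂⟩
    have hlow₂ : CoversLow ℓ .edge H₂.verts (arcs H₂) [] := by rw [harcs]; exact hlow₁
    exact ⟨H₂, l₁, .of_edge (hst₁.trans hst₂) hlow₂ hiso, hW₂, hlow₂, hcon₂, by omega⟩

end

/-! ### The main loop on the machine -/

/-- Whether the contents of two registers differ. -/
abbrev neExpr (x y : ℕ) : Expr := .add (.sub (.reg x) (.reg y)) (.sub (.reg y) (.reg x))

/-- Of the incompatible vertices in registers `23` and `24`, put the one to be deleted into register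
`15`. -/
def choose : Prog :=
  .ite (neExpr 23 2)
    (.ite (neExpr 24 2)
      (.ite (.sub (.get 7 (.reg 23)) (.get 7 (.reg 24)))
        (.assign 15 (.reg 24)) (.assign 15 (.reg 23)))
      (.assign 15 (.reg 23)))
    (.assign 15 (.reg 24))

/-- The test whether the vertices in registers `23` and `24` are present and incompatible. -/
abbrev conflictExpr : Expr :=
  .sub (.const 1)
    (.add (.add (.add
      (.add (.sub (.const 1) (.get 4 (.reg 23))) (.sub (.const 1) (.get 4 (.reg 24))))
      (.get 5 (cellIdx 23 24))) (.get 6 (cellIdx 23 24))) (.sub (.const 1) (neExpr 23 24)))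

/-- The main loop of the heuristic for the vertex in register `2`. -/
def greedy (var : Variant) : Prog :=
  .loop (.sub (.reg 4) (.reg 6))
    (.assign 23 (.get 8 (.reg 6)) ;; .assign 24 (.get 9 (.reg 6)) ;;
      .assign 6 (.add (.reg 6) (.const 1)) ;;
      .ite conflictExpr (choose ;; delVertex ;; ltr var) .skip)

theorem CoversConflicts.pop {n : ℕ} {U : Set (Fin n)} {E : Finset (Fin n × Fin n)} {x y : Fin n}
    {q : List (Fin n × Fin n)} (h : CoversConflicts U E ((x, y) :: q))
    (hxy : ¬ (x ∈ U ∧ y ∈ U ∧ x ≠ y ∧ (x, y) ∉ E ∧ cnt E x y = 0)) : CoversConflicts U E q := by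
  intro a ha b hb hab hE hc
  refine (List.mem_cons.mp (h a ha b hb hab hE hc)).resolve_left ?_
  rintro ⟨⟩
  exact hxy ⟨ha, hb, hab, hE, hc⟩

theorem sub_add_sub_eq_zero {n : ℕ} {x y : Fin n} :
    (x : ℕ) - y + ((y : ℕ) - x) = 0 ↔ x = y := by
  rw [Fin.ext_iff]
  omega

section

variable {n ℓ D : ℕ} {G : SimpleGraph (Fin n)} {L : Fin n → List (Fin n)} {v : Fin n}
  {vs : List (Fin n)} {H H' : G.Subgraph} {l l' : List (Fin n × Fin n)} {p q : ℕ} {s : Mem}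

theorem run_choose {x y : Fin n} {E : Finset (Fin n × Fin n)} (hx : s.reg 23 = x)
    (hy : s.reg 24 = y) (hv : s.reg 2 = v) (hT : ∀ u : Fin n, s.arr 7 u = tri E u) (hxy : x ≠ y) :
    Run choose s fun s' t => ∃ d e : Fin n, s' = s.setReg 15 d ∧ (d = x ∧ e = y ∨ d = y ∧ e = x) ∧
      d ≠ v ∧ (e = v ∨ tri E d ≤ tri E e) ∧ t ≤ 40 := by
  simp only [choose, run_ite, run_assign, Expr.eval, hx, hy, hv, hT, sub_add_sub_eq_zero, Expr.cost]
  split_ifs with h₁ h₂ h₃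
  · exact ⟨y, x, rfl, .inr ⟨rfl, rfl⟩, h₁ ▸ hxy.symm, .inl h₁, by norm_num⟩
  · exact ⟨x, y, rfl, .inl ⟨rfl, rfl⟩, h₁, .inl h₂, by norm_num⟩
  · exact ⟨x, y, rfl, .inl ⟨rfl, rfl⟩, h₁, .inr (by omega), by norm_num⟩
  · exact ⟨y, x, rfl, .inr ⟨rfl, rfl⟩, h₂, .inr (by omega), by norm_num⟩

/-- The bound on the length of `vs` lets the deletion of a vertex also pay for the search for
isolated vertices by the Low-Triangle Rule that follows it. -/
theorem run_greedy (var : Variant) (hL : IsAdjLists G L) (hD : ∀ x ∈ vs, (L x).length ≤ D)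
    (hvs : vs.length ≤ (D + 1) ^ 2) (h : Work L ℓ v vs H l l.length q s)
    (hlow : CoversLow ℓ var H.verts (arcs H) [])
    (hcon : CoversConflicts H.verts (arcs H) (l.drop q)) :
    Run (greedy var) s fun s' t => ∃ H' l', Relation.ReflTransGen (Round ℓ var v) H H' ∧
      conflictGraph H'.coe = ⊥ ∧ Work L ℓ v vs H' l' l'.length l'.length s' ∧
      t ≤ pot D H l l.length q + 10 := by
  refine Run.mono (Run.loop (fun s' φ => ∃ H' l' q', Relation.ReflTransGen (Round ℓ var v) H H' ∧
    Work L ℓ v vs H' l' l'.length q' s' ∧ CoversLow ℓ var H'.verts (arcs H') [] ∧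
    CoversConflicts H'.verts (arcs H') (l'.drop q') ∧ φ = pot D H' l' l'.length q')
    ⟨H, l, q, .refl, h, hlow, hcon, rfl⟩ ?_) ?_
  · rintro s₁ φ ⟨H₁, l₁, q₁, hst, h₁, hlow₁, hcon₁, rfl⟩ hf h₀
    simp only [Expr.eval, h₁.reg_six, h₁.holds.log.1] at h₀
    have hq : q₁ < l₁.length := by omega
    have hpot : 150 + pot D H₁ l₁ l₁.length (q₁ + 1) = pot D H₁ l₁ l₁.length q₁ := by
      simp only [pot]
      omega
    rw [drop_eq_cons hq] at hcon₁
    have h₈ : s₁.arr 8 q₁ = (l₁[q₁].1 : ℕ) := (h₁.holds.log.get hq).1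
    have h₉ : s₁.arr 9 q₁ = (l₁[q₁].2 : ℕ) := (h₁.holds.log.get hq).2
    generalize l₁[q₁].1 = x at h₈ hcon₁
    generalize l₁[q₁].2 = y at h₉ hcon₁
    have h₂ := ((h₁.setReg (r := 23) x (by norm_num)).setReg (r := 24) y
      (by norm_num)).setReg_six (q' := q₁ + 1) hq
    simp only [run_seq, run_assign, run_ite, Expr.eval, h₁.reg_six, h₈, h₉, Mem.setReg_reg,
      Mem.setReg_arr, Nat.reduceEqDiff, if_false, if_true, run_skip,
      h₁.holds.base.off, h₁.holds.tables.adj, h₁.holds.tables.cnt]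
    by_cases hc : x ∈ H₁.verts ∧ y ∈ H₁.verts ∧ x ≠ y ∧ (x, y) ∉ arcs H₁ ∧ cnt (arcs H₁) x y = 0
    · obtain ⟨hxH, hyH, hxy, hadj, hcnt⟩ := hc
      have hne := mt sub_add_sub_eq_zero.1 hxy
      rw [if_neg (by
        rw [(h₁.holds.alive x).1 hxH, (h₁.holds.alive y).1 hyH, if_neg hadj, hcnt]; omega)]
      refine (run_choose (x := x) (y := y) (v := v) (E := arcs H₁) (by simp) (by simp)
        h₂.reg_two h₂.holds.tables.tri hxy).mono ?_
      rintro _ t₁ ⟨d, e, rfl, hde, hdv, hev, ht₁⟩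
      have hdH : d ∈ H₁.verts := by rcases hde with ⟨rfl, -⟩ | ⟨rfl, -⟩ <;> assumption
      have heH : e ∈ H₁.verts := by rcases hde with ⟨-, rfl⟩ | ⟨-, rfl⟩ <;> assumption
      have hsymm : cnt (arcs H₁) y x = cnt (arcs H₁) x y := by
        unfold cnt
        congr 1
        ext r
        simp only [Finset.mem_filter, Finset.mem_univ, true_and, mem_arcs]
        exact ⟨fun h => ⟨h.2.symm, h.1.symm⟩, fun h => ⟨h.2.symm, h.1.symm⟩⟩
      have hstep : GreedyStep v H₁ (H₁.deleteVerts {d}) := by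
        refine ⟨⟨d, hdH⟩, ⟨e, heH⟩, ?_, hdv, hev.imp_right fun h => ?_, rfl⟩
        · rw [conflictGraph_adj_iff]
          rw [mem_arcs] at hadj
          rcases hde with ⟨rfl, rfl⟩ | ⟨rfl, rfl⟩
          · exact ⟨hxy, hadj, hcnt⟩
          · exact ⟨hxy.symm, fun h => hadj h.symm, hsymm.trans hcnt⟩
        · rw [← two_mul_vertexTriangles, ← two_mul_vertexTriangles] at h
          exact Nat.le_of_mul_le_mul_left h two_pos
      refine ((h₂.setReg (r := 15) d (by norm_num)).run_delVertex hL hD (by simp) hdH).mono ?_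
      rintro s₂ t₂ ⟨r, hW, hrec, ht₂⟩
      have hsub : (H₁.deleteVerts {d}).verts ⊆ H₁.verts := Set.sdiff_subset
      refine (run_ltr var hL hD hW ?_ ?_).mono ?_
      · rw [List.drop_left]
        exact hlow₁.recorded hrec hsub
      · rw [List.drop_append_of_le_length hq]
        refine (hcon₁.recorded hrec hsub).pop ?_
        rintro ⟨h₁, h₂, -⟩
        rcases hde with ⟨rfl, -⟩ | ⟨rfl, -⟩
        · exact h₁.2 rfl
        · exact h₂.2 rfl
      · rintro s₃ t₃ ⟨H₃, l₃, hLTR, hW₃, hlow₃, hcon₃, ht₃⟩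
        refine ⟨_, ⟨H₃, l₃, _, hst.tail ⟨_, hstep, hLTR⟩, hW₃, hlow₃, hcon₃, rfl⟩, ?_⟩
        simp only [Expr.cost]
        have : 1 ≤ (D + 1) ^ 2 := Nat.one_le_pow _ _ (Nat.succ_pos D)
        omega
    · rw [if_pos]
      · refine ⟨_, ⟨_, _, _, hst, h₂, hlow₁, hcon₁.pop hc, rfl⟩, ?_⟩
        simp only [Expr.cost]
        omega
      · by_cases hx : x ∈ H₁.verts
        · by_cases hy : y ∈ H₁.verts
          · by_cases hxy : x = y
            · have := sub_add_sub_eq_zero.2 hxy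
              omega
            · by_cases hadj : (x, y) ∈ arcs H₁
              · rw [if_pos hadj]
                omega
              · have : cnt (arcs H₁) x y ≠ 0 := fun h => hc ⟨hx, hy, hxy, hadj, h⟩
                omega
          · rw [(h₁.holds.alive y).2 hy]
            omega
        · rw [(h₁.holds.alive x).2 hx]
          omega
  · rintro s₁ t ⟨φ, ⟨H₁, l₁, q₁, hst, h₁, hlow₁, hcon₁, rfl⟩, h₀, ht⟩
    simp only [Expr.eval, h₁.reg_six, h₁.holds.log.1] at h₀
    obtain rfl : q₁ = l₁.length := by have := h₁.le_six; omega
    rw [List.drop_length] at hcon₁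
    refine ⟨H₁, l₁, hst, ?_, h₁, ?_⟩
    · ext x y
      rw [conflictGraph_adj_iff]
      simp only [SimpleGraph.bot_adj, iff_false]
      rintro ⟨hxy, hadj, hc⟩
      have := hcon₁ x x.2 y y.2 hxy (mt mem_arcs.1 hadj) hc
      simp at this
    · simp only [Expr.cost] at ht
      omega

end

/-! ### Building the start graph -/

/-- Append the vertex in register `z` to the vertex list, unless it is already there. -/
def addVertex (z : ℕ) : Prog :=
  .ite (.get 4 (.reg z)) .skip
    (.store 4 (.reg z) (.const 1) ;; .store 10 (.reg 3) (.reg z) ;;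
      .assign 3 (.add (.reg 3) (.const 1)))

/-- List the vertices of `N₂[v]` for the vertex `v` in register `2`. -/
def listNbhd : Prog :=
  .assign 3 (.const 0) ;; addVertex 2 ;;
  forAdj 25 26 27 2 (addVertex 27 ;; forAdj 28 29 30 27 (addVertex 30))

/-- Insert all arcs between listed vertices. -/
def buildArcs : Prog :=
  .assign 25 (.const 0) ;;
  forSeg 25 3 10 10 (forAdj 26 27 11 10 (.ite (.get 4 (.reg 11)) (updArc true) .skip))

/-- Append all pairs of listed vertices to the log. -/
def logPairs : Prog :=
  .assign 25 (.const 0) ;;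
  forSeg 25 3 27 10 (.assign 26 (.const 0) ;; forSeg 26 3 28 10 (pushPair 27 28))

/-- Build the data structure for the subgraph induced by `N₂[v]`. -/
def setup : Prog :=
  .assign 4 (.const 0) ;; .assign 5 (.const 0) ;; .assign 6 (.const 0) ;;
  listNbhd ;; buildArcs ;; logPairs

/-- The vertex list is `vs`, and precisely the listed vertices are marked as present. -/
structure Listed {n : ℕ} (vs : List (Fin n)) (s : Mem) : Prop where
  reg_three : s.reg 3 = vs.length
  seg : Seg (s.arr 10) 0 vs
  nodup : vs.Nodup
  alive : IsIndicator (s.arr 4) {x | x ∈ vs}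

section

variable {n ℓ D : ℕ} {G : SimpleGraph (Fin n)} {L : Fin n → List (Fin n)} {v : Fin n}
  {vs : List (Fin n)} {l : List (Fin n × Fin n)} {s : Mem}

theorem Listed.setReg (h : Listed vs s) {r : ℕ} (k : ℕ) (hr : r ≠ 3) :
    Listed vs (s.setReg r k) :=
  ⟨by simp [hr.symm, h.reg_three], h.seg, h.nodup, h.alive⟩

theorem run_addVertex {z : ℕ} {c : Fin n} (h : Listed vs s) (hz : s.reg z = c) :
    Run (addVertex z) s fun s' t => ∃ vs', Listed vs' s' ∧ (∀ x, x ∈ vs' ↔ x ∈ vs ∨ x = c) ∧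
      vs'.length ≤ vs.length + 1 ∧ t ≤ 15 := by
  simp only [addVertex, run_ite, run_seq, run_store, run_assign, run_skip, Expr.eval, hz, Expr.cost,
    Mem.setArr_reg]
  by_cases hc : c ∈ vs
  · rw [if_neg (by rw [(h.alive c).1 hc]; norm_num)]
    refine ⟨vs, h, fun x => ?_, by omega, by norm_num⟩
    constructor
    · exact .inl
    · rintro (hx | rfl) <;> assumption
  · rw [if_pos ((h.alive c).2 hc)]
    refine ⟨vs ++ [c], ⟨?_, ?_, ?_, ?_⟩, by simp, by simp, by norm_num⟩
    · simp [h.reg_three]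
    · simpa [h.reg_three] using h.seg.append_singleton c
    · exact List.nodup_append.2 ⟨h.nodup, List.nodup_singleton c, fun a ha b hb hab => by
        rw [List.mem_singleton] at hb
        exact hc (hb ▸ hab ▸ ha)⟩
    · intro x
      have := h.alive x
      simp only [Mem.setReg_arr, Mem.setArr_arr, Nat.reduceEqDiff, if_false, if_true,
        Function.update_apply, ← Fin.ext_iff, Set.mem_ofPred_eq, List.mem_append,
        List.mem_singleton] at this ⊢
      split_ifs with hx
      · simp [hx]
      · simpa [hx] using this

theorem run_listNbhd (hL : IsAdjLists G L) (hB : Base L ℓ s) (hv : s.reg 2 = v)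
    (hA : IsIndicator (n := n) (s.arr 4) ∅) (hD : ∀ x ∈ L v, (L x).length ≤ D) :
    Run listNbhd s fun s' t => ∃ vs, Listed vs s' ∧ (∀ x, x ∈ vs ↔ x ∈ closedNbhd₂ G v) ∧
      vs.length ≤ 1 + (L v).length * (D + 1) ∧ t ≤ 100 * (1 + (L v).length * (D + 1)) := by
  simp only [listNbhd, run_seq, run_assign, Expr.eval]
  have h₀ : Listed ([] : List (Fin n)) (s.setReg 3 0) :=
    ⟨by simp, by intro j hj; simp at hj, List.nodup_nil, by simpa [IsIndicator] using hA⟩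
  refine Run.mono (Run.frame (run_addVertex (c := v) h₀ (by simp [hv]))) ?_
  rintro s₁ t₁ ⟨⟨vs₁, h₁, hm₁, hlen₁, ht₁⟩, hf₁⟩
  have hi₁ : IsInput L (s₁.arr 0) (s₁.arr 1) := by
    rw [hf₁.arr 0 rfl, hf₁.arr 1 rfl]
    exact hB.inp
  have hv₁ : s₁.reg 2 = v := by rw [hf₁.reg 2 rfl]; simp [hv]
  refine Run.mono (run_forAdj (X := v) (fun pre s' => ∃ vs, Listed vs s' ∧
    (∀ x, x ∈ vs ↔ x = v ∨ x ∈ pre ∨ ∃ u ∈ pre, x ∈ L u) ∧ vs.length ≤ 1 + pre.length * (D + 1))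
    (15 + (D * 26 + 12)) hi₁ hv₁ (by decide) rfl ?_ ?_ ?_) ?_
  · refine ⟨vs₁, h₁, fun x => ?_, by simpa using hlen₁⟩
    simp [hm₁]
  · rintro r k pre s' hr ⟨vs, h, h'⟩
    exact ⟨vs, h.setReg k (by omega), h'⟩
  · rintro pre c post hpre s₂ ⟨vs₂, h₂, hm₂, hlen₂⟩ hz hf₂
    simp only [run_seq]
    refine Run.mono (Run.frame (run_addVertex h₂ hz)) ?_
    rintro s₃ t₃ ⟨⟨vs₃, h₃, hm₃, hlen₃, ht₃⟩, hf₃⟩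
    have hi₃ : IsInput L (s₃.arr 0) (s₃.arr 1) := by
      rw [hf₃.arr 0 rfl, hf₃.arr 1 rfl, hf₂.arr 0 rfl, hf₂.arr 1 rfl]
      exact hi₁
    have hc₃ : s₃.reg 27 = c := by rw [hf₃.reg 27 rfl, hz]
    refine Run.mono (run_forAdj (X := c) (fun pre' s' => ∃ vs, Listed vs s' ∧
      (∀ x, x ∈ vs ↔ x ∈ vs₃ ∨ x ∈ pre') ∧ vs.length ≤ vs₃.length + pre'.length)
      15 hi₃ hc₃ (by decide) rfl ⟨vs₃, h₃, by simp, by simp⟩ ?_ ?_) ?_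
    · rintro r k pre s' hr ⟨vs, h, h'⟩
      exact ⟨vs, h.setReg k (by omega), h'⟩
    · rintro pre' w post' - s₄ ⟨vs₄, h₄, hm₄, hlen₄⟩ hw hf₄
      refine Run.mono (run_addVertex h₄ hw) ?_
      rintro s₅ t₅ ⟨vs₅, h₅, hm₅, hlen₅, ht₅⟩
      refine ⟨⟨vs₅, h₅, fun x => ?_, ?_⟩, ht₅⟩
      · rw [hm₅, hm₄, List.mem_append, List.mem_singleton, or_assoc]
      · rw [List.length_append, List.length_singleton]
        omega
    · rintro s₄ t₄ ⟨⟨vs₄, h₄, hm₄, hlen₄⟩, ht₄⟩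
      have hDc : (L c).length ≤ D := hD c (by simp [hpre])
      refine ⟨⟨vs₄, h₄, fun x => ?_, ?_⟩, ?_⟩
      · rw [hm₄, hm₃, hm₂]
        simp only [List.mem_append, List.mem_singleton]
        constructor
        · rintro (((h | h | ⟨u, hu, hx⟩) | h) | h)
          · exact .inl h
          · exact .inr (.inl (.inl h))
          · exact .inr (.inr ⟨u, .inl hu, hx⟩)
          · exact .inr (.inl (.inr h))
          · exact .inr (.inr ⟨c, .inr rfl, h⟩)
        · rintro (h | (h | h) | ⟨u, hu | rfl, hx⟩)
          · exact .inl (.inl (.inl h))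
          · exact .inl (.inl (.inr (.inl h)))
          · exact .inl (.inr h)
          · exact .inl (.inl (.inr (.inr ⟨u, hu, hx⟩)))
          · exact .inr hx
      · rw [List.length_append, List.length_singleton, add_mul, one_mul]
        omega
      · have := Nat.mul_le_mul_right (15 + 11) hDc
        omega
  · rintro s₂ t₂ ⟨⟨vs₂, h₂, hm₂, hlen₂⟩, ht₂⟩
    refine ⟨vs₂, h₂, fun x => ?_, hlen₂, ?_⟩
    · rw [hm₂]
      simp only [closedNbhd₂, Set.mem_union, Set.mem_singleton_iff, SimpleGraph.mem_neighborSet,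
        Set.mem_ofPred_eq, (hL _).2, or_assoc]
      refine or_congr_right (or_congr_right ⟨?_, ?_⟩)
      · rintro ⟨u, hu, hx⟩
        exact ⟨u, hu, hx.symm⟩
      · rintro ⟨u, hu, hx⟩
        exact ⟨u, hu, SimpleGraph.Adj.symm hx⟩
    · simp only [Expr.cost]
      have : (L v).length * (15 + (D * 26 + 12) + 11) ≤ 60 * ((L v).length * (D + 1)) := by
        nlinarith [Nat.zero_le ((L v).length), Nat.zero_le ((L v).length * D)]
      omega

open Classical in
theorem run_buildArcs (hL : IsAdjLists G L) (hvs : Listed vs s)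
    (hS : Holds L ℓ s {x | x ∈ vs} ∅ []) (hD : ∀ x ∈ vs, (L x).length ≤ D) :
    Run buildArcs s fun s' t => ∃ l,
      Holds L ℓ s' {x | x ∈ vs} {p | G.Adj p.1 p.2 ∧ p.1 ∈ vs ∧ p.2 ∈ vs} l ∧
      l.length ≤ vs.length * (2 * (D + 1) ^ 2) ∧ t ≤ 300 * (1 + vs.length * (D + 1) ^ 2) := by
  let F : List (Fin n) → Fin n → List (Fin n) → Finset (Fin n × Fin n) := fun pre c pre' =>
    {p | G.Adj p.1 p.2 ∧ p.2 ∈ vs ∧ (p.1 ∈ pre ∨ p.1 = c ∧ p.2 ∈ pre')}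
  have hF : ∀ {pre c pre' x y}, (x, y) ∈ F pre c pre' ↔
      G.Adj x y ∧ y ∈ vs ∧ (x ∈ pre ∨ x = c ∧ y ∈ pre') := by simp [F]
  simp only [buildArcs, run_seq, run_assign, Expr.eval]
  refine Run.mono (Run.forSeg (l := vs) (p := 0) (fun pre s' => ∃ l,
    Holds L ℓ s' {x | x ∈ vs} {p | G.Adj p.1 p.2 ∧ p.2 ∈ vs ∧ p.1 ∈ pre} l ∧
    l.length ≤ pre.length * (2 * (D + 1) ^ 2)) (D * (210 * (D + 1) + 11) + 12) (by decide) rfl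
    ⟨[], ?_, by simp⟩ (by simp) (by simp [hvs.reg_three]) hvs.seg ?_ ?_) ?_
  · simpa using hS.setReg (r := 25) 0 (by decide)
  · rintro r k pre s' hr ⟨l, h₁, h₂⟩
    exact ⟨l, h₁.setReg k (by omega), h₂⟩
  · rintro pre c post hpre s₁ ⟨l₁, h₁, hlen₁⟩ hz hf₁
    have hcn : c ∉ pre := by
      have := hvs.nodup
      rw [hpre] at this
      exact fun hc => (List.nodup_append.mp this).2.2 c hc c (by simp) rfl
    have hcv : c ∈ vs := by simp [hpre]
    have hDc := hD c hcv
    refine Run.mono (run_forAdj (X := c) (fun pre' s' => ∃ l,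
      Holds L ℓ s' {x | x ∈ vs} (F pre c pre') l ∧
      l.length ≤ l₁.length + pre'.length * (2 * D + 2)) (210 * (D + 1)) h₁.base.inp hz (by decide)
      rfl ⟨l₁, ?_, by simp⟩ ?_ ?_) ?_
    · have : F pre c [] =
          ({p | G.Adj p.1 p.2 ∧ p.2 ∈ vs ∧ p.1 ∈ pre} : Finset (Fin n × Fin n)) := by
        ext ⟨x, y⟩
        simp [F]
      rw [this]
      exact h₁
    · rintro r k pre s' hr ⟨l, h₁, h₂⟩
      exact ⟨l, h₁.setReg k (by omega), h₂⟩
    · rintro pre' w post' hpre' s₂ ⟨l₂, h₂, hlen₂⟩ hw hf₂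
      have hwn : w ∉ pre' := by
        have := (hL c).1
        rw [hpre'] at this
        exact fun hc => (List.nodup_append.mp this).2.2 w hc w (by simp) rfl
      have hcw : G.Adj c w := ((hL c).2 w).1 (by simp [hpre'])
      have hc₂ : s₂.reg 10 = c := by rw [hf₂.reg 10 rfl, hz]
      simp only [run_ite, run_skip, Expr.eval, hw, Expr.cost]
      by_cases hwv : w ∈ vs
      · rw [if_neg (by rw [(h₂.alive w).1 hwv]; norm_num)]
        have hnot : (c, w) ∉ F pre c pre' := fun h => by
          rcases (hF.1 h).2.2 with h | h
          · exact hcn h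
          · exact hwn h.2
        refine Run.mono (Run.frame (run_updArc (E₀ := F pre c pre') true h₂.base (fun x => (hL x).1)
          hcw.ne hnot (by simpa using h₂.tables) h₂.log hc₂ hw
          (fun d hd => ((hL _).2 _).2 (hF.1 hd).1) (fun d hd => ((hL _).2 _).2 (hF.1 hd).1.symm)
          hDc (hD w hwv))) ?_
        rintro s₃ t₃ ⟨⟨hT, ⟨l₃, hl₃, hlen₃, -⟩, ht₃⟩, hf₃⟩
        have hins : insert (c, w) (F pre c pre') = F pre c (pre' ++ [w]) := by
          ext ⟨x, y⟩
          simp only [Finset.mem_insert, hF, Prod.mk.injEq, List.mem_append, List.mem_singleton]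
          constructor
          · rintro (⟨rfl, rfl⟩ | h)
            · exact ⟨hcw, hwv, .inr ⟨rfl, .inr rfl⟩⟩
            · tauto
          · tauto
        rw [if_pos rfl, hins] at hT
        refine ⟨⟨_, ⟨h₂.base.frame hf₃ rfl, ?_, hT, hl₃⟩, ?_⟩, by omega⟩
        · rw [hf₃.arr 4 rfl]
          exact h₂.alive
        · rw [List.length_append, List.length_append, List.length_singleton, add_mul]
          omega
      · rw [if_pos ((h₂.alive w).2 hwv)]
        have hins : F pre c pre' = F pre c (pre' ++ [w]) := by
          ext ⟨x, y⟩
          simp only [hF, List.mem_append, List.mem_singleton]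
          constructor
          · tauto
          · rintro ⟨hxy, hy, hx | ⟨rfl, hx | rfl⟩⟩
            · exact ⟨hxy, hy, .inl hx⟩
            · exact ⟨hxy, hy, .inr ⟨rfl, hx⟩⟩
            · exact absurd hy hwv
        rw [← hins]
        refine ⟨⟨l₂, h₂, ?_⟩, by omega⟩
        rw [List.length_append, List.length_singleton, add_mul]
        omega
    · rintro s₂ t₂ ⟨⟨l₂, h₂, hlen₂⟩, ht₂⟩
      have hFL : F pre c (L c) =
          ({p | G.Adj p.1 p.2 ∧ p.2 ∈ vs ∧ p.1 ∈ pre ++ [c]} : Finset (Fin n × Fin n)) := by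
        ext ⟨x, y⟩
        simp only [hF, Finset.mem_filter, Finset.mem_univ, true_and, List.mem_append,
          List.mem_singleton]
        refine and_congr_right fun hxy => and_congr_right fun _ => or_congr_right ?_
        refine and_iff_left_of_imp ?_
        rintro rfl
        exact ((hL _).2 _).2 hxy
      rw [hFL] at h₂
      refine ⟨⟨l₂, h₂, ?_⟩, ?_⟩
      · have := Nat.mul_le_mul_right (2 * D + 2) hDc
        rw [List.length_append, List.length_singleton, add_mul]
        nlinarith
      · have := Nat.mul_le_mul_right (210 * (D + 1) + 11) hDc
        omega
  · rintro s₁ t₁ ⟨⟨l₁, h₁, hlen₁⟩, ht₁⟩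
    have hE : ({p | G.Adj p.1 p.2 ∧ p.2 ∈ vs ∧ p.1 ∈ vs} : Finset (Fin n × Fin n)) =
        ({p | G.Adj p.1 p.2 ∧ p.1 ∈ vs ∧ p.2 ∈ vs} : Finset (Fin n × Fin n)) := by
      ext p
      simp only [Finset.mem_filter, Finset.mem_univ, true_and]
      tauto
    rw [hE] at h₁
    refine ⟨l₁, h₁, hlen₁, ?_⟩
    have : vs.length * (D * (210 * (D + 1) + 11) + 12 + 11) ≤ 300 * (vs.length * (D + 1) ^ 2) := by
      have : D * (210 * (D + 1) + 11) + 12 + 11 ≤ 300 * (D + 1) ^ 2 := by nlinarith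
      calc _ ≤ vs.length * (300 * (D + 1) ^ 2) := Nat.mul_le_mul_left _ this
        _ = _ := by ring
    simp only [Expr.cost]
    omega

theorem run_logPairs (hvs : Listed vs s) (hl : IsLog (s.reg 4) (s.arr 8) (s.arr 9) l) :
    Run logPairs s fun s' t => ∃ r, IsLog (s'.reg 4) (s'.arr 8) (s'.arr 9) (l ++ r) ∧
      r.length = vs.length * vs.length ∧ (∀ x ∈ vs, ∀ y ∈ vs, (x, y) ∈ r) ∧
      t ≤ 60 * (1 + vs.length * (vs.length + 1)) := by
  simp only [logPairs, run_seq, run_assign, Expr.eval]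
  refine Run.mono (Run.forSeg (l := vs) (p := 0) (fun pre s' => ∃ r,
    IsLog (s'.reg 4) (s'.arr 8) (s'.arr 9) (l ++ r) ∧ r.length = pre.length * vs.length ∧
    ∀ x ∈ pre, ∀ y ∈ vs, (x, y) ∈ r) (vs.length * 25 + 8) (by decide) rfl
    ⟨[], by simpa using hl, by simp, by simp⟩ (by simp) (by simp [hvs.reg_three]) hvs.seg ?_ ?_) ?_
  · rintro r k pre s' (rfl | rfl) h <;> simpa using h
  · rintro pre c post - s₁ ⟨r₁, h₁, hlen₁, hm₁⟩ hz hf₁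
    have h3 : s₁.reg 3 = vs.length := by rw [hf₁.reg 3 rfl]; simp [hvs.reg_three]
    simp only [run_seq, run_assign, Expr.eval]
    refine Run.mono (Run.forSeg (l := vs) (p := 0) (fun pre' s' => ∃ r,
      IsLog (s'.reg 4) (s'.arr 8) (s'.arr 9) (l ++ r) ∧
      r.length = pre.length * vs.length + pre'.length ∧
      (∀ x ∈ pre, ∀ y ∈ vs, (x, y) ∈ r) ∧ ∀ y ∈ pre', (c, y) ∈ r) 14 (by decide) rfl
      ⟨r₁, by simpa using h₁, by simpa using hlen₁, hm₁, by simp⟩ (by simp) (by simp [h3])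
      (by rw [Mem.setReg_arr, hf₁.arr 10 rfl]; exact hvs.seg) ?_ ?_) ?_
    · rintro r k pre s' (rfl | rfl) h <;> simpa using h
    · rintro pre' w post' - s₂ ⟨r₂, h₂, hlen₂, hm₂, hm₂'⟩ hw hf₂
      have hc₂ : s₂.reg 27 = c := by rw [hf₂.reg 27 rfl]; simp [hz]
      have hpush := h₂.push c w
      rw [List.append_assoc] at hpush
      simp only [pushPair, run_seq, run_store, run_assign, Expr.eval, hc₂, hw, Mem.setArr_reg,
        Mem.setArr_arr, Mem.setReg_reg, Mem.setReg_arr, Nat.reduceEqDiff, if_true, if_false,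
        Expr.cost]
      refine ⟨⟨_, hpush, ?_, fun x hx y hy => ?_, fun y hy => ?_⟩, by norm_num⟩
      · simp [hlen₂, add_assoc]
      · exact List.mem_append_left _ (hm₂ x hx y hy)
      · rcases List.mem_append.1 hy with hy | hy
        · exact List.mem_append_left _ (hm₂' y hy)
        · rw [List.mem_singleton] at hy
          simp [hy]
    · rintro s₂ t₂ ⟨⟨r₂, h₂, hlen₂, hm₂, hm₂'⟩, ht₂⟩
      refine ⟨⟨r₂, h₂, ?_, fun x hx y hy => ?_⟩, ?_⟩
      · rw [hlen₂, List.length_append, List.length_singleton, add_mul, one_mul]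
      · rcases List.mem_append.1 hx with hx | hx
        · exact hm₂ x hx y hy
        · rw [List.mem_singleton] at hx
          exact hx ▸ hm₂' y hy
      · simp only [Expr.cost]
        omega
  · rintro s₁ t₁ ⟨⟨r₁, h₁, hlen₁, hm₁⟩, ht₁⟩
    refine ⟨r₁, h₁, hlen₁, hm₁, ?_⟩
    simp only [Expr.cost]
    nlinarith

theorem card_arcs_le {H : G.Subgraph} (hL : IsAdjLists G L) (hvs : ∀ x ∈ H.verts, x ∈ vs)
    (hD : ∀ x ∈ vs, (L x).length ≤ D) : (arcs H).card ≤ vs.length * D := by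
  have hsub : arcs H ⊆ (vs.flatMap fun x => (L x).map fun y => (x, y)).toFinset := by
    rintro ⟨x, y⟩ hxy
    rw [mem_arcs] at hxy
    simp only [List.mem_toFinset, List.mem_flatMap, List.mem_map, Prod.mk.injEq]
    exact ⟨x, hvs x hxy.fst_mem, y, ((hL x).2 y).2 hxy.adj_sub, rfl, rfl⟩
  refine (Finset.card_le_card hsub).trans ((List.toFinset_card_le _).trans ?_)
  rw [List.length_flatMap]
  refine (List.sum_le_card_nsmul _ D ?_).trans ?_
  · intro m hm
    obtain ⟨x, hx, rfl⟩ := List.mem_map.1 hm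
    simpa using hD x hx
  · simp

theorem run_setup (var : Variant) (hL : IsAdjLists G L) (hB : Base L ℓ s) (hv : s.reg 2 = v)
    (hA : IsIndicator (n := n) (s.arr 4) ∅)
    (hT : Tables (n := n) (s.arr 5) (s.arr 6) (s.arr 7) ∅)
    (hD : ∀ x ∈ closedNbhd₂ G v, (L x).length ≤ D) :
    Run setup s fun s' t => ∃ vs l,
      Work L ℓ v vs ((⊤ : G.Subgraph).induce (closedNbhd₂ G v)) l 0 0 s' ∧
      CoversLow ℓ var (closedNbhd₂ G v) (arcs ((⊤ : G.Subgraph).induce (closedNbhd₂ G v))) l ∧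
      CoversConflicts (closedNbhd₂ G v) (arcs ((⊤ : G.Subgraph).induce (closedNbhd₂ G v))) l ∧
      vs.Nodup ∧ (∀ x, x ∈ vs ↔ x ∈ closedNbhd₂ G v) ∧
      vs.length ≤ 1 + (L v).length * (D + 1) ∧ vs.length ≤ (D + 1) ^ 2 ∧
      t + pot D ((⊤ : G.Subgraph).induce (closedNbhd₂ G v)) l 0 0 ≤
        10000 * ((1 + (L v).length * (D + 1)) * (D + 1) ^ 2) := by
  classical
  have hadj : ∀ x ∈ L v, (L x).length ≤ D := fun x hx => hD x (by
    simp only [closedNbhd₂, Set.mem_union, SimpleGraph.mem_neighborSet]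
    exact .inl (.inr (((hL v).2 x).1 hx)))
  have hDv : (L v).length ≤ D := hD v (by simp [closedNbhd₂])
  simp only [setup, run_seq, run_assign, Expr.eval]
  set s₀ := ((s.setReg 4 0).setReg 5 0).setReg 6 0 with hs₀
  have hB₀ : Base L ℓ s₀ := hB.of_eq (by simp [hs₀]) (by simp [hs₀]) rfl rfl rfl
  refine Run.mono (Run.frame (run_listNbhd (v := v) (D := D) hL hB₀ (by simp [hs₀, hv]) hA hadj)) ?_
  rintro s₁ t₁ ⟨⟨vs, h₁, hm, hlen, ht₁⟩, hf₁⟩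
  have hDvs : ∀ x ∈ vs, (L x).length ≤ D := fun x hx => hD x ((hm x).1 hx)
  have hS₁ : Holds L ℓ s₁ {x | x ∈ vs} ∅ [] := by
    refine ⟨hB₀.frame hf₁ rfl, h₁.alive, ?_, ?_⟩
    · rw [hf₁.arr 5 rfl, hf₁.arr 6 rfl, hf₁.arr 7 rfl]
      exact hT
    · rw [hf₁.reg 4 rfl]
      exact ⟨by simp [hs₀], fun j hj => by simp at hj, fun j hj => by simp at hj⟩
  refine Run.mono (Run.frame (run_buildArcs hL h₁ hS₁ hDvs)) ?_
  rintro s₂ t₂ ⟨⟨l, h₂, hlen₂, ht₂⟩, hf₂⟩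
  have hl₂ : Listed vs s₂ := by
    refine ⟨?_, ?_, h₁.nodup, h₂.alive⟩
    · rw [hf₂.reg 3 rfl, h₁.reg_three]
    · rw [hf₂.arr 10 rfl]
      exact h₁.seg
  refine Run.mono (Run.frame (run_logPairs hl₂ h₂.log)) ?_
  rintro s₃ t₃ ⟨⟨r, h₃, hlen₃, hm₃, ht₃⟩, hf₃⟩
  have hU : {x | x ∈ vs} = closedNbhd₂ G v := Set.ext hm
  have hE : ({p | G.Adj p.1 p.2 ∧ p.1 ∈ vs ∧ p.2 ∈ vs} : Finset (Fin n × Fin n)) =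
      arcs ((⊤ : G.Subgraph).induce (closedNbhd₂ G v)) := by
    ext ⟨x, y⟩
    simp only [Finset.mem_filter, Finset.mem_univ, true_and, mem_arcs, hm,
      SimpleGraph.Subgraph.induce_adj, SimpleGraph.Subgraph.top_adj]
    tauto
  rw [hE, hU] at h₂
  have hsq : vs.length ≤ (D + 1) ^ 2 := by
    have := Nat.mul_le_mul_right (D + 1) hDv
    nlinarith
  refine ⟨vs, l ++ r, ⟨⟨h₂.base.frame hf₃ rfl, ?_, ?_, h₃⟩, fun x hx => (hm x).2 hx, ?_, ?_, ?_, ?_,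
    Nat.zero_le _, ?_, Nat.zero_le _⟩, ?_, ?_, h₁.nodup, hm, hlen, hsq, ?_⟩
  · rw [hf₃.arr 4 rfl]
    exact h₂.alive
  · rw [hf₃.arr 5 rfl, hf₃.arr 6 rfl, hf₃.arr 7 rfl]
    exact h₂.tables
  · rw [hf₃.reg 2 rfl, hf₂.reg 2 rfl, hf₁.reg 2 rfl]
    simp [hs₀, hv]
  · rw [hf₃.reg 3 rfl, hl₂.reg_three]
  · rw [hf₃.arr 10 rfl]
    exact hl₂.seg
  · rw [hf₃.reg 5 rfl, hf₂.reg 5 rfl, hf₁.reg 5 rfl]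
    simp [hs₀]
  · rw [hf₃.reg 6 rfl, hf₂.reg 6 rfl, hf₁.reg 6 rfl]
    simp [hs₀]
  · cases var with
    | vertex =>
      exact fun x hx _ => ⟨x, List.mem_append_right _ (hm₃ x ((hm x).2 hx) x ((hm x).2 hx))⟩
    | edge =>
      intro x y hxy _
      rw [mem_arcs] at hxy
      exact List.mem_append_right _ (hm₃ x ((hm x).2 hxy.fst_mem) y ((hm y).2 hxy.snd_mem))
  · exact fun x hx y hy _ _ _ => List.mem_append_right _ (hm₃ x ((hm x).2 hx) y ((hm y).2 hy))
  · have hca := card_arcs_le (H := (⊤ : G.Subgraph).induce (closedNbhd₂ G v)) hL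
      (fun x hx => (hm x).2 hx) hDvs
    have hnc : ((⊤ : G.Subgraph).induce (closedNbhd₂ G v)).verts.ncard ≤ vs.length := by
      rw [SimpleGraph.Subgraph.induce_verts, ← hU, ← List.coe_toFinset, Set.ncard_coe_finset]
      exact List.toFinset_card_le _
    set K := 1 + (L v).length * (D + 1) with hK
    have e₁ : vs.length * (D + 1) ^ 2 ≤ K * (D + 1) ^ 2 := Nat.mul_le_mul_right _ hlen
    have e₂ : vs.length * vs.length ≤ K * (D + 1) ^ 2 := Nat.mul_le_mul hlen hsq
    have e₃ : (D + 1) * (arcs ((⊤ : G.Subgraph).induce (closedNbhd₂ G v))).card ≤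
        K * (D + 1) ^ 2 := by
      calc _ ≤ (D + 1) * (vs.length * D) := Nat.mul_le_mul_left _ hca
        _ ≤ vs.length * (D + 1) ^ 2 := by nlinarith
        _ ≤ _ := e₁
    have e₄ : (D + 1) ^ 2 * ((⊤ : G.Subgraph).induce (closedNbhd₂ G v)).verts.ncard ≤
        K * (D + 1) ^ 2 := by
      rw [mul_comm]
      exact Nat.mul_le_mul_right _ (hnc.trans hlen)
    have e₅ : K ≤ K * (D + 1) ^ 2 := Nat.le_mul_of_pos_right _ (by positivity)
    have e₆ : 1 ≤ K := by omega
    have e₇ : vs.length * (2 * (D + 1) ^ 2) = 2 * (vs.length * (D + 1) ^ 2) := by ring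
    have e₈ : vs.length * (vs.length + 1) = vs.length * vs.length + vs.length := by ring
    simp only [pot, Expr.cost, List.length_append]
    omega

end

/-! ### The computation for a single vertex -/

/-- Put the size of `S_v` into register `8`. -/
def countAlive (abort : Bool) : Prog :=
  .assign 8 (.const 0) ;; .assign 25 (.const 0) ;;
  forSeg 25 3 27 10 (.assign 8 (.add (.reg 8) (.get 4 (.reg 27)))) ;;
  if abort then .ite (.get 4 (.reg 2)) .skip (.assign 8 (.const 0)) else .skip

/-- If the set `S_v` is larger than the best set so far, then it becomes the best set. -/
def saveBest : Prog :=
  .ite (.sub (.reg 8) (.reg 7))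
    (.assign 7 (.const 0) ;; .assign 25 (.const 0) ;;
      forSeg 25 3 27 10 (.ite (.get 4 (.reg 27))
        (.store 11 (.reg 7) (.reg 27) ;; .assign 7 (.add (.reg 7) (.const 1))) .skip))
    .skip

/-- Delete all vertices, so that all tables are zero again. -/
def cleanup : Prog := .assign 25 (.const 0) ;; forSeg 25 3 15 10 delVertex

/-- The computation of `S_v` for the vertex `v` in register `2`, and the update of the best set. -/
def processVertex (var : Variant) (abort : Bool) : Prog :=
  setup ;; ltr var ;; greedy var ;; countAlive abort ;; saveBest ;; cleanup

/-- The set `S` is stored as a list in array `11`, with its size in register `7`. -/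
def IsSaved {n : ℕ} (r : ℕ) (f : ℕ → ℕ) (S : Set (Fin n)) : Prop :=
  ∃ bl : List (Fin n), bl.Nodup ∧ r = bl.length ∧ Seg f 0 bl ∧ ∀ x, x ∈ bl ↔ x ∈ S

theorem ncard_eq_length {α : Type*} {l : List α} {S : Set α} (hl : l.Nodup)
    (h : ∀ x, x ∈ l ↔ x ∈ S) : S.ncard = l.length := by
  classical
  have : S = (l.toFinset : Set α) := by
    ext x
    simp [h]
  rw [this, Set.ncard_coe_finset, List.toFinset_card_of_nodup hl]

theorem IsSaved.ncard {n r : ℕ} {f : ℕ → ℕ} {S : Set (Fin n)} (h : IsSaved r f S) :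
    r = S.ncard := by
  obtain ⟨bl, hbl, rfl, -, hm⟩ := h
  exact (ncard_eq_length hbl hm).symm

/-- The graph represented is empty: all tables are zero. -/
structure Idle {n : ℕ} (L : Fin n → List (Fin n)) (ℓ : ℕ) (s : Mem) : Prop where
  base : Base L ℓ s
  alive : IsIndicator (n := n) (s.arr 4) ∅
  tables : Tables (n := n) (s.arr 5) (s.arr 6) (s.arr 7) ∅

section

variable {n ℓ D : ℕ} {G : SimpleGraph (Fin n)} {L : Fin n → List (Fin n)} {v : Fin n}
  {vs : List (Fin n)} {H : G.Subgraph} {l : List (Fin n × Fin n)} {p q : ℕ} {s : Mem}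

open Classical in
theorem run_countAlive (abort : Bool) (h : Work L ℓ v vs H l p q s) (hvs : vs.Nodup) :
    Run (countAlive abort) s fun s' t =>
      s'.reg 8 = (if abort = true ∧ v ∉ H.verts then ∅ else H.verts).ncard ∧
      t ≤ 30 * (1 + vs.length) := by
  simp only [countAlive, run_seq, run_assign, Expr.eval]
  refine Run.mono (Run.frame (Run.forSeg (l := vs) (p := 0) (fun pre s' =>
    s'.reg 8 = (pre.filter fun x => x ∈ H.verts).length) 5 (by decide) rfl (by simp) (by simp)
    (by simp [h.reg_three]) h.seg ?_ ?_)) ?_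
  · rintro r k pre s₁ (rfl | rfl) h₁ <;> simpa using h₁
  · rintro pre c post - s₁ h₁ hz hf₁
    have hA : IsIndicator (s₁.arr 4) H.verts := by
      rw [hf₁.arr 4 rfl]
      exact h.holds.alive
    simp only [run_assign, Expr.eval, hz, h₁, Mem.setReg_reg, if_true, List.filter_append,
      List.length_append, Expr.cost]
    by_cases hc : c ∈ H.verts
    · simp [hc, (hA c).1 hc]
    · simp [hc, (hA c).2 hc]
  · rintro s₁ t₁ ⟨⟨h₁, ht₁⟩, hf₁⟩
    have hn : H.verts.ncard = (vs.filter fun x => x ∈ H.verts).length :=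
      ncard_eq_length (hvs.filter _) fun x => by
        simpa using h.verts_subset x
    have hA : s₁.arr 4 v = s.arr 4 v := by rw [hf₁.arr 4 rfl]; rfl
    have hv : s₁.reg 2 = v := by rw [hf₁.reg 2 rfl]; simp [h.reg_two]
    have hI := h.holds.alive v
    cases abort with
    | false =>
      simp only [Bool.false_eq_true, if_false, false_and, run_skip, Expr.cost]
      exact ⟨h₁.trans hn.symm, by omega⟩
    | true =>
      simp only [if_true, run_ite, run_skip, run_assign, true_and, Expr.eval, hv, hA, Expr.cost]
      by_cases hvH : v ∈ H.verts
      · rw [if_neg (by rw [hI.1 hvH]; norm_num), if_neg (not_not.2 hvH)]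
        exact ⟨h₁.trans hn.symm, by omega⟩
      · rw [if_pos (hI.2 hvH), if_pos hvH]
        exact ⟨by simp, by omega⟩

open Classical in
theorem run_saveBest (h : Work L ℓ v vs H l p q s) (hvs : vs.Nodup) {S T : Set (Fin n)}
    (hS : IsSaved (s.reg 7) (s.arr 11) S) (h8 : s.reg 8 = T.ncard) (hT : T = ∅ ∨ T = H.verts) :
    Run saveBest s fun s' t =>
      IsSaved (s'.reg 7) (s'.arr 11) (if S.ncard < T.ncard then T else S) ∧
      t ≤ 40 * (1 + vs.length) := by
  simp only [saveBest, run_ite, run_seq, run_assign, run_skip, Expr.eval, h8, hS.ncard]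
  by_cases hlt : S.ncard < T.ncard
  · have hTH : T = H.verts := hT.resolve_left fun h => by simp [h] at hlt
    rw [if_neg (by omega), if_pos hlt]
    refine Run.mono (Run.forSeg (l := vs) (p := 0) (fun pre s' =>
      s'.reg 7 = (pre.filter fun x => x ∈ H.verts).length ∧
      Seg (s'.arr 11) 0 (pre.filter fun x => x ∈ H.verts)) 20 (by decide) rfl
      ⟨by simp, fun j hj => by simp at hj⟩ (by simp) (by simp [h.reg_three]) h.seg ?_ ?_) ?_
    · rintro r k pre s₁ (rfl | rfl) h₁ <;> simpa using h₁
    · rintro pre c post - s₁ ⟨h₁, h₂⟩ hz hf₁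
      have hA : IsIndicator (s₁.arr 4) H.verts := by
        rw [hf₁.arr 4 rfl]
        exact h.holds.alive
      simp only [run_ite, run_seq, run_store, run_assign, run_skip, Expr.eval, hz]
      by_cases hc : c ∈ H.verts
      · rw [if_neg (by rw [(hA c).1 hc]; norm_num)]
        have := h₂.append_singleton c
        simp only [List.filter_append, List.filter_singleton, hc, decide_true, Expr.cost]
        refine ⟨⟨by simp [h₁], ?_⟩, by norm_num⟩
        simpa [h₁] using this
      · rw [if_pos ((hA c).2 hc)]
        simp only [List.filter_append, List.filter_singleton, hc, decide_false, Expr.cost]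
        exact ⟨⟨by simpa using h₁, by simpa using h₂⟩, by norm_num⟩
    · rintro s₁ t₁ ⟨⟨h₁, h₂⟩, ht₁⟩
      refine ⟨⟨_, hvs.filter _, h₁, h₂, fun x => ?_⟩, ?_⟩
      · rw [hTH]
        simpa using h.verts_subset x
      · simp only [Expr.cost]
        omega
  · rw [if_pos (by omega), if_neg hlt]
    have hS' := hS
    rw [hS.ncard] at hS'
    refine ⟨hS', ?_⟩
    simp only [Expr.cost]
    omega

theorem run_cleanup (hL : IsAdjLists G L) (hD : ∀ x ∈ vs, (L x).length ≤ D)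
    (h : Work L ℓ v vs H l p q s) :
    Run cleanup s fun s' t => Idle L ℓ s' ∧ t ≤ 520 * (1 + vs.length * (D + 1) ^ 2) := by
  simp only [cleanup, run_seq, run_assign, Expr.eval]
  refine Run.mono (Run.forSeg (l := vs) (p := 0) (fun pre s' => ∃ (H' : G.Subgraph) (l' : _),
    Holds L ℓ s' H'.verts (arcs H') l' ∧ H'.verts = H.verts \ {x | x ∈ pre}) (500 * (D + 1) ^ 2)
    (by decide) rfl ⟨H, l, h.holds.setReg _ (by decide), by simp⟩ (by simp)
    (by simp [h.reg_three]) h.seg ?_ ?_) ?_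
  · rintro r k pre s₁ hr ⟨H', l', h₁, h₂⟩
    exact ⟨H', l', h₁.setReg k (by omega), h₂⟩
  · rintro pre c post hpre s₁ ⟨H₁, l₁, h₁, hv₁⟩ hz hf₁
    refine (TriangleClub.run_delVertex (D := D) hL (fun u w huw => (mem_arcs.1 huw).adj_sub)
      (fun u w huw => mem_arcs.2 (mem_arcs.1 huw).symm) h₁ hz (hD c (by simp [hpre]))
      fun u hu => hD u (h.verts_subset u ?_)).mono ?_
    · have : u ∈ H₁.verts := (mem_arcs.1 hu).snd_mem
      rw [hv₁] at this
      exact this.1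
    · rintro s₂ t₂ ⟨r, h₂, -, -, ht₂⟩
      rw [← arcs_deleteVerts] at h₂
      refine ⟨⟨H₁.deleteVerts {c}, _, h₂, ?_⟩, ht₂⟩
      rw [SimpleGraph.Subgraph.deleteVerts_verts, hv₁]
      ext x
      simp only [Set.mem_sdiff, Set.mem_ofPred_eq, Set.mem_singleton_iff, List.mem_append,
        List.mem_singleton]
      tauto
  · rintro s₁ t₁ ⟨⟨H₁, l₁, h₁, hv₁⟩, ht₁⟩
    have hempty : H₁.verts = ∅ := by
      rw [hv₁]
      ext x
      simpa using h.verts_subset x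
    have harcs : arcs H₁ = ∅ := by
      ext ⟨x, y⟩
      simp only [mem_arcs, Finset.notMem_empty, iff_false]
      intro hxy
      have := hxy.fst_mem
      rw [hempty] at this
      exact this
    rw [hempty, harcs] at h₁
    refine ⟨⟨h₁.base, h₁.alive, h₁.tables⟩, ?_⟩
    have : vs.length * (500 * (D + 1) ^ 2 + 11) ≤ 511 * (vs.length * (D + 1) ^ 2) := by
      nlinarith [Nat.one_le_pow 2 (D + 1) (Nat.succ_pos D), Nat.zero_le vs.length]
    simp only [Expr.cost]
    omega

theorem run_processVertex (var : Variant) (abort : Bool) (hL : IsAdjLists G L) (h : Idle L ℓ s)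
    (hv : s.reg 2 = v) {S : Set (Fin n)} (hS : IsSaved (s.reg 7) (s.arr 11) S)
    (hD : ∀ x ∈ closedNbhd₂ G v, (L x).length ≤ D) :
    Run (processVertex var abort) s fun s' t => Idle L ℓ s' ∧
      (∃ T, IsLocalGLB G ℓ var abort v T ∧
        IsSaved (s'.reg 7) (s'.arr 11) (if S.ncard < T.ncard then T else S)) ∧
      t ≤ 12000 * ((1 + (L v).length * (D + 1)) * (D + 1) ^ 2) := by
  classical
  have keep : ∀ {p : Prog} {s s' : Mem}, Frame p s s' → (p.wr 7 || p.wa 11) = false →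
      IsSaved (s.reg 7) (s.arr 11) S → IsSaved (s'.reg 7) (s'.arr 11) S := by
    intro p s s' hf hw hS
    rw [Bool.or_eq_false_iff] at hw
    rw [hf.reg 7 hw.1, hf.arr 11 hw.2]
    exact hS
  simp only [processVertex, run_seq]
  refine Run.mono (Run.frame (run_setup var hL h.base hv h.alive h.tables hD)) ?_
  rintro s₁ t₁ ⟨⟨vs, l₁, hW₁, hlow₁, hcon₁, hvs, hm, hlen, hsq, ht₁⟩, hf₁⟩
  have hS₁ := keep hf₁ rfl hS
  have hDvs : ∀ x ∈ vs, (L x).length ≤ D := fun x hx => hD x ((hm x).1 hx)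
  refine Run.mono (Run.frame (run_ltr (D := D) var hL hDvs hW₁ hlow₁ hcon₁)) ?_
  rintro s₂ t₂ ⟨⟨H₂, l₂, hLTR, hW₂, hlow₂, hcon₂, ht₂⟩, hf₂⟩
  have hS₂ := keep hf₂ (by cases var <;> rfl) hS₁
  refine Run.mono (Run.frame (run_greedy (D := D) var hL hDvs hsq hW₂ hlow₂ hcon₂)) ?_
  rintro s₃ t₃ ⟨⟨H₃, l₃, hrounds, hbot, hW₃, ht₃⟩, hf₃⟩
  have hS₃ := keep hf₃ (by cases var <;> rfl) hS₂
  refine Run.mono (Run.frame (run_countAlive abort hW₃ hvs)) ?_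
  rintro s₄ t₄ ⟨⟨h₈, ht₄⟩, hf₄⟩
  have hS₄ := keep hf₄ (by cases abort <;> rfl) hS₃
  have hW₄ : Work L ℓ v vs H₃ l₃ l₃.length l₃.length s₄ := by
    have := hW₃.frame (H' := H₃) (r := []) hf₄ (by cases abort <;> rfl) ?_ subset_rfl
    · simpa using this
    · rw [List.append_nil]
      exact hW₃.holds.of_eq
        ⟨hf₄.reg 0 (by cases abort <;> rfl), hf₄.reg 1 (by cases abort <;> rfl),
          hf₄.reg 4 (by cases abort <;> rfl)⟩
        fun a ha _ => hf₄.arr a (by cases abort <;> rfl)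
  set T := if abort = true ∧ v ∉ H₃.verts then ∅ else H₃.verts with hT
  refine Run.mono (Run.frame (run_saveBest (T := T) hW₄ hvs hS₄ h₈ ?_)) ?_
  · rw [hT]
    split_ifs <;> simp
  rintro s₅ t₅ ⟨⟨hS₅, ht₅⟩, hf₅⟩
  have hW₅ : Work L ℓ v vs H₃ l₃ l₃.length l₃.length s₅ := by
    have := hW₄.frame (H' := H₃) (r := []) hf₅ rfl ?_ subset_rfl
    · simpa using this
    · rw [List.append_nil]
      refine hW₄.holds.of_eq ⟨hf₅.reg 0 rfl, hf₅.reg 1 rfl, hf₅.reg 4 rfl⟩ fun a ha _ =>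
        hf₅.arr a ?_
      interval_cases a <;> rfl
  refine Run.mono (Run.frame (run_cleanup hL hDvs hW₅)) ?_
  rintro s₆ t₆ ⟨⟨hI, ht₆⟩, hf₆⟩
  refine ⟨hI, ⟨T, ⟨H₂, hLTR, GreedyRun.of_rounds abort hrounds hbot⟩, ?_⟩, ?_⟩
  · rw [hf₆.reg 7 rfl, hf₆.arr 11 rfl]
    exact hS₅
  · set K := 1 + (L v).length * (D + 1) with hK
    have e₁ : vs.length * (D + 1) ^ 2 ≤ K * (D + 1) ^ 2 := Nat.mul_le_mul_right _ hlen
    have e₅ : K ≤ K * (D + 1) ^ 2 := Nat.le_mul_of_pos_right _ (by positivity)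
    have e₆ : 1 ≤ K := by omega
    omega

end

/-! ### The whole program -/

/-- Compute the table of row offsets `x * n`. -/
def rowOffsets : Prog :=
  .assign 2 (.const 0) ;;
  .loop (.sub (.reg 0) (.reg 2))
    ((.store 3 (.reg 2) (.reg 9) ;; .assign 9 (.add (.reg 9) (.reg 0))) ;;
      .assign 2 (.add (.reg 2) (.const 1)))

/-- The loop over all vertices. -/
def allVertices (var : Variant) (abort : Bool) : Prog :=
  .assign 2 (.const 0) ;;
  .loop (.sub (.reg 0) (.reg 2)) (processVertex var abort ;; .assign 2 (.add (.reg 2) (.const 1)))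

/-- Write the best set in the format of `IsOutput`. -/
def output : Prog :=
  .assign 25 (.const 0) ;; forSeg 25 7 27 11 (.store 2 (.reg 27) (.const 1)) ;; .assign 0 (.reg 7)

/-- The Greedy Lower Bound on the machine. -/
def glb (var : Variant) (abort : Bool) : Prog :=
  rowOffsets ;; allVertices var abort ;; output

section

variable {n ℓ D : ℕ} {G : SimpleGraph (Fin n)} {L : Fin n → List (Fin n)} {s : Mem}

theorem isInput_input (L : Fin n → List (Fin n)) (ℓ : ℕ) :
    IsInput L ((input L ℓ).arr 0) ((input L ℓ).arr 1) := by
  intro x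
  obtain ⟨A, B, hAB, hA⟩ : ∃ A B, List.finRange n = A ++ x :: B ∧ (List.finRange n).take x = A := by
    have hx : (x : ℕ) < (List.finRange n).length := by simp
    refine ⟨_, (List.finRange n).drop (x + 1), ?_, rfl⟩
    conv_lhs => rw [← List.take_append_drop x (List.finRange n), List.drop_eq_getElem_cons hx]
    simp
  have hoff : ∀ i : ℕ, i ≤ n → (∑ v : Fin n, if v.val < i then (L v).length else 0) =
      (((List.finRange n).take i).flatMap fun v => (L v).map Fin.val).length := by
    intro i
    induction i with
    | zero => simp
    | succ i ih =>
      intro hi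
      have hi' : i < n := hi
      have hsum : (∑ v : Fin n, if v.val < i + 1 then (L v).length else 0) =
          (∑ v : Fin n, if v.val < i then (L v).length else 0) + (L ⟨i, hi'⟩).length := by
        have : ∀ v : Fin n, (if v.val < i + 1 then (L v).length else 0) =
            (if v.val < i then (L v).length else 0) +
              (if v = ⟨i, hi'⟩ then (L v).length else 0) := by
          intro v
          simp only [Fin.ext_iff]
          split_ifs <;> omega
        rw [Finset.sum_congr rfl fun v _ => this v, Finset.sum_add_distrib]
        simp
      rw [hsum, ih hi'.le, List.take_succ_eq_append_getElem (by simpa using hi'),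
        List.flatMap_append, List.length_append]
      simp
  refine ⟨?_, fun j hj => ?_⟩
  · have h₀ := hoff x x.2.le
    have h₁ := hoff (x + 1) x.2
    rw [List.take_succ_eq_append_getElem (by simp), List.flatMap_append, List.length_append,
      ← h₀] at h₁
    simpa [input] using h₁
  · have h₀ := hoff x x.2.le
    simp only [input, one_ne_zero, if_false, if_true]
    rw [h₀, hA, hAB, List.flatMap_append, List.getD_append_right _ _ _ _ (Nat.le_add_right _ _),
      Nat.add_sub_cancel_left, List.flatMap_cons, List.getD_append _ _ _ _ (by simpa using hj)]
    simp [hj]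

theorem run_rowOffsets (L : Fin n → List (Fin n)) (ℓ : ℕ) :
    Run rowOffsets (input L ℓ) fun s t => Base L ℓ s ∧ t ≤ 20 * (n + 1) := by
  simp only [rowOffsets, run_seq, run_assign, Expr.eval]
  refine Run.mono (Run.frame (Run.forRange (m := n) (fun j s' =>
    s'.reg 9 = j * n ∧ s'.reg 0 = n ∧ ∀ i < j, s'.arr 3 i = i * n) (fun _ => 8) (by decide) rfl
    (by simp [input]) (by simp) (by simp [input]) ?_ ?_)) ?_
  · intro k j s' h
    simpa using h
  · rintro j hj s₁ ⟨h₉, h₀, h₃⟩ h₂ -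
    simp only [run_seq, run_store, run_assign, Expr.eval, h₂, h₉, Mem.setArr_reg, h₀, Expr.cost]
    refine ⟨⟨by simp [add_mul], by simp [h₀], fun i hi => ?_⟩, by norm_num⟩
    simp only [Mem.setReg_arr, Mem.setArr_arr, if_true, Function.update_apply]
    split_ifs with h
    · rw [h]
    · exact h₃ i (by omega)
  · rintro s₁ t ⟨⟨⟨h₉, h₀, h₃⟩, ht⟩, hf⟩
    refine ⟨⟨h₀, ?_, ?_, fun x => h₃ x x.2⟩, ?_⟩
    · rw [hf.reg 1 rfl]
      simp [input]
    · rw [hf.arr 0 rfl, hf.arr 1 rfl]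
      exact isInput_input L ℓ
    · simp only [Finset.sum_const, Finset.card_range, smul_eq_mul, Expr.cost] at ht ⊢
      omega

theorem idle_of_input (h : Base L ℓ s) (h₄ : s.arr 4 = (input L ℓ).arr 4)
    (h₅ : s.arr 5 = (input L ℓ).arr 5) (h₆ : s.arr 6 = (input L ℓ).arr 6)
    (h₇ : s.arr 7 = (input L ℓ).arr 7) : Idle L ℓ s := by
  refine ⟨h, fun x => ?_, fun x y => ?_, fun x y => ?_, fun x => ?_⟩
  · simp [h₄, input]
  · simp [h₅, input]
  · simp [h₆, input, cnt]
  · simp [h₇, input, tri]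

theorem run_allVertices (var : Variant) (abort : Bool) (hL : IsAdjLists G L) (h : Idle L ℓ s)
    (hn : 0 < n) (hS : IsSaved (n := n) (s.reg 7) (s.arr 11) ∅) (D : Fin n → ℕ)
    (hD : ∀ v, ∀ x ∈ closedNbhd₂ G v, (L x).length ≤ D v) :
    Run (allVertices var abort) s fun s' t =>
      (∃ S, IsGLB G ℓ var abort S ∧ IsSaved (s'.reg 7) (s'.arr 11) S) ∧
      t ≤ ∑ v, 12000 * ((1 + (L v).length * (D v + 1)) * (D v + 1) ^ 2) + 8 * n + 10 := by
  simp only [allVertices, run_seq, run_assign, Expr.eval]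
  refine Run.mono (Run.forRange (m := n) (fun j s' => Idle L ℓ s' ∧ ∃ S,
    IsSaved (s'.reg 7) (s'.arr 11) S ∧ (j = 0 → S = ∅) ∧ ∃ T : Fin n → Set (Fin n),
      (∀ v : Fin n, v < j → IsLocalGLB G ℓ var abort v (T v)) ∧
      (0 < j → ∃ v : Fin n, v < j ∧ S = T v) ∧ ∀ v : Fin n, v < j → (T v).ncard ≤ S.ncard)
    (fun j => if hj : j < n then 12000 * ((1 + (L ⟨j, hj⟩).length * (D ⟨j, hj⟩ + 1)) *
      (D ⟨j, hj⟩ + 1) ^ 2) else 0) (by decide) (by cases var <;> cases abort <;> rfl)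
    ⟨?_, ∅, ?_, fun _ => rfl, fun _ => ∅, ?_, ?_, ?_⟩ (by simp) (by simp [h.base.reg_zero])
    ?_ ?_) ?_
  · exact ⟨h.base.of_eq (by simp) (by simp) rfl rfl rfl, h.alive, h.tables⟩
  · simpa using hS
  · intro v hv
    simp at hv
  · intro hv
    simp at hv
  · intro v hv
    simp at hv
  · rintro k j s₁ ⟨h₁, S, h₂, h₃⟩
    exact ⟨⟨h₁.base.of_eq (by simp) (by simp) rfl rfl rfl, h₁.alive, h₁.tables⟩, S,
      by simpa using h₂, h₃⟩
  · rintro j hj s₁ ⟨h₁, S, hS₁, h₀, T, hT, hST, hmax⟩ hr -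
    refine (run_processVertex var abort hL h₁ (v := ⟨j, hj⟩) hr hS₁ (hD ⟨j, hj⟩)).mono ?_
    rintro s₂ t ⟨h₂, ⟨R, hR, hS₂⟩, ht⟩
    refine ⟨⟨h₂, _, hS₂, by simp, Function.update T ⟨j, hj⟩ R, ?_, fun _ => ?_, ?_⟩, ?_⟩
    · intro v hv
      rcases eq_or_ne v ⟨j, hj⟩ with rfl | hne
      · simpa using hR
      · rw [Function.update_of_ne hne]
        have : (v : ℕ) ≠ j := fun h => hne (Fin.ext h)
        exact hT v (by omega)
    · by_cases hlt : S.ncard < R.ncard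
      · exact ⟨⟨j, hj⟩, Nat.lt_succ_self j, by simp [hlt]⟩
      · rw [if_neg hlt]
        rcases Nat.eq_zero_or_pos j with rfl | hpos
        · refine ⟨⟨0, hj⟩, Nat.one_pos, ?_⟩
          rw [Function.update_self, h₀ rfl]
          rw [h₀ rfl, Set.ncard_empty] at hlt
          exact ((Set.ncard_eq_zero (Set.toFinite R)).1 (by omega)).symm
        · obtain ⟨v, hv, rfl⟩ := hST hpos
          refine ⟨v, by omega, ?_⟩
          rw [Function.update_of_ne]
          rintro rfl
          exact lt_irrefl _ hv
    · intro v hv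
      have hSle : S.ncard ≤ (if S.ncard < R.ncard then R else S).ncard := by
        split_ifs <;> omega
      have hRle : R.ncard ≤ (if S.ncard < R.ncard then R else S).ncard := by
        split_ifs <;> omega
      rcases eq_or_ne v ⟨j, hj⟩ with rfl | hne
      · simpa using hRle
      · rw [Function.update_of_ne hne]
        have : (v : ℕ) ≠ j := fun h => hne (Fin.ext h)
        exact (hmax v (by omega)).trans hSle
    · rw [dif_pos hj]
      exact ht
  · rintro s₁ t ⟨⟨h₁, S, hS₁, -, T, hT, hST, hmax⟩, ht⟩
    obtain ⟨v, -, hSv⟩ := hST hn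
    refine ⟨⟨S, ⟨T, fun v => hT v v.2, ⟨v, hSv⟩, fun v => hmax v v.2⟩, hS₁⟩, ?_⟩
    rw [Finset.sum_add_distrib, Finset.sum_range] at ht
    simp only [Fin.is_lt, dite_true, Fin.eta, Finset.sum_const, Finset.card_range,
      smul_eq_mul] at ht
    simp only [Expr.cost]
    omega

theorem run_output {S : Set (Fin n)} (hS : IsSaved (s.reg 7) (s.arr 11) S)
    (h₂ : ∀ i, s.arr 2 i = 0) :
    Run output s fun s' t => IsOutput s' S ∧ t ≤ 20 * (n + 1) := by
  obtain ⟨bl, hbl, h₇, hseg, hm⟩ := hS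
  simp only [output, run_seq, run_assign, Expr.eval]
  refine Run.mono (Run.frame (Run.forSeg (l := bl) (p := 0) (fun pre s' => ∀ v : Fin n,
    (v ∈ pre → s'.arr 2 v = 1) ∧ (v ∉ pre → s'.arr 2 v = 0)) 5 (by decide) rfl
    (by simp [h₂]) (by simp) (by simp [h₇]) hseg ?_ ?_)) ?_
  · rintro r k pre s₁ - h₁
    exact h₁
  · rintro pre c post - s₁ h₁ hz -
    simp only [run_store, Expr.eval, hz, Mem.setArr_arr, if_true, Function.update_apply,
      ← Fin.ext_iff, Expr.cost]
    refine ⟨fun v => ?_, by norm_num⟩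
    have := h₁ v
    split_ifs with hv
    · simp [hv]
    · simpa [hv] using this
  · rintro s₁ t ⟨⟨h₁, ht⟩, hf⟩
    refine ⟨⟨?_, fun v => ?_⟩, ?_⟩
    · rw [ncard_eq_length hbl hm, ← h₇]
      simp [hf.reg 7 rfl]
    · rw [← hm v]
      exact h₁ v
    · have : bl.length ≤ n := by simpa using hbl.length_le_card
      simp only [Expr.cost]
      omega

/-- The local degree bounds `D` need not be uniform; isolated vertices have to be cheap. -/
theorem run_glb (var : Variant) (abort : Bool) (hL : IsAdjLists G L) (hn : 0 < n) (D : Fin n → ℕ)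
    (hD : ∀ v, ∀ x ∈ closedNbhd₂ G v, (L x).length ≤ D v) :
    Run (glb var abort) (input L ℓ) fun s t => (∃ S, IsGLB G ℓ var abort S ∧ IsOutput s S) ∧
      t ≤ 12000 * ∑ v, (1 + (L v).length * (D v + 1)) * (D v + 1) ^ 2 + 100 * n := by
  simp only [glb, run_seq]
  refine Run.mono (Run.frame (run_rowOffsets L ℓ)) ?_
  rintro s₁ t₁ ⟨⟨hB, ht₁⟩, hf₁⟩
  have hI := idle_of_input hB (hf₁.arr 4 rfl) (hf₁.arr 5 rfl) (hf₁.arr 6 rfl) (hf₁.arr 7 rfl)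
  refine Run.mono (Run.frame (run_allVertices var abort hL hI hn ?_ D hD)) ?_
  · refine ⟨[], List.nodup_nil, ?_, fun j hj => by simp at hj, by simp⟩
    rw [hf₁.reg 7 rfl]
    simp [input]
  rintro s₂ t₂ ⟨⟨⟨S, hS, hS₂⟩, ht₂⟩, hf₂⟩
  refine (run_output hS₂ fun i => ?_).mono ?_
  · rw [hf₂.arr 2 (by cases var <;> cases abort <;> rfl), hf₁.arr 2 rfl]
    simp [input]
  · rintro s₃ t₃ ⟨hO, ht₃⟩
    refine ⟨⟨S, hS, hO⟩, ?_⟩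
    rw [← Finset.mul_sum] at ht₂
    omega

end

/-! ### The running time -/

theorem one_le_degeneracy {n : ℕ} {G : SimpleGraph (Fin n)} {u w : Fin n} (h : G.Adj u w) :
    1 ≤ degeneracy G := by
  -- the set in the definition is nonempty, so that its infimum is not a junk value
  have hne : {d | ∀ S : Set (Fin n), S.Nonempty →
      ∃ v ∈ S, (G.neighborSet v ∩ S).ncard ≤ d}.Nonempty :=
    ⟨n, fun S ⟨v, hv⟩ => ⟨v, hv, by
      simpa using Set.ncard_le_ncard (Set.subset_univ (G.neighborSet v ∩ S))⟩⟩
  have hmem : degeneracy G ∈ {d | ∀ S : Set (Fin n), S.Nonempty →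
      ∃ v ∈ S, (G.neighborSet v ∩ S).ncard ≤ d} := Nat.sInf_mem hne
  by_contra h₀
  have h₀ : degeneracy G = 0 := by omega
  rw [h₀] at hmem
  obtain ⟨v, hv, hc⟩ := hmem {u, w} ⟨u, by simp⟩
  rw [Nat.le_zero, Set.ncard_eq_zero (Set.toFinite _)] at hc
  rcases hv with rfl | rfl
  · exact Set.notMem_empty w (hc ▸ ⟨h, by simp⟩)
  · exact Set.notMem_empty u (hc ▸ ⟨h.symm, by simp⟩)

theorem length_eq_degree {n : ℕ} {G : SimpleGraph (Fin n)} [DecidableRel G.Adj]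
    {L : Fin n → List (Fin n)} (hL : IsAdjLists G L) (v : Fin n) : (L v).length = G.degree v := by
  rw [← List.toFinset_card_of_nodup (hL v).1, ← SimpleGraph.card_neighborFinset_eq_degree]
  congr 1
  ext w
  simp [(hL v).2 w]

end TriangleClub

theorem mainTheorem4 (var : TriangleClub.Variant) (abort : Bool) :
    ∃ (P : RAM.Prog) (C : ℕ),
      ∀ (n : ℕ) (_hn : 0 < n) (G : SimpleGraph (Fin n)) [DecidableRel G.Adj] (ℓ : ℕ)
        (L : Fin n → List (Fin n)) (_hL : TriangleClub.IsAdjLists G L),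
        ∃ (s : RAM.Mem) (t : ℕ) (S : Set (Fin n)),
          RAM.Exec P (TriangleClub.input L ℓ) s t ∧
          TriangleClub.IsGLB G ℓ var abort S ∧ TriangleClub.IsOutput s S ∧
          ((∀ v, ∃ w, G.Adj v w) →
            t ≤ C * (G.edgeFinset.card * G.maxDegree ^ 3 * TriangleClub.degeneracy G ^ 2)) ∧
          t ≤ C * (n + G.edgeFinset.card * G.maxDegree ^ 3 * TriangleClub.degeneracy G ^ 2) := by
  refine ⟨TriangleClub.glb var abort, 600000, fun n hn G _ ℓ L hL => ?_⟩
  -- `N₂[v]` of an isolated vertex is `{v}`, so that the degree bound `0` is valid for it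
  let D : Fin n → ℕ := fun v => if (L v).length = 0 then 0 else G.maxDegree
  obtain ⟨s, t, hexec, ⟨S, hS, hO⟩, ht⟩ :=
      TriangleClub.run_glb (ℓ := ℓ) var abort hL hn D fun v x hx => by
    by_cases h₀ : (L v).length = 0
    · have hnone : ∀ w, ¬ G.Adj v w := fun w hw => by
        have := ((hL v).2 w).2 hw
        rw [List.length_eq_zero_iff.1 h₀] at this
        simp at this
      have hxv : x = v := by
        rcases hx with (hx | hx) | ⟨w, hw⟩
        · exact hx
        · exact absurd hx (hnone x)
        · exact absurd hw.1 (hnone w)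
      simp [D, hxv, h₀]
    · simp only [D, h₀, if_false]
      rw [TriangleClub.length_eq_degree hL]
      exact G.degree_le_maxDegree x
  refine ⟨s, t, S, hexec, hS, hO, ?_⟩
  have hterm : ∀ v, (1 + (L v).length * (D v + 1)) * (D v + 1) ^ 2 ≤
      1 + 12 * (G.degree v * G.maxDegree ^ 3) := by
    intro v
    by_cases h₀ : (L v).length = 0
    · simp [show D v = 0 by simp only [D, h₀, if_true], h₀]
    · simp only [D, h₀, if_false]
      rw [TriangleClub.length_eq_degree hL] at h₀ ⊢
      have hΔ : 1 ≤ G.maxDegree := (Nat.one_le_iff_ne_zero.2 h₀).trans (G.degree_le_maxDegree v)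
      have h₁ : 1 + G.degree v * (G.maxDegree + 1) ≤ 3 * (G.degree v * G.maxDegree) := by
        nlinarith [Nat.one_le_iff_ne_zero.2 h₀]
      have h₂ : (G.maxDegree + 1) ^ 2 ≤ 4 * G.maxDegree ^ 2 := by nlinarith
      calc _ ≤ 3 * (G.degree v * G.maxDegree) * (4 * G.maxDegree ^ 2) := Nat.mul_le_mul h₁ h₂
        _ = 12 * (G.degree v * G.maxDegree ^ 3) := by ring
        _ ≤ _ := by omega
  have hsum : ∑ v, (1 + (L v).length * (D v + 1)) * (D v + 1) ^ 2 ≤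
      n + 24 * (G.edgeFinset.card * G.maxDegree ^ 3) := by
    refine (Finset.sum_le_sum fun v _ => hterm v).trans ?_
    rw [Finset.sum_add_distrib, ← Finset.mul_sum, ← Finset.sum_mul,
      G.sum_degrees_eq_twice_card_edges]
    simp only [Finset.sum_const, Finset.card_univ, Fintype.card_fin, smul_eq_mul, mul_one]
    apply le_of_eq
    ring
  have hd : G.edgeFinset.card * G.maxDegree ^ 3 ≤
      G.edgeFinset.card * G.maxDegree ^ 3 * TriangleClub.degeneracy G ^ 2 := by
    rcases Finset.eq_empty_or_nonempty G.edgeFinset with h₀ | ⟨e, he⟩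
    · simp [h₀]
    · induction e with
      | _ u w =>
        rw [SimpleGraph.mem_edgeFinset, SimpleGraph.mem_edgeSet] at he
        exact Nat.le_mul_of_pos_right _ (Nat.pow_pos (TriangleClub.one_le_degeneracy he))
  refine ⟨fun hiso => ?_, by omega⟩
  have hdeg : ∀ v, 1 ≤ G.degree v := fun v => (G.degree_pos_iff_exists_adj v).2 (hiso v)
  have hn2 : n ≤ 2 * G.edgeFinset.card := by
    rw [← G.sum_degrees_eq_twice_card_edges]
    simpa using Finset.sum_le_sum fun v (_ : v ∈ Finset.univ) => hdeg v
  have hΔ : 1 ≤ G.maxDegree := (hdeg ⟨0, hn⟩).trans (G.degree_le_maxDegree _)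
  have hm : G.edgeFinset.card ≤ G.edgeFinset.card * G.maxDegree ^ 3 :=
    Nat.le_mul_of_pos_right _ (Nat.pow_pos hΔ)
  omega
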